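/- Let $\mathbb{R}^{4,1}$ be $\mathbb{R}^5$ with the Lorentzian product $x\circ y=x_1y_1+\dots+x_4y_4-x_5y_5$ and $\mathbb{H}^4=\{x : x\circ x=-1,\ x_5>0\}$. Let $T\subset\mathbb{H}^4$ be the compact totally truncated Coxeter simplex: its facets have outward unit normals $e_1,\dots,e_5$ and $v_1,\dots,v_5$, where $e_i\circ e_j=-\cos(\pi/m_{ij})$ with $m_{ii}=1$, $m_{12}=m_{34}=5$, $m_{14}=m_{23}=m_{25}=m_{45}=3$ and $m_{ij}=2$ for the other pairs, and where $v_i\circ v_i=1$, $v_i\circ e_j=0$ for $j\ne i$, $v_i\circ e_i<0$. The facet of $T$ with normal $v_i$ is called an orthogonal facet; it is of type $A$ for $i\in\{1,3\}$, of type $B$ for $i\in\{2,4\}$ and of type $C$ for $i=5$. An $(\ell,m,n)$-domino is a Coxeter polytope in $\mathbb{H}^4$ obtained from $n+1$ copies of $T$ by gluing $n$ times along orthogonal facets of the same type: $\ell$ times along type $A$, $m$ times along type $B$, and $n-\ell-m$ times along type $C$. The growth rate of a domino is $\limsup_{k\to\infty}\sqrt[k]{a_k}$, where $a_k$ is the number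 of elements of word length $k$ in the group generated by the reflections in the facets of the domino, with respect to these reflections. Call a triple $(\ell,m,n)$ of non-negative integers admissible if $\ell+m\le n$, and $n-\ell-m\le (n+1)/2$ if $n$ is odd, and $n-\ell-m\le n/2$ if $n$ is even. Let $$\begin{aligned} Q_{\ell,m,n}(t)={}&t^{18}-(4n+6)t^{17}+(2n-m+3)t^{16}-(3n-m+\ell+5)t^{15}+(5n-3m+5)t^{14}\\ &-(n-4m+1)t^{13}+(8n-4m+\ell+9)t^{12}+(5m-\ell)t^{11}+(10n-5m+\ell+11)t^{10}\\ &-(2n-6m+2)t^{9}+(10n-5m+\ell+11)t^{8}+(5m-\ell)t^{7}+(8n-4m+\ell+9)t^{6}\\ &-(n-4m+1)t^{5}+(5n-3m+5)t^{4}-(3n-m+\ell+5)t^{3}+(2n-m+3)t^{2}-(4n+6)t+1 . \end{aligned}$$ Theorem. For every admissible $(\ell,m,n)$ there is an $(\ell,m,n)$-domino, and all $(\ell,m,n)$-dominoes have the same growth rate, denoted by $\tau_{\ell,m,n}$. Moreover: (1) The $18$ complex roots of $Q_{\ell,m,n}$ are simple; they consist of exactly seven pairs $\omega_i,\overline{\omega_i}$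 of non-real roots on the unit circle and exactly two reciprocal pairs $\alpha,1/\alpha$ and $\beta,1/\beta$ of real roots. (2) $0<1/\alpha<1/\beta<1<\beta<\alpha=\tau_{\ell,m,n}$, and $4n+5<\tau_{\ell,m,n}<4n+m+\ell+6$. In particular $\tau_{\ell,m,n}\to\infty$ as $n\to\infty$, uniformly in the admissible $\ell,m$. (3) $Q_{\ell,m,n}$ has no factor of degree two in $\mathbb{Z}[t]$. -/

import Mathlib

open Polynomial Filter

/-! ### Growth rate of a group with respect to a generating set -/

section Growth

/-- `w` is a product of `k` elements of `S`, and of no fewer: `l_S(w) = k`. -/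
def HasWordLength {G : Type*} [Group G] (S : Set G) (w : G) (k : ℕ) : Prop :=
  IsLeast {j : ℕ | ∃ l : List G, l.length = j ∧ (∀ s ∈ l, s ∈ S) ∧ l.prod = w} k

/-- The number `a_k` of elements of word length `k`. It is used for sets `S` of involutions, where
the elements having a word length are exactly those of the subgroup generated by `S`. -/
noncomputable def growthCoeff {G : Type*} [Group G] (S : Set G) (k : ℕ) : ℕ :=
  {w : G | HasWordLength S w k}.ncard

/-- The growth rate `limsup (a_k)^(1/k)` of the group generated by `S`, with respect to `S`. -/
noncomputable def growthRate {G : Type*} [Group G] (S : Set G) : ℝ :=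
  limsup (fun k : ℕ => (growthCoeff S k : ℝ) ^ (1 / (k : ℝ))) atTop

end Growth

/-! ### Hyperbolic 4-space in the Lorentz space `ℝ^{4,1}` -/

/-- The real vector space underlying `ℝ^{4,1}`. -/
abbrev LorentzSpace : Type := Fin 5 → ℝ

/-- The Lorentzian inner product of signature `(4,1)`. -/
def lorentz (x y : LorentzSpace) : ℝ :=
  x 0 * y 0 + x 1 * y 1 + x 2 * y 2 + x 3 * y 3 - x 4 * y 4

/-- Hyperbolic 4-space, in the hyperboloid model. -/
def hyperbolicSpace : Set LorentzSpace := {x | lorentz x x = -1 ∧ 0 < x 4}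

/-- The reflections in the hyperplanes `u^⊥`, for `u` in a set `N` of unit space-like vectors. -/
def reflectionsIn (N : Set LorentzSpace) : Set (LorentzSpace ≃ₗ[ℝ] LorentzSpace) :=
  {r | ∃ u ∈ N, ∀ x, r x = x - (2 * lorentz x u) • u}

/-! ### The totally truncated Coxeter simplex `T` -/

/-- The three types of orthogonal facets of `T`. -/
inductive FacetType : Type
  | A
  | B
  | C

/-- The labels `m_{ij}` of the Coxeter graph of the underlying extended simplex (the dihedral angle
of the `i`-th and the `j`-th facet is `π / m_{ij}`). -/
def simplexLabel : Matrix (Fin 5) (Fin 5) ℕ :=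
  !![1, 5, 2, 3, 2;
     5, 1, 3, 2, 3;
     2, 3, 1, 5, 2;
     3, 2, 5, 1, 3;
     2, 3, 2, 3, 1]

/-- The type of the orthogonal facet that truncates the `i`-th ultraideal vertex. It is the
3-simplex whose Coxeter graph is obtained by deleting the `i`-th node from the graph above: a
4-cycle with labels `3,5,3,3` (type `A`), a star with labels `3,3,5` (type `B`), a 4-cycle with
labels `5,3,5,3` (type `C`). -/
def orthFacetType : Fin 5 → FacetType :=
  ![FacetType.A, FacetType.B, FacetType.A, FacetType.B, FacetType.C]

/-- A convex polytope in `ℍ⁴` given by the outward unit normals of its facets, some of which are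
distinguished: `orth t` is the set of normals of its orthogonal facets of type `t`. -/
structure MarkedPolytope where
  normals : Set LorentzSpace
  orth : FacetType → Set LorentzSpace

namespace MarkedPolytope

/-- The polytope as a subset of `ℍ⁴`. -/
def carrier (P : MarkedPolytope) : Set LorentzSpace :=
  {x | x ∈ hyperbolicSpace ∧ ∀ u ∈ P.normals, lorentz x u ≤ 0}

/-- The interior of the polytope in `ℍ⁴`. -/
def interior (P : MarkedPolytope) : Set LorentzSpace :=
  {x | x ∈ hyperbolicSpace ∧ ∀ u ∈ P.normals, lorentz x u < 0}

/-- The growth rate of the group generated by the reflections in the facets of the polytope,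
with respect to these reflections. -/
noncomputable def rate (P : MarkedPolytope) : ℝ := growthRate (reflectionsIn P.normals)

/-- The normals of the facets that are orthogonal to the facet with normal `u`. -/
def orthogonalTo (P : MarkedPolytope) (u : LorentzSpace) : Set LorentzSpace :=
  {y | y ∈ P.normals ∧ lorentz y u = 0}

/-- The union of two polytopes `P` and `P'` lying on different sides of their common facet
`P ∩ u^⊥ = P' ∩ u^⊥`, where `u` is the outward normal for `P` and `-u` the one for `P'`. The common
facet disappears; facets of `P` and `P'` that lie in the same hyperplane and on the same side of it
become one facet, having the same outward normal. -/
def glue (P P' : MarkedPolytope) (u : LorentzSpace) : MarkedPolytope where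
  normals := (P.normals \ {u}) ∪ (P'.normals \ {-u})
  orth := fun t => (P.orth t \ {u}) ∪ (P'.orth t \ {-u})

end MarkedPolytope

/-- The polytope bounded by the facets of a simplex, with normals `e i`, and by the orthogonal
facets, with normals `v i`. -/
def truncatedSimplex (e v : Fin 5 → LorentzSpace) : MarkedPolytope where
  normals := Set.range e ∪ Set.range v
  orth := fun t => {u | ∃ i, orthFacetType i = t ∧ v i = u}

/-- `e` and `v` are the normals of a copy of `T` in `ℍ⁴`: the `e i` are the outward unit normals of
an extended Coxeter simplex with the given Coxeter graph, and `v i` is its `i`-th ultraideal vertex,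
which is truncated by the hyperplane `(v i)^⊥`. -/
structure IsTile (e v : Fin 5 → LorentzSpace) : Prop where
  gram : ∀ i j, lorentz (e i) (e j) = -Real.cos (Real.pi / (simplexLabel i j : ℝ))
  unit : ∀ i, lorentz (v i) (v i) = 1
  ortho : ∀ i j, i ≠ j → lorentz (v i) (e j) = 0
  neg : ∀ i, lorentz (v i) (e i) < 0
  interior_nonempty : (truncatedSimplex e v).interior.Nonempty

/-- `1` if the two types agree and `0` otherwise. -/
def FacetType.count : FacetType → FacetType → ℕ
  | .A, .A => 1
  | .B, .B => 1
  | .C, .C => 1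
  | _, _ => 0

/-- `IsDomino ℓ m n D`: the polytope `D` is obtained from `n + 1` copies of `T` by gluing `n` times
along orthogonal facets, `ℓ` times along facets of type `A`, `m` times along facets of type `B` and
`n - ℓ - m` times along facets of type `C`. The copies are added one at a time; a new copy is put on
the other side of a free orthogonal facet `D ∩ u^⊥` so that one of its orthogonal facets of the same
type coincides with `D ∩ u^⊥`, that is, both are bounded by the same facets orthogonal to them. -/
inductive IsDomino : ℕ → ℕ → ℕ → MarkedPolytope → Prop
  | tile (e v : Fin 5 → LorentzSpace) (h : IsTile e v) : IsDomino 0 0 0 (truncatedSimplex e v)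
  | glue (ℓ m n : ℕ) (D : MarkedPolytope) (e v : Fin 5 → LorentzSpace) (t : FacetType)
      (u : LorentzSpace) (hD : IsDomino ℓ m n D) (h : IsTile e v)
      (hu : u ∈ D.orth t) (hu' : -u ∈ (truncatedSimplex e v).orth t)
      (hfacet : D.orthogonalTo u = (truncatedSimplex e v).orthogonalTo (-u)) :
      IsDomino (ℓ + t.count .A) (m + t.count .B) (n + 1) (D.glue (truncatedSimplex e v) u)

/-! ### The polynomials `Q_{ℓ,m,n}` -/

/-- The inequalities satisfied by the numbers of gluings. -/
def Admissible (ℓ m n : ℕ) : Prop :=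
  ℓ + m ≤ n ∧ (Odd n → (n : ℝ) - ℓ - m ≤ ((n : ℝ) + 1) / 2) ∧
    (Even n → (n : ℝ) - ℓ - m ≤ (n : ℝ) / 2)

/-- The polynomial `Q_{ℓ,m,n}`. -/
noncomputable def dominoQ (ℓ m n : ℤ) : ℤ[X] :=
  X ^ 18 - C (4 * n + 6) * X ^ 17 + C (2 * n - m + 3) * X ^ 16
    - C (3 * n - m + ℓ + 5) * X ^ 15 + C (5 * n - 3 * m + 5) * X ^ 14
    - C (n - 4 * m + 1) * X ^ 13 + C (8 * n - 4 * m + ℓ + 9) * X ^ 12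
    + C (5 * m - ℓ) * X ^ 11 + C (10 * n - 5 * m + ℓ + 11) * X ^ 10
    - C (2 * n - 6 * m + 2) * X ^ 9 + C (10 * n - 5 * m + ℓ + 11) * X ^ 8
    + C (5 * m - ℓ) * X ^ 7 + C (8 * n - 4 * m + ℓ + 9) * X ^ 6
    - C (n - 4 * m + 1) * X ^ 5 + C (5 * n - 3 * m + 5) * X ^ 4
    - C (3 * n - m + ℓ + 5) * X ^ 3 + C (2 * n - m + 3) * X ^ 2
    - C (4 * n + 6) * X + 1

/-! ### The Lorentzian product -/

section Lorentz

/-! The facets of a domino meet at angles π/2, π/3, π/5 or have disjoint hyperplanes, so its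
reflection group behaves as a Coxeter group. The length theory needed is proved directly for sets of
unit normals. By `IsCoxeterNormals.length_lt_iff`, multiplying w on the right by the reflection in s
lengthens w exactly when w maps s into the cone of non-negative combinations of normals. Hence
cosets of parabolic subgroups have unique minimal representatives with additive lengths
(`growthSeries_eq_mul`), and inclusion-exclusion over ascent sets yields Steinberg's formula
`invGrowth_eq_sum`. A subset contributes nothing to it if its cone contains a non-zero causal
vector, because then no element has all descents. Two consequences make the inverse growth series
computable. It is additive over an amalgam (`invGrowth_union`), since a subset with two separated
normals contributes zero, and a factor of order two divides it by 1 + x (`invGrowth_insert`). Euler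
relations give the series of the simplex group and of its subgroups from the finite ones of rank at
most three, and truncation then gives the tile. A gluing adds the inverse series of the tile plus (x
- 1)/(1 + x) times that of the facet group (`IsGluing.invGrowth_glue`). The latter depends only on
the type of the facet, so by induction the growth series of every domino is `dominoDen` divided by
Q, whatever the pattern of gluings. For the roots, Q is palindromic, so Q(t) = t⁹ R(t + 1/t) with R
= `dominoTrace` of degree nine. Sign changes of R give seven roots in (-2, 2), one in (2, 3) and one
in (4n + 26/5, 4n + 6), hence all nine. The first seven yield conjugate pairs on the unit circle,
the last two yield reciprocal real pairs. The pole of the growth series nearest to 0 is therefore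
1/α, where the denominator polynomial of the inverse series is positive and cannot cancel it, and
`limsup_root_coeff_eq` identifies the rate with α. No trace t + 1/t of a root is an integer. A
quadratic factor over ℤ would have two roots with integral sum and product 1 or -1. The first is
excluded by the traces, the second by the position of the roots (`not_dvd_dominoQ`). Dominoes exist
because a tile can be reflected in any of its free orthogonal facets. Facets of types A and B never
run out, and counting free facets of type C gives the admissibility bound. -/

lemma lorentz_comm (x y : LorentzSpace) : lorentz x y = lorentz y x := by
  simp only [lorentz]; ring

@[simp] lemma lorentz_add_left (x y z : LorentzSpace) :
    lorentz (x + y) z = lorentz x z + lorentz y z := by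
  simp only [lorentz, Pi.add_apply]; ring

@[simp] lemma lorentz_smul_left (a : ℝ) (x y : LorentzSpace) :
    lorentz (a • x) y = a * lorentz x y := by
  simp only [lorentz, Pi.smul_apply, smul_eq_mul]; ring

@[simp] lemma lorentz_neg_left (x y : LorentzSpace) : lorentz (-x) y = -lorentz x y := by
  simp only [lorentz, Pi.neg_apply]; ring

@[simp] lemma lorentz_sub_left (x y z : LorentzSpace) :
    lorentz (x - y) z = lorentz x z - lorentz y z := by
  simp only [lorentz, Pi.sub_apply]; ring

@[simp] lemma lorentz_zero_left (x : LorentzSpace) : lorentz 0 x = 0 := by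
  simp [lorentz]

@[simp] lemma lorentz_add_right (x y z : LorentzSpace) :
    lorentz x (y + z) = lorentz x y + lorentz x z := by
  simp only [lorentz, Pi.add_apply]; ring

@[simp] lemma lorentz_smul_right (a : ℝ) (x y : LorentzSpace) :
    lorentz x (a • y) = a * lorentz x y := by
  simp only [lorentz, Pi.smul_apply, smul_eq_mul]; ring

@[simp] lemma lorentz_neg_right (x y : LorentzSpace) : lorentz x (-y) = -lorentz x y := by
  simp only [lorentz, Pi.neg_apply]; ring

@[simp] lemma lorentz_sub_right (x y z : LorentzSpace) :
    lorentz x (y - z) = lorentz x y - lorentz x z := by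
  simp only [lorentz, Pi.sub_apply]; ring

@[simp] lemma lorentz_zero_right (x : LorentzSpace) : lorentz x 0 = 0 := by
  simp [lorentz]

lemma lorentz_sum_left {ι : Type*} (s : Finset ι) (f : ι → LorentzSpace) (y : LorentzSpace) :
    lorentz (∑ i ∈ s, f i) y = ∑ i ∈ s, lorentz (f i) y := by
  classical
  induction s using Finset.induction_on with
  | empty => simp
  | insert a s ha ih => simp [Finset.sum_insert ha, ih]

lemma lorentz_sum_right {ι : Type*} (s : Finset ι) (f : ι → LorentzSpace) (y : LorentzSpace) :
    lorentz y (∑ i ∈ s, f i) = ∑ i ∈ s, lorentz y (f i) := by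
  simp_rw [lorentz_comm y, lorentz_sum_left]

/-- The time-like vectors pointing to the future. -/
def IsFuture (x : LorentzSpace) : Prop := lorentz x x < 0 ∧ 0 < x 4

/-- Cauchy–Schwarz for the spatial parts, each of which is bounded by the time component of its
vector. -/
lemma lorentz_sq_le_of_causal {x y : LorentzSpace} (hx : lorentz x x ≤ 0) (hy : lorentz y y ≤ 0) :
    (x 0 * y 0 + x 1 * y 1 + x 2 * y 2 + x 3 * y 3) ^ 2 ≤ (x 4 * y 4) ^ 2 := by
  simp only [lorentz] at hx hy
  have h1 : (x 0 * y 0 + x 1 * y 1 + x 2 * y 2 + x 3 * y 3) ^ 2 ≤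
      (x 0 ^ 2 + x 1 ^ 2 + x 2 ^ 2 + x 3 ^ 2) * (y 0 ^ 2 + y 1 ^ 2 + y 2 ^ 2 + y 3 ^ 2) := by
    nlinarith [sq_nonneg (x 0 * y 1 - x 1 * y 0), sq_nonneg (x 0 * y 2 - x 2 * y 0),
      sq_nonneg (x 0 * y 3 - x 3 * y 0), sq_nonneg (x 1 * y 2 - x 2 * y 1),
      sq_nonneg (x 1 * y 3 - x 3 * y 1), sq_nonneg (x 2 * y 3 - x 3 * y 2)]
  refine h1.trans ?_
  rw [mul_pow]
  refine mul_le_mul ?_ ?_ (by positivity) (by positivity) <;> linarith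

/-- Two causal vectors pointing to the future have non-positive product. -/
lemma lorentz_nonpos_of_causal {x y : LorentzSpace} (hx : lorentz x x ≤ 0) (hx4 : 0 ≤ x 4)
    (hy : lorentz y y ≤ 0) (hy4 : 0 ≤ y 4) : lorentz x y ≤ 0 := by
  have h := abs_le_of_sq_le_sq' (lorentz_sq_le_of_causal hx hy) (mul_nonneg hx4 hy4)
  simp only [lorentz]
  linarith [h.2]

/-- The same Cauchy–Schwarz estimate becomes strict as soon as one of the two vectors is time-like.
-/
lemma IsFuture.lorentz_neg {x y : LorentzSpace} (hx : IsFuture x) (hy : lorentz y y ≤ 0)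
    (hy4 : 0 < y 4) : lorentz x y < 0 := by
  obtain ⟨hx, hx4⟩ := hx
  have h1 : (x 0 * y 0 + x 1 * y 1 + x 2 * y 2 + x 3 * y 3) ^ 2 ≤
      (x 0 ^ 2 + x 1 ^ 2 + x 2 ^ 2 + x 3 ^ 2) * (y 0 ^ 2 + y 1 ^ 2 + y 2 ^ 2 + y 3 ^ 2) := by
    nlinarith [sq_nonneg (x 0 * y 1 - x 1 * y 0), sq_nonneg (x 0 * y 2 - x 2 * y 0),
      sq_nonneg (x 0 * y 3 - x 3 * y 0), sq_nonneg (x 1 * y 2 - x 2 * y 1),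
      sq_nonneg (x 1 * y 3 - x 3 * y 1), sq_nonneg (x 2 * y 3 - x 3 * y 2)]
  simp only [lorentz] at hx hy ⊢
  have h2 : (x 0 * y 0 + x 1 * y 1 + x 2 * y 2 + x 3 * y 3) ^ 2 < (x 4 * y 4) ^ 2 := by
    refine h1.trans_lt ?_
    rw [mul_pow]
    refine mul_lt_mul_of_lt_of_le_of_nonneg_of_pos ?_ ?_ (by positivity) (by positivity) <;>
      linarith
  have h := abs_lt_of_sq_lt_sq' h2 (mul_pos hx4 hy4).le
  linarith [h.2]

/-- A causal vector is future pointing as soon as its product with a future vector is negative. -/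
lemma IsFuture.time_pos {x y : LorentzSpace} (hx : IsFuture x) (hy : lorentz y y ≤ 0)
    (hxy : lorentz x y < 0) : 0 < y 4 := by
  by_contra! h
  rcases h.lt_or_eq with h | h
  · have := hx.lorentz_neg (y := -y) (by simpa using hy) (by simpa using h)
    simp at this; linarith
  · have hy' : lorentz y y ≤ 0 := hy
    simp only [lorentz, h] at hy
    have e0 : y 0 = 0 := by nlinarith [sq_nonneg (y 0), sq_nonneg (y 1), sq_nonneg (y 2), sq_nonneg (y 3)]
    have e1 : y 1 = 0 := by nlinarith [sq_nonneg (y 0), sq_nonneg (y 1), sq_nonneg (y 2), sq_nonneg (y 3)]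
    have e2 : y 2 = 0 := by nlinarith [sq_nonneg (y 0), sq_nonneg (y 1), sq_nonneg (y 2), sq_nonneg (y 3)]
    have e3 : y 3 = 0 := by nlinarith [sq_nonneg (y 0), sq_nonneg (y 1), sq_nonneg (y 2), sq_nonneg (y 3)]
    simp [lorentz, e0, e1, e2, e3, h] at hxy

end Lorentz

/-! ### Reflections, words and word length -/

section Reflection

/-- The reflection in the hyperplane `u^⊥` (the identity if `u` is isotropic). -/
noncomputable def lorentzReflection (u : LorentzSpace) : LorentzSpace ≃ₗ[ℝ] LorentzSpace :=
  LinearEquiv.ofInvolutive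
    { toFun := fun x => x - (2 * lorentz x u / lorentz u u) • u
      map_add' := fun x y => by
        rw [lorentz_add_left, mul_add, add_div, add_smul]; abel
      map_smul' := fun a x => by
        rw [lorentz_smul_left, RingHom.id_apply, smul_sub, smul_smul]
        congr 2; ring }
    (by
      intro x
      by_cases hu : lorentz u u = 0
      · simp [hu]
      · simp only [LinearMap.coe_mk, AddHom.coe_mk, lorentz_sub_left, lorentz_smul_left,
          div_mul_cancel₀ _ hu]
        rw [sub_sub, ← add_smul, ← add_div]
        have : 2 * lorentz x u + 2 * (lorentz x u - 2 * lorentz x u) = 0 := by ring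
        simp [this])

lemma lorentzReflection_apply' (u x : LorentzSpace) :
    lorentzReflection u x = x - (2 * lorentz x u / lorentz u u) • u := rfl

lemma lorentzReflection_apply {u : LorentzSpace} (hu : lorentz u u = 1) (x : LorentzSpace) :
    lorentzReflection u x = x - (2 * lorentz x u) • u := by
  rw [lorentzReflection_apply', hu, div_one]

@[simp] lemma lorentzReflection_mul_self (u : LorentzSpace) :
    lorentzReflection u * lorentzReflection u = 1 := by
  ext1 x
  exact LinearEquiv.symm_apply_apply (lorentzReflection u) x

@[simp] lemma lorentzReflection_inv (u : LorentzSpace) :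
    (lorentzReflection u)⁻¹ = lorentzReflection u :=
  inv_eq_of_mul_eq_one_left (lorentzReflection_mul_self u)

@[simp] lemma mul_lorentzReflection_mul_self (w : LorentzSpace ≃ₗ[ℝ] LorentzSpace)
    (u : LorentzSpace) : w * lorentzReflection u * lorentzReflection u = w := by
  rw [mul_assoc, lorentzReflection_mul_self, mul_one]

@[simp] lemma lorentzReflection_mul_mul_self (w : LorentzSpace ≃ₗ[ℝ] LorentzSpace)
    (u : LorentzSpace) : lorentzReflection u * (lorentzReflection u * w) = w := by
  rw [← mul_assoc, lorentzReflection_mul_self, one_mul]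

lemma lorentzReflection_self {u : LorentzSpace} (hu : lorentz u u = 1) :
    lorentzReflection u u = -u := by
  rw [lorentzReflection_apply hu, hu, mul_one, two_smul]; abel

lemma lorentz_lorentzReflection (u x y : LorentzSpace) :
    lorentz (lorentzReflection u x) (lorentzReflection u y) = lorentz x y := by
  by_cases hu : lorentz u u = 0
  · simp [lorentzReflection_apply', hu]
  · simp only [lorentzReflection_apply', lorentz_sub_left, lorentz_sub_right, lorentz_smul_left,
      lorentz_smul_right, lorentz_comm u y]
    field_simp; ring

/-- A transvection 1 + f ⊗ u has determinant 1 + f(u), and here f(u) = -2. The determinant serves as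
the sign character that controls the parity of word length. -/
lemma det_lorentzReflection {u : LorentzSpace} (hu : lorentz u u = 1) :
    LinearEquiv.det (lorentzReflection u) = -1 := by
  let f : Module.Dual ℝ LorentzSpace :=
    { toFun := fun x => -2 * lorentz x u
      map_add' := fun x y => by rw [lorentz_add_left]; ring
      map_smul' := fun a x => by rw [lorentz_smul_left, RingHom.id_apply, smul_eq_mul]; ring }
  have h := LinearMap.transvection.det f u
  have h2 : LinearMap.transvection f u = (lorentzReflection u : LorentzSpace →ₗ[ℝ] LorentzSpace) := by
    refine LinearMap.ext fun x => ?_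
    change x + (-2 * lorentz x u) • u = lorentzReflection u x
    rw [lorentzReflection_apply hu, neg_mul, neg_smul, sub_eq_add_neg]
  rw [h2] at h
  apply Units.ext
  rw [LinearEquiv.coe_det, h]
  change 1 + -2 * lorentz u u = -1
  rw [hu]; norm_num

/-- The product of the reflections of a word. -/
noncomputable def wordProd (l : List LorentzSpace) : LorentzSpace ≃ₗ[ℝ] LorentzSpace :=
  (l.map lorentzReflection).prod

@[simp] lemma wordProd_nil : wordProd [] = 1 := rfl

@[simp] lemma wordProd_cons (u : LorentzSpace) (l : List LorentzSpace) :
    wordProd (u :: l) = lorentzReflection u * wordProd l := by simp [wordProd]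

@[simp] lemma wordProd_append (l l' : List LorentzSpace) :
    wordProd (l ++ l') = wordProd l * wordProd l' := by simp [wordProd]

lemma wordProd_reverse (l : List LorentzSpace) : wordProd l.reverse = (wordProd l)⁻¹ := by
  induction l with
  | nil => simp
  | cons u l ih => simp [ih]

/-- The group generated by the reflections in the hyperplanes normal to the elements of `N`. -/
noncomputable def reflGroup (N : Set LorentzSpace) :
    Subgroup (LorentzSpace ≃ₗ[ℝ] LorentzSpace) where
  carrier := {w | ∃ l : List LorentzSpace, (∀ u ∈ l, u ∈ N) ∧ wordProd l = w}
  one_mem' := ⟨[], by simp, rfl⟩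
  mul_mem' := by
    rintro _ _ ⟨l, hl, rfl⟩ ⟨l', hl', rfl⟩
    refine ⟨l ++ l', fun u hu => ?_, by simp⟩
    rcases List.mem_append.1 hu with h | h
    exacts [hl u h, hl' u h]
  inv_mem' := by
    rintro _ ⟨l, hl, rfl⟩
    exact ⟨l.reverse, fun u hu => hl u (List.mem_reverse.1 hu), wordProd_reverse l⟩

lemma wordProd_mem {N : Set LorentzSpace} {l : List LorentzSpace} (hl : ∀ u ∈ l, u ∈ N) :
    wordProd l ∈ reflGroup N := ⟨l, hl, rfl⟩

lemma lorentzReflection_mem {N : Set LorentzSpace} {u : LorentzSpace} (hu : u ∈ N) :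
    lorentzReflection u ∈ reflGroup N := ⟨[u], by simpa using hu, by simp⟩

lemma reflGroup_mono {I N : Set LorentzSpace} (h : I ⊆ N) : reflGroup I ≤ reflGroup N := by
  rintro _ ⟨l, hl, rfl⟩
  exact ⟨l, fun u hu => h (hl u hu), rfl⟩

/-- The least length of a word in the reflections of `N` representing `w`. -/
noncomputable def wordLength (N : Set LorentzSpace) (w : LorentzSpace ≃ₗ[ℝ] LorentzSpace) : ℕ :=
  sInf {j | ∃ l : List LorentzSpace, l.length = j ∧ (∀ u ∈ l, u ∈ N) ∧ wordProd l = w}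

variable {N I : Set LorentzSpace} {v w : LorentzSpace ≃ₗ[ℝ] LorentzSpace} {u : LorentzSpace}

lemma exists_word (hw : w ∈ reflGroup N) :
    ∃ l : List LorentzSpace, l.length = wordLength N w ∧ (∀ u ∈ l, u ∈ N) ∧ wordProd l = w := by
  obtain ⟨l, hl, rfl⟩ := hw
  exact Nat.sInf_mem (s := {j | ∃ l' : List LorentzSpace, l'.length = j ∧ (∀ u ∈ l', u ∈ N) ∧
    wordProd l' = wordProd l}) ⟨_, l, rfl, hl, rfl⟩

lemma wordLength_wordProd_le {l : List LorentzSpace} (hl : ∀ u ∈ l, u ∈ N) :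
    wordLength N (wordProd l) ≤ l.length := Nat.sInf_le ⟨l, rfl, hl, rfl⟩

lemma wordLength_mul_le (hv : v ∈ reflGroup N) (hw : w ∈ reflGroup N) :
    wordLength N (v * w) ≤ wordLength N v + wordLength N w := by
  obtain ⟨l, h1, h2, rfl⟩ := exists_word hv
  obtain ⟨l', h1', h2', rfl⟩ := exists_word hw
  rw [← h1, ← h1', ← List.length_append, ← wordProd_append]
  refine wordLength_wordProd_le fun u hu => ?_
  rcases List.mem_append.1 hu with h | h
  exacts [h2 u h, h2' u h]

@[simp] lemma wordLength_one : wordLength N 1 = 0 :=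
  Nat.le_zero.1 (wordLength_wordProd_le (N := N) (l := []) (by simp))

lemma eq_one_of_wordLength_eq_zero (hw : w ∈ reflGroup N) (h : wordLength N w = 0) : w = 1 := by
  obtain ⟨l, h1, -, rfl⟩ := exists_word hw
  rw [h, List.length_eq_zero_iff] at h1
  simp [h1]

lemma wordLength_lorentzReflection_le (hu : u ∈ N) : wordLength N (lorentzReflection u) ≤ 1 := by
  simpa using wordLength_wordProd_le (N := N) (l := [u]) (by simpa using hu)

lemma wordLength_anti (h : I ⊆ N) (hw : w ∈ reflGroup I) : wordLength N w ≤ wordLength I w := by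
  obtain ⟨l, h1, h2, rfl⟩ := exists_word hw
  rw [← h1]
  exact wordLength_wordProd_le fun u hu => h (h2 u hu)

lemma wordLength_mul_reflection_le (hw : w ∈ reflGroup N) (hu : u ∈ N) :
    wordLength N (w * lorentzReflection u) ≤ wordLength N w + 1 :=
  (wordLength_mul_le hw (lorentzReflection_mem hu)).trans
    (by gcongr; exact wordLength_lorentzReflection_le hu)

lemma wordLength_reflection_mul_le (hw : w ∈ reflGroup N) (hu : u ∈ N) :
    wordLength N (lorentzReflection u * w) ≤ wordLength N w + 1 :=
  (wordLength_mul_le (lorentzReflection_mem hu) hw).trans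
    (by have := wordLength_lorentzReflection_le hu; omega)

lemma wordLength_le_mul_reflection (hw : w ∈ reflGroup N) (hu : u ∈ N) :
    wordLength N w ≤ wordLength N (w * lorentzReflection u) + 1 := by
  simpa using wordLength_mul_reflection_le
    ((reflGroup N).mul_mem hw (lorentzReflection_mem hu)) hu

lemma det_of_mem (hN : ∀ u ∈ N, lorentz u u = 1) (hw : w ∈ reflGroup N) :
    LinearEquiv.det w = (-1) ^ wordLength N w := by
  obtain ⟨l, h1, h2, rfl⟩ := exists_word hw
  rw [← h1]; clear h1 hw
  induction l with
  | nil => simp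
  | cons u l ih =>
    rw [wordProd_cons, map_mul, ih fun x hx => h2 x (List.mem_cons_of_mem _ hx),
      det_lorentzReflection (hN u (h2 u List.mem_cons_self)), List.length_cons, pow_succ']

/-- The determinant changes sign, so the parity of the length changes: every generator is either an
ascent or a descent of w. -/
lemma wordLength_mul_reflection_ne (hN : ∀ u ∈ N, lorentz u u = 1) (hw : w ∈ reflGroup N)
    (hu : u ∈ N) : wordLength N (w * lorentzReflection u) ≠ wordLength N w := by
  intro h
  have h1 := det_of_mem hN ((reflGroup N).mul_mem hw (lorentzReflection_mem hu))
  rw [map_mul, det_lorentzReflection (hN u hu), h, det_of_mem hN hw] at h1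
  rw [mul_eq_left] at h1
  have := congrArg Units.val h1
  norm_num at this

/-- A non-trivial element has a word ending in a descent. -/
lemma exists_descent (hw : w ∈ reflGroup N) (h : wordLength N w ≠ 0) :
    ∃ u ∈ N, wordLength N (w * lorentzReflection u) + 1 = wordLength N w := by
  obtain ⟨l, h1, h2, rfl⟩ := exists_word hw
  induction l using List.reverseRecOn with
  | nil => simp at h
  | append_singleton l u _ =>
    have hu : u ∈ N := h2 u (by simp)
    refine ⟨u, hu, ?_⟩
    have h3 := wordLength_le_mul_reflection hw hu
    have h4 : wordLength N (wordProd l) ≤ l.length :=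
      wordLength_wordProd_le fun x hx => h2 x (by simp [hx])
    simp only [wordProd_append, wordProd_cons, wordProd_nil, mul_one,
      mul_lorentzReflection_mul_self, List.length_append, List.length_singleton] at *
    omega

lemma lorentz_of_mem (hw : w ∈ reflGroup N) (x y : LorentzSpace) :
    lorentz (w x) (w y) = lorentz x y := by
  obtain ⟨l, -, rfl⟩ := hw
  induction l with
  | nil => simp
  | cons u l ih => simp only [wordProd_cons, LinearEquiv.mul_apply, lorentz_lorentzReflection, ih]

lemma lorentz_inv_of_mem (hw : w ∈ reflGroup N) (x y : LorentzSpace) :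
    lorentz (w⁻¹ x) y = lorentz x (w y) := by
  rw [← lorentz_of_mem hw (w⁻¹ x) y, ← LinearEquiv.mul_apply, mul_inv_cancel]
  rfl

lemma IsFuture.reflection {x : LorentzSpace} (hx : IsFuture x) (hu : lorentz u u = 1) :
    IsFuture (lorentzReflection u x) := by
  have h : lorentz (lorentzReflection u x) (lorentzReflection u x) < 0 := by
    rw [lorentz_lorentzReflection]; exact hx.1
  refine ⟨h, hx.time_pos h.le ?_⟩
  rw [lorentzReflection_apply hu, lorentz_sub_right, lorentz_smul_right]
  nlinarith [hx.1, sq_nonneg (lorentz x u)]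

lemma IsFuture.of_mem {x : LorentzSpace} (hx : IsFuture x) (hN : ∀ u ∈ N, lorentz u u = 1)
    (hw : w ∈ reflGroup N) : IsFuture (w x) := by
  obtain ⟨l, hl, rfl⟩ := hw
  induction l with
  | nil => simpa using hx
  | cons u l ih =>
    rw [wordProd_cons, LinearEquiv.mul_apply]
    exact (ih fun x hx => hl x (List.mem_cons_of_mem _ hx)).reflection (hN u (hl u List.mem_cons_self))

end Reflection

/-! ### Roots and the length function -/

section Cone

/-- The vectors that are combinations of elements of `N` with non-negative coefficients. -/
noncomputable def nonnegCone (N : Set LorentzSpace) : Submodule NNReal LorentzSpace :=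
  Submodule.span NNReal N

variable {N I : Set LorentzSpace} {v w : LorentzSpace ≃ₗ[ℝ] LorentzSpace} {s t u x : LorentzSpace}

lemma mem_nonnegCone (hu : u ∈ N) : u ∈ nonnegCone N := Submodule.subset_span hu

lemma smul_mem_nonnegCone {a : ℝ} (ha : 0 ≤ a) (hx : x ∈ nonnegCone N) : a • x ∈ nonnegCone N :=
  (nonnegCone N).smul_mem ⟨a, ha⟩ hx

lemma map_mem_nonnegCone (w : LorentzSpace ≃ₗ[ℝ] LorentzSpace)
    (h : ∀ u ∈ I, w u ∈ nonnegCone N) (hx : x ∈ nonnegCone I) : w x ∈ nonnegCone N := by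
  induction hx using Submodule.span_induction with
  | mem u hu => exact h u hu
  | zero => rw [map_zero]; exact zero_mem _
  | add y z _ _ hy hz => rw [map_add]; exact add_mem hy hz
  | smul a y _ hy =>
    rw [NNReal.smul_def, map_smul]
    exact smul_mem_nonnegCone a.2 hy

/-- Applied to an interior point s of the polytope, this makes the cone pointed: it contains no
non-zero vector together with its negative. -/
lemma eq_zero_or_lorentz_neg_of_mem_nonnegCone (h : ∀ u ∈ N, lorentz s u < 0)
    (hx : x ∈ nonnegCone N) : x = 0 ∨ lorentz s x < 0 := by
  induction hx using Submodule.span_induction with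
  | mem u hu => exact Or.inr (h u hu)
  | zero => exact Or.inl rfl
  | add y z _ _ hy hz =>
    rcases hy with rfl | hy <;> rcases hz with rfl | hz
    · simp
    · simpa using Or.inr hz
    · simpa using Or.inr hy
    · right; rw [lorentz_add_right]; linarith
  | smul a y _ hy =>
    rcases hy with rfl | hy
    · simp
    · rcases eq_or_ne a 0 with rfl | ha
      · simp
      · right
        rw [NNReal.smul_def, lorentz_smul_right]
        exact mul_neg_of_pos_of_neg (by positivity) hy

end Cone

/-! ### Groups generated by two reflections -/

section Dihedral

/-- The alternating product `⋯ s t s t` of `k` reflections. -/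
noncomputable def altProd : LorentzSpace → LorentzSpace → ℕ → (LorentzSpace ≃ₗ[ℝ] LorentzSpace)
  | _, _, 0 => 1
  | s, t, k + 1 => altProd t s k * lorentzReflection t

/-- The coefficients of the roots of a dihedral group. -/
noncomputable def dihedralCoeff (a : ℝ) : ℕ → ℝ × ℝ
  | 0 => (1, 0)
  | 1 => (1, a)
  | k + 2 => (-(dihedralCoeff a k).1 + a * (dihedralCoeff a (k + 1)).2,
      -(dihedralCoeff a k).2 + a * (dihedralCoeff a (k + 1)).1)

variable {N I : Set LorentzSpace} {y w : LorentzSpace ≃ₗ[ℝ] LorentzSpace} {s t u x : LorentzSpace}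

/-- With a = -2⟨s,t⟩ one has r_t s = s + a t and r_s s = -s. Peeling letters off the right end gives
the two-term recursion of `dihedralCoeff`, in which s and t exchange roles at every step. -/
lemma altProd_apply (k : ℕ) : ∀ {s t : LorentzSpace}, lorentz s s = 1 → lorentz t t = 1 →
    altProd s t k s = (dihedralCoeff (-2 * lorentz s t) k).1 • s +
      (dihedralCoeff (-2 * lorentz s t) k).2 • t := by
  induction k using Nat.strong_induction_on with
  | _ k ih =>
    intro s t hs ht
    match k with
    | 0 => simp [altProd, dihedralCoeff]
    | 1 =>
      simp only [altProd, dihedralCoeff, one_mul, lorentzReflection_apply ht]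
      module
    | k + 2 =>
      have h1 : altProd t s (k + 1) s = -altProd s t k s := by
        rw [altProd, LinearEquiv.mul_apply, lorentzReflection_self hs, map_neg]
      have h2 := ih (k + 1) (by omega) ht hs
      rw [altProd, LinearEquiv.mul_apply, lorentzReflection_apply ht, map_sub, map_smul, h1, h2,
        ih k (by omega) hs ht, lorentz_comm t s]
      simp only [dihedralCoeff]
      module

/-- The case of hyperplanes that do not meet. The induction must also carry the crosswise
monotonicity of the coefficients, since each new one is a difference. -/
lemma dihedralCoeff_nonneg_of_two_le {a : ℝ} (ha : 2 ≤ a) (k : ℕ) :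
    0 ≤ (dihedralCoeff a k).1 ∧ 0 ≤ (dihedralCoeff a k).2 := by
  have key : ∀ k, 0 ≤ (dihedralCoeff a k).1 ∧ 0 ≤ (dihedralCoeff a k).2 ∧
      (dihedralCoeff a k).1 ≤ (dihedralCoeff a (k + 1)).2 ∧
      (dihedralCoeff a k).2 ≤ (dihedralCoeff a (k + 1)).1 := by
    intro k
    induction k with
    | zero => simp [dihedralCoeff]; linarith
    | succ k ih =>
      obtain ⟨h1, h2, h3, h4⟩ := ih
      refine ⟨h2.trans h4, h1.trans h3, ?_, ?_⟩ <;> simp only [dihedralCoeff] <;> nlinarith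
  exact ⟨(key k).1, (key k).2.1⟩

/-- The letter at which the left factor resumes depends on the parity of m, hence the unordered
pair. -/
lemma altProd_add (k m : ℕ) (s t : LorentzSpace) :
    ∃ s' t', ({s', t'} : Set LorentzSpace) = {s, t} ∧
      altProd s t (k + m) = altProd s' t' k * altProd s t m := by
  induction m generalizing s t with
  | zero => exact ⟨s, t, rfl, by simp [altProd]⟩
  | succ m ih =>
    obtain ⟨s', t', h1, h2⟩ := ih t s
    refine ⟨s', t', h1.trans (Set.pair_comm _ _), ?_⟩
    rw [← add_assoc, altProd, altProd, h2, mul_assoc]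

lemma altProd_mem_and_length_le (k : ℕ) (s t : LorentzSpace) :
    altProd s t k ∈ reflGroup {s, t} ∧ wordLength {s, t} (altProd s t k) ≤ k := by
  induction k generalizing s t with
  | zero => simp [altProd, (reflGroup _).one_mem]
  | succ k ih =>
    obtain ⟨h1, h2⟩ := ih t s
    rw [Set.pair_comm] at h1 h2
    have ht : t ∈ ({s, t} : Set LorentzSpace) := by simp
    exact ⟨(reflGroup _).mul_mem h1 (lorentzReflection_mem ht),
      (wordLength_mul_reflection_le h1 ht).trans (by omega)⟩

/-- Equal neighbouring letters cancel, so a shortest word in two letters alternates. -/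
lemma exists_altProd (hy : y ∈ reflGroup {s, t}) :
    y = altProd s t (wordLength {s, t} y) ∨ y = altProd t s (wordLength {s, t} y) := by
  have key : ∀ l : List LorentzSpace, (∀ u ∈ l, u ∈ ({s, t} : Set LorentzSpace)) →
      ∃ k ≤ l.length, wordProd l = altProd s t k ∨ wordProd l = altProd t s k := by
    intro l
    induction l using List.reverseRecOn with
    | nil => exact fun _ => ⟨0, le_rfl, Or.inl (by simp [altProd])⟩
    | append_singleton l u ih =>
      intro h
      obtain ⟨k, hk, h'⟩ := ih fun x hx => h x (by simp [hx])
      have hu : u = s ∨ u = t := by simpa using h u (by simp)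
      have red : ∀ s t : LorentzSpace, (wordProd l = altProd s t k ∨ wordProd l = altProd t s k) →
          ∃ k' ≤ l.length + 1, wordProd (l ++ [t]) = altProd s t k' ∨
            wordProd (l ++ [t]) = altProd t s k' := by
        intro s t h'
        rcases h' with h' | h'
        · cases k with
          | zero => exact ⟨1, by omega, Or.inl (by simp [h', altProd])⟩
          | succ k => exact ⟨k, by omega, Or.inr (by simp [h', altProd])⟩
        · exact ⟨k + 1, by omega, Or.inl (by simp [h', altProd])⟩
      rw [List.length_append, List.length_singleton]
      rcases hu with rfl | rfl
      · obtain ⟨k', h1, h2⟩ := red t u h'.symm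
        exact ⟨k', h1, h2.symm⟩
      · exact red s u h'
  obtain ⟨l, h1, h2, rfl⟩ := exists_word hy
  obtain ⟨k, hk, h⟩ := key l h2
  have hle : wordLength {s, t} (wordProd l) ≤ k := by
    rcases h with h | h
    · rw [h]; exact (altProd_mem_and_length_le k s t).2
    · rw [h, Set.pair_comm]; exact (altProd_mem_and_length_le k t s).2
  obtain rfl : k = wordLength {s, t} (wordProd l) := by omega
  exact h

/-- The conditions on a pair of unit vectors under which the products of the two reflections
behave as in a Coxeter group. -/
def IsDihedralPair (s t : LorentzSpace) : Prop :=
  (∀ k, 0 ≤ (dihedralCoeff (-2 * lorentz s t) k).1 ∧ 0 ≤ (dihedralCoeff (-2 * lorentz s t) k).2) ∨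
  ∃ m, 0 < m ∧ altProd s t m = altProd t s m ∧
    ∀ k < m, 0 ≤ (dihedralCoeff (-2 * lorentz s t) k).1 ∧
      0 ≤ (dihedralCoeff (-2 * lorentz s t) k).2

/-- An element that s does not shorten is an alternating product ending in t. If a relation of
length m exists, the product has fewer than m letters, for otherwise the relation would rewrite it
so as to end in s. In that range the coefficients are non-negative. -/
lemma IsDihedralPair.exists_nonneg (h : IsDihedralPair s t) (hs : lorentz s s = 1)
    (ht : lorentz t t = 1) (hy : y ∈ reflGroup {s, t})
    (hlen : wordLength {s, t} y ≤ wordLength {s, t} (y * lorentzReflection s)) :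
    ∃ a b : ℝ, 0 ≤ a ∧ 0 ≤ b ∧ y s = a • s + b • t := by
  have short : ∀ k, y = altProd t s (k + 1) → wordLength {s, t} y = k + 1 → False := by
    intro k h1 h2
    have h3 : y * lorentzReflection s = altProd s t k := by
      rw [h1, altProd, mul_lorentzReflection_mul_self]
    rw [h3, h2] at hlen
    have := (altProd_mem_and_length_le k s t).2
    omega
  have key : ∀ k, y = altProd s t k → wordLength {s, t} y = k →
      ∃ a b : ℝ, 0 ≤ a ∧ 0 ≤ b ∧ y s = a • s + b • t := by
    intro k h1 h2
    rcases h with h | ⟨m, hmpos, hm, h⟩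
    · exact ⟨_, _, (h k).1, (h k).2, by rw [h1, altProd_apply k hs ht]⟩
    · by_cases hk : k < m
      · exact ⟨_, _, (h k hk).1, (h k hk).2, by rw [h1, altProd_apply k hs ht]⟩
      · exfalso
        obtain ⟨j, rfl⟩ : ∃ j, k = j + m := ⟨k - m, by omega⟩
        obtain ⟨m, rfl⟩ : ∃ m', m = m' + 1 := ⟨m - 1, by omega⟩
        obtain ⟨s', t', h3, h4⟩ := altProd_add j (m + 1) s t
        have h5 : y * lorentzReflection s = altProd s' t' j * altProd s t m := by
          rw [h1, h4, hm, altProd, ← mul_assoc, mul_lorentzReflection_mul_self]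
        have h6 := altProd_mem_and_length_le j s' t'
        have h7 := altProd_mem_and_length_le m s t
        rw [h3] at h6
        have := wordLength_mul_le h6.1 h7.1
        rw [h5, h2] at hlen
        omega
  rcases exists_altProd hy with h1 | h1
  · exact key _ h1 rfl
  · rcases Nat.eq_zero_or_pos (wordLength {s, t} y) with h0 | h0
    · rw [h0] at h1
      exact key 0 h1 h0
    · obtain ⟨k, hk⟩ : ∃ k, wordLength {s, t} y = k + 1 := ⟨_, (Nat.sub_add_cancel h0).symm⟩
      exact (short k (hk ▸ h1) hk).elim

/-- In coordinates x + A s + B t each relation between alternating products reduces to two scalar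
identities. -/
lemma reflection_smul_add_left (hs : lorentz s s = 1) (x : LorentzSpace) (A B : ℝ) :
    lorentzReflection s (x + A • s + B • t) =
      x + (-A - 2 * lorentz x s - 2 * B * lorentz s t) • s + B • t := by
  rw [lorentzReflection_apply hs]
  simp only [lorentz_add_left, lorentz_smul_left, hs, lorentz_comm t s]
  module

lemma reflection_smul_add_right (ht : lorentz t t = 1) (x : LorentzSpace) (A B : ℝ) :
    lorentzReflection t (x + A • s + B • t) =
      x + A • s + (-B - 2 * lorentz x t - 2 * A * lorentz s t) • t := by
  rw [lorentzReflection_apply ht]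
  simp only [lorentz_add_left, lorentz_smul_left, ht]
  module

lemma smul_add_smul_congr {A A' B B' : ℝ} (h1 : A = A') (h2 : B = B') :
    x + A • s + B • t = x + A' • s + B' • t := by rw [h1, h2]

lemma altProd_two (hs : lorentz s s = 1) (ht : lorentz t t = 1) (h : lorentz s t = 0) :
    altProd s t 2 = altProd t s 2 := by
  refine LinearEquiv.ext fun x => ?_
  have hx : x = x + (0 : ℝ) • s + (0 : ℝ) • t := by simp
  simp only [altProd, one_mul, LinearEquiv.mul_apply]
  rw [hx]
  simp only [reflection_smul_add_left hs, reflection_smul_add_right ht]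
  apply smul_add_smul_congr <;> grind

lemma altProd_three (hs : lorentz s s = 1) (ht : lorentz t t = 1) (h : lorentz s t = -1 / 2) :
    altProd s t 3 = altProd t s 3 := by
  refine LinearEquiv.ext fun x => ?_
  have hx : x = x + (0 : ℝ) • s + (0 : ℝ) • t := by simp
  simp only [altProd, one_mul, LinearEquiv.mul_apply]
  rw [hx]
  simp only [reflection_smul_add_left hs, reflection_smul_add_right ht]
  apply smul_add_smul_congr <;> grind

lemma altProd_five (hs : lorentz s s = 1) (ht : lorentz t t = 1)
    (h : lorentz s t = -Real.goldenRatio / 2) :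
    altProd s t 5 = altProd t s 5 := by
  refine LinearEquiv.ext fun x => ?_
  have hx : x = x + (0 : ℝ) • s + (0 : ℝ) • t := by simp
  simp only [altProd, one_mul, LinearEquiv.mul_apply]
  rw [hx]
  simp only [reflection_smul_add_left hs, reflection_smul_add_right ht]
  have h2 := Real.goldenRatio_sq
  rw [h]
  generalize Real.goldenRatio = φ at *
  apply smul_add_smul_congr <;> grind

/-- The angles π/2, π/3, π/5 give relations of length 2, 3, 5. For ⟨s,t⟩ ≤ -1 the parameter a is at
least 2 and no relation is needed. -/
lemma isDihedralPair_of_lorentz (hs : lorentz s s = 1) (ht : lorentz t t = 1)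
    (h : lorentz s t = 0 ∨ lorentz s t = -1 / 2 ∨ lorentz s t = -Real.goldenRatio / 2 ∨
      lorentz s t ≤ -1) : IsDihedralPair s t := by
  rcases h with h | h | h | h
  · refine Or.inr ⟨2, by norm_num, altProd_two hs ht h, fun k hk => ?_⟩
    interval_cases k <;> simp [dihedralCoeff, h]
  · refine Or.inr ⟨3, by norm_num, altProd_three hs ht h, fun k hk => ?_⟩
    interval_cases k <;> norm_num [dihedralCoeff, h]
  · refine Or.inr ⟨5, by norm_num, altProd_five hs ht h, fun k hk => ?_⟩
    have h2 := Real.goldenRatio_sq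
    have h3 := Real.goldenRatio_pos
    have h4 : -2 * lorentz s t = Real.goldenRatio := by rw [h]; ring
    rw [h4]
    interval_cases k <;> simp [dihedralCoeff] <;>
      first | exact h3.le | (constructor <;> nlinarith)
  · exact Or.inl fun k => dihedralCoeff_nonneg_of_two_le (by linarith) k

end Dihedral

/-! ### Ascents, descents and the cone of normals -/

section Coxeter

/-- Unit normals of half-spaces of `ℍ⁴` whose intersection has non-empty interior, and whose
boundary hyperplanes are disjoint or meet at one of the angles `π/2`, `π/3`, `π/5`. -/
structure IsCoxeterNormals (N : Set LorentzSpace) : Prop where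
  unit : ∀ u ∈ N, lorentz u u = 1
  angle : ∀ u ∈ N, ∀ v ∈ N, u ≠ v → lorentz u v = 0 ∨ lorentz u v = -1 / 2 ∨
    lorentz u v = -Real.goldenRatio / 2 ∨ lorentz u v ≤ -1
  interior : ∃ x, IsFuture x ∧ ∀ u ∈ N, lorentz x u < 0

variable {N I : Set LorentzSpace} {v w y : LorentzSpace ≃ₗ[ℝ] LorentzSpace}
  {s t u x : LorentzSpace}

lemma IsCoxeterNormals.mono (hN : IsCoxeterNormals N) (h : I ⊆ N) : IsCoxeterNormals I where
  unit u hu := hN.unit u (h hu)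
  angle u hu v hv := hN.angle u (h hu) v (h hv)
  interior := hN.interior.imp fun _ hx => ⟨hx.1, fun u hu => hx.2 u (h hu)⟩

/-- The coset `w W_I` has an element `v` without descents in `I` such that lengths add up. -/
lemma exists_coset_decomposition (hN : IsCoxeterNormals N) (hI : I ⊆ N) (hw : w ∈ reflGroup N) :
    ∃ v ∈ reflGroup N, ∃ y ∈ reflGroup I, w = v * y ∧
      wordLength N v + wordLength I y = wordLength N w ∧
      (∀ s ∈ I, wordLength N v < wordLength N (v * lorentzReflection s)) ∧
      ∀ t ∈ I, wordLength N (w * lorentzReflection t) < wordLength N w →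
        wordLength N v < wordLength N w := by
  -- Among the factorisations w = v y whose lengths sum to at most that of w, one with v as short as
  -- possible is taken. Minimality excludes descents of v in I, because such a reflection could be
  -- moved over to y.
  let A : ℕ → Prop := fun j => ∃ v ∈ reflGroup N, ∃ y ∈ reflGroup I, w = v * y ∧
    wordLength N v + wordLength I y ≤ wordLength N w ∧ wordLength N v = j
  have hA : ∃ j, A j := ⟨_, w, hw, 1, (reflGroup I).one_mem, by simp, by simp, rfl⟩
  classical
  obtain ⟨v, hv, y, hy, hwv, hle, hj⟩ := Nat.find_spec hA
  have hmin : ∀ j, A j → wordLength N v ≤ j := fun j h => hj ▸ Nat.find_min' hA h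
  refine ⟨v, hv, y, hy, hwv, le_antisymm hle ?_, fun s hs => ?_, fun t ht hlt => ?_⟩
  · rw [hwv]
    exact (wordLength_mul_le hv (reflGroup_mono hI hy)).trans
      (by gcongr; exact wordLength_anti hI hy)
  · by_contra! h
    have h1 := lt_of_le_of_ne h (wordLength_mul_reflection_ne hN.unit hv (hI hs))
    have h2 := hmin _ ⟨v * lorentzReflection s, (reflGroup N).mul_mem hv
      (lorentzReflection_mem (hI hs)), lorentzReflection s * y,
      (reflGroup I).mul_mem (lorentzReflection_mem hs) hy, by
        rw [hwv, mul_assoc, lorentzReflection_mul_mul_self], by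
        have := wordLength_reflection_mul_le hy hs
        omega, rfl⟩
    omega
  · refine (hmin _ ⟨w * lorentzReflection t, (reflGroup N).mul_mem hw
      (lorentzReflection_mem (hI ht)), lorentzReflection t, lorentzReflection_mem ht, by simp, ?_,
      rfl⟩).trans_lt hlt
    have := wordLength_lorentzReflection_le ht
    omega

/-- Induction on the length of w. Take a descent t and factor w = v y along the dihedral subgroup of
s and t. Then v is shorter than w and has neither s nor t as a descent, so v s and v t lie in the
cone. As y is not shortened by s, y s is a non-negative combination of s and t, and v carries it
into the cone. -/
theorem IsCoxeterNormals.apply_mem_nonnegCone (hN : IsCoxeterNormals N) (hw : w ∈ reflGroup N)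
    (hs : s ∈ N) (h : wordLength N w < wordLength N (w * lorentzReflection s)) :
    w s ∈ nonnegCone N := by
  induction hk : wordLength N w using Nat.strong_induction_on generalizing w s with
  | _ k ih =>
    rcases Nat.eq_zero_or_pos (wordLength N w) with h0 | h0
    · rw [eq_one_of_wordLength_eq_zero hw h0]
      exact mem_nonnegCone hs
    obtain ⟨t, ht, hlt⟩ := exists_descent hw h0.ne'
    have hst : s ≠ t := by rintro rfl; omega
    have hI : ({s, t} : Set LorentzSpace) ⊆ N := by
      rintro x (rfl | rfl) <;> assumption
    obtain ⟨v, hv, y, hy, hwv, hadd, hasc, hdesc⟩ := exists_coset_decomposition hN hI hw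
    have hvlt : wordLength N v < k := hk ▸ hdesc t (by simp) (by omega)
    have hvs := ih _ hvlt hv hs (hasc s (by simp)) rfl
    have hvt := ih _ hvlt hv ht (hasc t (by simp)) rfl
    have hys : wordLength {s, t} y ≤ wordLength {s, t} (y * lorentzReflection s) := by
      by_contra! hcon
      have hm := (reflGroup {s, t}).mul_mem hy (lorentzReflection_mem (u := s) (by simp))
      have h1 := wordLength_mul_le hv (reflGroup_mono hI hm)
      have h2 := wordLength_anti hI hm
      rw [← mul_assoc, ← hwv] at h1
      omega
    obtain ⟨a, b, ha, hb, hab⟩ := (isDihedralPair_of_lorentz (hN.unit s hs) (hN.unit t ht)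
      (hN.angle s hs t ht hst)).exists_nonneg (hN.unit s hs) (hN.unit t ht) hy hys
    rw [hwv, LinearEquiv.mul_apply, hab, map_add, map_smul, map_smul]
    exact add_mem (smul_mem_nonnegCone ha hvs) (smul_mem_nonnegCone hb hvt)

theorem IsCoxeterNormals.neg_apply_mem_nonnegCone (hN : IsCoxeterNormals N)
    (hw : w ∈ reflGroup N) (hs : s ∈ N)
    (h : wordLength N (w * lorentzReflection s) < wordLength N w) : -w s ∈ nonnegCone N := by
  have h1 := hN.apply_mem_nonnegCone ((reflGroup N).mul_mem hw (lorentzReflection_mem hs)) hs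
    (by simpa using h)
  rwa [LinearEquiv.mul_apply, lorentzReflection_self (hN.unit s hs), map_neg] at h1

lemma IsCoxeterNormals.not_mem_nonnegCone_of_neg (hN : IsCoxeterNormals N) (hx : x ≠ 0)
    (h : x ∈ nonnegCone N) : -x ∉ nonnegCone N := by
  intro h'
  obtain ⟨p, -, hp⟩ := hN.interior
  rcases eq_zero_or_lorentz_neg_of_mem_nonnegCone hp h with h1 | h1
  · exact hx h1
  rcases eq_zero_or_lorentz_neg_of_mem_nonnegCone hp h' with h2 | h2
  · exact hx (neg_eq_zero.1 h2)
  · rw [lorentz_neg_right] at h2; linarith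

lemma IsCoxeterNormals.apply_ne_zero (hN : IsCoxeterNormals N)
    (w : LorentzSpace ≃ₗ[ℝ] LorentzSpace) (hs : s ∈ N) : w s ≠ 0 := by
  intro h
  have h1 := hN.unit s hs
  rw [(LinearEquiv.map_eq_zero_iff w).1 h] at h1
  simp at h1

/-- The bridge from combinatorics to geometry: a normal and its negative cannot both be mapped into
the pointed cone, so the two implications for ascents and descents exclude each other. -/
theorem IsCoxeterNormals.length_lt_iff (hN : IsCoxeterNormals N) (hw : w ∈ reflGroup N)
    (hs : s ∈ N) :
    wordLength N w < wordLength N (w * lorentzReflection s) ↔ w s ∈ nonnegCone N := by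
  refine ⟨hN.apply_mem_nonnegCone hw hs, fun h => ?_⟩
  by_contra! h1
  exact hN.not_mem_nonnegCone_of_neg (hN.apply_ne_zero w hs) h (hN.neg_apply_mem_nonnegCone hw hs
    (lt_of_le_of_ne h1 (wordLength_mul_reflection_ne hN.unit hw hs)))

/-- An element without descents is trivial. -/
lemma eq_one_of_forall_lt (hw : w ∈ reflGroup N)
    (h : ∀ s ∈ N, wordLength N w < wordLength N (w * lorentzReflection s)) : w = 1 := by
  by_contra hne
  obtain ⟨u, hu, h1⟩ := exists_descent hw fun h0 => hne (eq_one_of_wordLength_eq_zero hw h0)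
  have := h u hu
  omega

/-- Uniqueness of the minimal element of a coset of `W_I`. -/
lemma IsCoxeterNormals.coset_unique (hN : IsCoxeterNormals N) (hI : I ⊆ N)
    {v v' : LorentzSpace ≃ₗ[ℝ] LorentzSpace} (hv : v ∈ reflGroup N) (hv' : v' ∈ reflGroup N)
    (h : ∀ s ∈ I, wordLength N v < wordLength N (v * lorentzReflection s))
    (h' : ∀ s ∈ I, wordLength N v' < wordLength N (v' * lorentzReflection s))
    (hy : y ∈ reflGroup I) (hvy : v' = v * y) : y = 1 := by
  by_contra hne
  have hI' := hN.mono hI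
  obtain ⟨s, hs, h1⟩ := exists_descent hy fun h0 => hne (eq_one_of_wordLength_eq_zero hy h0)
  have h2 := hI'.neg_apply_mem_nonnegCone hy hs (by omega)
  have h3 := map_mem_nonnegCone (N := N) v
    (fun u hu => hN.apply_mem_nonnegCone hv (hI hu) (h u hu)) h2
  have h4 := hN.apply_mem_nonnegCone hv' (hI hs) (h' s hs)
  rw [hvy, LinearEquiv.mul_apply] at h4
  rw [map_neg] at h3
  refine hN.not_mem_nonnegCone_of_neg ?_ h4 h3
  rw [← LinearEquiv.mul_apply]
  exact hN.apply_ne_zero _ (hI hs)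

/-- If a non-negative combination of the normals is causal, no element has all descents. -/
lemma IsCoxeterNormals.not_forall_descent (hN : IsCoxeterNormals N) (hx : x ∈ nonnegCone N)
    (hx0 : x ≠ 0) (hxx : lorentz x x ≤ 0) (hw : w ∈ reflGroup N) :
    ¬ ∀ s ∈ N, wordLength N (w * lorentzReflection s) < wordLength N w := by
  intro h
  obtain ⟨p, hpf, hp⟩ := hN.interior
  -- If every generator is a descent, -(w⁻¹ p) is negative on all normals, just as p is. Then x is
  -- negative against p, hence future pointing, and also negative against -(w⁻¹ p), although w⁻¹ p
  -- is a future vector.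
  have h1 : ∀ s ∈ N, lorentz (-(w⁻¹ p)) s < 0 := fun s hs => by
    have h2 := hN.neg_apply_mem_nonnegCone hw hs (h s hs)
    rcases eq_zero_or_lorentz_neg_of_mem_nonnegCone hp h2 with h3 | h3
    · exact absurd (neg_eq_zero.1 h3) (hN.apply_ne_zero w hs)
    · rw [lorentz_neg_left, lorentz_inv_of_mem hw]
      rwa [lorentz_neg_right] at h3
  rcases eq_zero_or_lorentz_neg_of_mem_nonnegCone h1 hx with h2 | h2
  · exact hx0 h2
  rcases eq_zero_or_lorentz_neg_of_mem_nonnegCone hp hx with h3 | h3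
  · exact hx0 h3
  have h4 := hpf.time_pos hxx h3
  have h5 := (hpf.of_mem hN.unit ((reflGroup N).inv_mem hw)).lorentz_neg hxx h4
  rw [lorentz_neg_left] at h2
  linarith

end Coxeter

/-! ### Growth series -/

section GrowthSeries

variable {N I M P Q : Finset LorentzSpace} {v w y : LorentzSpace ≃ₗ[ℝ] LorentzSpace}
  {s t u x : LorentzSpace} {k : ℕ}

lemma finite_layer (N : Finset LorentzSpace) (k : ℕ) :
    {w | w ∈ reflGroup (N : Set LorentzSpace) ∧ wordLength N w = k}.Finite := by
  refine (((List.finite_length_eq N k).image (List.map Subtype.val)).image wordProd).subset ?_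
  rintro w ⟨hw, hk⟩
  obtain ⟨l, h1, h2, rfl⟩ := exists_word hw
  exact ⟨l, ⟨l.attach.map fun x => ⟨x.1, by simpa using h2 _ x.2⟩, by simp [h1, hk],
    by rw [List.map_map]; simp⟩, rfl⟩

/-- The elements of word length `k`. -/
noncomputable def layer (N : Finset LorentzSpace) (k : ℕ) :
    Finset (LorentzSpace ≃ₗ[ℝ] LorentzSpace) := (finite_layer N k).toFinset

@[simp] lemma mem_layer : w ∈ layer N k ↔ w ∈ reflGroup (N : Set LorentzSpace) ∧
    wordLength N w = k := by simp [layer]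

open Classical in
/-- The elements of word length `k` without descents in `I`. -/
noncomputable def ascLayer (N I : Finset LorentzSpace) (k : ℕ) :
    Finset (LorentzSpace ≃ₗ[ℝ] LorentzSpace) :=
  {w ∈ layer N k | ∀ s ∈ I, wordLength N w < wordLength N (w * lorentzReflection s)}

open Classical in
/-- The elements of word length `k` all of whose right neighbours are shorter. -/
noncomputable def descLayer (N : Finset LorentzSpace) (k : ℕ) :
    Finset (LorentzSpace ≃ₗ[ℝ] LorentzSpace) :=
  {w ∈ layer N k | ∀ s ∈ N, wordLength N (w * lorentzReflection s) < wordLength N w}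

/-- The growth series of the group generated by the reflections in the elements of `N`. -/
noncomputable def growthSeries (N : Finset LorentzSpace) : PowerSeries ℚ :=
  PowerSeries.mk fun k => ((layer N k).card : ℚ)

/-- The generating function of the elements without descents in `I`. -/
noncomputable def ascSeries (N I : Finset LorentzSpace) : PowerSeries ℚ :=
  PowerSeries.mk fun k => ((ascLayer N I k).card : ℚ)

/-- The generating function of the elements with all descents. -/
noncomputable def descSeries (N : Finset LorentzSpace) : PowerSeries ℚ :=
  PowerSeries.mk fun k => ((descLayer N k).card : ℚ)

/-- By uniqueness, v is the minimal representative occurring in the coset decomposition of v y, for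
which lengths add. -/
lemma coset_data_of_mul (hN : IsCoxeterNormals N) (hI : I ⊆ N)
    (hv : v ∈ reflGroup (N : Set LorentzSpace))
    (hasc : ∀ s ∈ I, wordLength N v < wordLength N (v * lorentzReflection s))
    (hy : y ∈ reflGroup (I : Set LorentzSpace)) :
    wordLength N (v * y) = wordLength N v + wordLength I y := by
  have hI' : (I : Set LorentzSpace) ⊆ N := by exact_mod_cast hI
  obtain ⟨v', hv', y', hy', h1, h2, h3, -⟩ := exists_coset_decomposition hN hI'
    ((reflGroup (N : Set LorentzSpace)).mul_mem hv (reflGroup_mono hI' hy))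
  have h4 : v' = v * (y * y'⁻¹) := by rw [← mul_assoc, h1, mul_inv_cancel_right]
  have h5 := hN.coset_unique hI' hv hv' (by simpa using hasc) h3
    ((reflGroup _).mul_mem hy ((reflGroup _).inv_mem hy')) h4
  rw [mul_inv_eq_one] at h5
  subst h5
  rw [mul_inv_cancel, mul_one] at h4
  rw [← h2, h4]

/-- The growth series of a parabolic subgroup divides that of the group. -/
theorem growthSeries_eq_mul (hN : IsCoxeterNormals N) (hI : I ⊆ N) :
    growthSeries N = ascSeries N I * growthSeries I := by
  classical
  have hI' : (I : Set LorentzSpace) ⊆ N := by exact_mod_cast hI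
  ext k
  simp only [growthSeries, ascSeries, PowerSeries.coeff_mul, PowerSeries.coeff_mk]
  norm_cast
  simp_rw [← Finset.card_product]
  rw [← Finset.card_sigma]
  symm
  refine Finset.card_bij (fun p _ => p.2.1 * p.2.2) ?_ ?_ ?_
  · rintro ⟨⟨i, j⟩, v, y⟩ h
    simp only [Finset.mem_sigma, Finset.mem_product, ascLayer,
      Finset.mem_filter, mem_layer] at h
    obtain ⟨hij, ⟨⟨hv, rfl⟩, hasc⟩, hy, rfl⟩ := h
    rw [mem_layer]
    exact ⟨(reflGroup _).mul_mem hv (reflGroup_mono hI' hy),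
      by rw [coset_data_of_mul hN hI hv hasc hy]; exact Finset.HasAntidiagonal.mem_antidiagonal.1 hij⟩
  · rintro ⟨⟨i, j⟩, v, y⟩ h ⟨⟨i', j'⟩, v', y'⟩ h' heq
    simp only [Finset.mem_sigma, Finset.mem_product, ascLayer,
      Finset.mem_filter, mem_layer] at h h'
    obtain ⟨hij, ⟨⟨hv, rfl⟩, hasc⟩, hy, rfl⟩ := h
    obtain ⟨hij', ⟨⟨hv', rfl⟩, hasc'⟩, hy', rfl⟩ := h'
    simp only at heq
    have h4 : v' = v * (y * y'⁻¹) := by rw [← mul_assoc, heq, mul_inv_cancel_right]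
    have h5 := hN.coset_unique hI' hv hv' (by simpa using hasc) (by simpa using hasc')
      ((reflGroup _).mul_mem hy ((reflGroup _).inv_mem hy')) h4
    rw [mul_inv_eq_one] at h5
    subst h5
    rw [mul_inv_cancel, mul_one] at h4
    subst h4
    rfl
  · intro w hw
    rw [mem_layer] at hw
    obtain ⟨v, hv, y, hy, h1, h2, h3, -⟩ := exists_coset_decomposition hN hI' hw.1
    refine ⟨⟨(wordLength N v, wordLength I y), v, y⟩, ?_, h1.symm⟩
    simp only [Finset.mem_sigma, Finset.mem_product, ascLayer,
      Finset.mem_filter, mem_layer, and_true]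
    exact ⟨Finset.HasAntidiagonal.mem_antidiagonal.2 (h2.trans hw.2), ⟨hv, by simpa using h3⟩, hy⟩

lemma constantCoeff_growthSeries (N : Finset LorentzSpace) :
    PowerSeries.constantCoeff (growthSeries N) = 1 := by
  rw [← PowerSeries.coeff_zero_eq_constantCoeff_apply, growthSeries, PowerSeries.coeff_mk]
  have : layer N 0 = {1} := by
    ext w
    rw [mem_layer, Finset.mem_singleton]
    constructor
    · exact fun h => eq_one_of_wordLength_eq_zero h.1 h.2
    · rintro rfl; exact ⟨(reflGroup _).one_mem, wordLength_one⟩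
  simp [this]

lemma growthSeries_empty : growthSeries ∅ = 1 := by
  ext k
  rcases Nat.eq_zero_or_pos k with rfl | hk
  · rw [PowerSeries.coeff_zero_eq_constantCoeff_apply, constantCoeff_growthSeries]; simp
  · rw [growthSeries, PowerSeries.coeff_mk, PowerSeries.coeff_one, if_neg hk.ne']
    norm_cast
    rw [Finset.card_eq_zero, Finset.eq_empty_iff_forall_notMem]
    intro w hw
    rw [mem_layer] at hw
    obtain ⟨l, h1, h2, rfl⟩ := exists_word hw.1
    cases l with
    | nil => simp at hw; omega
    | cons u l => simpa using h2 u

/-- An element with ascent set A is counted with the sum of the signs of all subsets of A, which is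
zero unless A is empty. By parity, an empty ascent set means that every generator is a descent. -/
lemma sum_neg_one_pow_ascSeries (hN : IsCoxeterNormals N) :
    ∑ I ∈ N.powerset, (-1) ^ I.card * ascSeries N I = descSeries N := by
  classical
  ext k
  simp only [map_sum]
  have h1 : ∀ I : Finset LorentzSpace, PowerSeries.coeff k ((-1) ^ I.card * ascSeries N I) =
      ∑ w ∈ layer N k, if ∀ s ∈ I, wordLength N w < wordLength N (w * lorentzReflection s)
        then (-1 : ℚ) ^ I.card else 0 := by
    intro I
    have : ((-1) ^ I.card : PowerSeries ℚ) = PowerSeries.C ((-1) ^ I.card) := by simp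
    rw [this, PowerSeries.coeff_C_mul, ascSeries, PowerSeries.coeff_mk, ascLayer,
      ← Finset.sum_filter, Finset.sum_const, nsmul_eq_mul, mul_comm]
  simp_rw [h1]
  rw [Finset.sum_comm, descSeries, PowerSeries.coeff_mk, descLayer, Finset.card_filter]
  push_cast
  refine Finset.sum_congr rfl fun w hw => ?_
  rw [mem_layer] at hw
  let A : Finset LorentzSpace :=
    {s ∈ N | wordLength N w < wordLength N (w * lorentzReflection s)}
  have h2 : ∑ I ∈ N.powerset, (if ∀ s ∈ I, wordLength N w < wordLength N (w * lorentzReflection s)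
      then (-1 : ℚ) ^ I.card else 0) = ∑ I ∈ A.powerset, (-1 : ℚ) ^ I.card := by
    rw [← Finset.sum_filter]
    refine Finset.sum_congr ?_ fun _ _ => rfl
    ext I
    simp only [Finset.mem_filter, Finset.mem_powerset, A]
    constructor
    · exact fun h s hs => Finset.mem_filter.2 ⟨h.1 hs, h.2 s hs⟩
    · exact fun h => ⟨fun s hs => (Finset.mem_filter.1 (h hs)).1,
        fun s hs => (Finset.mem_filter.1 (h hs)).2⟩
  have h3 : ∑ I ∈ A.powerset, (-1 : ℚ) ^ I.card = if A = ∅ then 1 else 0 := by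
    exact_mod_cast Finset.sum_powerset_neg_one_pow_card (x := A)
  rw [h2, h3]
  have h4 : A = ∅ ↔ ∀ s ∈ N, wordLength N (w * lorentzReflection s) < wordLength N w := by
    simp only [A, Finset.filter_eq_empty_iff]
    refine forall₂_congr fun s hs => ⟨fun h => ?_, fun h => by omega⟩
    have := wordLength_mul_reflection_ne hN.unit hw.1 hs
    omega
  simp only [h4]

/-- The inverse of the growth series. -/
noncomputable def invGrowth (N : Finset LorentzSpace) : LaurentSeries ℚ :=
  (HahnSeries.ofPowerSeries ℤ ℚ (growthSeries N))⁻¹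

lemma growthSeries_ne_zero (N : Finset LorentzSpace) :
    HahnSeries.ofPowerSeries ℤ ℚ (growthSeries N) ≠ 0 := by
  intro h
  rw [map_eq_zero_iff _ HahnSeries.ofPowerSeries_injective] at h
  have := constantCoeff_growthSeries N
  simp [h] at this

/-- The contribution of a set of normals to the inverse growth series: it is non-zero only if the
group is finite. -/
noncomputable def finiteTerm (N : Finset LorentzSpace) : LaurentSeries ℚ :=
  HahnSeries.ofPowerSeries ℤ ℚ (descSeries N) * invGrowth N

/-- Divide the alternating sum of coset series by the growth series of N: each quotient is the
inverse growth series of the subgroup for I. -/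
theorem sum_neg_one_pow_invGrowth (hN : IsCoxeterNormals N) :
    ∑ I ∈ N.powerset, (-1) ^ I.card * invGrowth I = finiteTerm N := by
  rw [finiteTerm, ← sum_neg_one_pow_ascSeries hN, map_sum, Finset.sum_mul]
  refine Finset.sum_congr rfl fun I hI => ?_
  have h1 := growthSeries_ne_zero N
  have h2 := growthSeries_ne_zero I
  rw [growthSeries_eq_mul hN (Finset.mem_powerset.1 hI), map_mul] at h1
  have h3 := left_ne_zero_of_mul h1
  rw [invGrowth, invGrowth, growthSeries_eq_mul hN (Finset.mem_powerset.1 hI), map_mul, map_mul,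
    map_pow, map_neg, map_one]
  field_simp

lemma sum_powerset_insert_alternating {α K : Type*} [DecidableEq α] [CommRing K] {a : α}
    {U : Finset α} (hU : a ∉ U) (F : Finset α → K) :
    ∑ I ∈ (insert a U).powerset, (-1) ^ I.card * F I =
      ∑ I ∈ U.powerset, (-1) ^ I.card * F I -
        ∑ I ∈ U.powerset, (-1) ^ I.card * F (insert a I) := by
  rw [Finset.sum_powerset_insert hU, sub_eq_add_neg, ← Finset.sum_neg_distrib]
  congr 1
  refine Finset.sum_congr rfl fun I hI => ?_
  rw [Finset.card_insert_of_notMem fun h => hU (Finset.mem_powerset.1 hI h), pow_succ]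
  ring

/-- Möbius inversion on the Boolean lattice; with these signs the transform is its own inverse. -/
lemma sum_powerset_involution {α K : Type*} [DecidableEq α] [CommRing K] (f : Finset α → K)
    (N : Finset α) :
    ∑ U ∈ N.powerset, (-1) ^ U.card * ∑ I ∈ U.powerset, (-1) ^ I.card * f I = f N := by
  induction N using Finset.induction_on generalizing f with
  | empty => simp
  | insert a N ha ih =>
    rw [sum_powerset_insert_alternating ha, ← Finset.sum_sub_distrib, ← ih fun I => f (insert a I)]
    refine Finset.sum_congr rfl fun U hU => ?_
    rw [sum_powerset_insert_alternating fun h => ha (Finset.mem_powerset.1 hU h)]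
    ring

/-- Steinberg's formula. -/
theorem invGrowth_eq_sum (hN : IsCoxeterNormals N) :
    invGrowth N = ∑ U ∈ N.powerset, (-1) ^ U.card * finiteTerm U := by
  classical
  rw [← sum_powerset_involution invGrowth N]
  refine Finset.sum_congr rfl fun U hU => ?_
  rw [sum_neg_one_pow_invGrowth (hN.mono (by exact_mod_cast Finset.mem_powerset.1 hU))]

lemma descSeries_eq_zero (hN : IsCoxeterNormals N) (hx : x ∈ nonnegCone N)
    (hx0 : x ≠ 0) (hxx : lorentz x x ≤ 0) : descSeries N = 0 := by
  ext k
  rw [descSeries, PowerSeries.coeff_mk, map_zero]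
  norm_cast
  rw [Finset.card_eq_zero, Finset.eq_empty_iff_forall_notMem]
  intro w hw
  simp only [descLayer, Finset.mem_filter, mem_layer] at hw
  exact hN.not_forall_descent hx hx0 hxx hw.1.1 (by simpa using hw.2)

lemma finiteTerm_eq_zero (hN : IsCoxeterNormals N) (hx : x ∈ nonnegCone N)
    (hx0 : x ≠ 0) (hxx : lorentz x x ≤ 0) : finiteTerm N = 0 := by
  rw [finiteTerm, descSeries_eq_zero hN hx hx0 hxx, map_zero, zero_mul]

/-- The vector s + t is causal, its square being 2 + 2⟨s,t⟩ ≤ 0. -/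
lemma finiteTerm_eq_zero_of_pair (hN : IsCoxeterNormals N) (hs : s ∈ N) (ht : t ∈ N)
    (hst : lorentz s t ≤ -1) : finiteTerm N = 0 := by
  obtain ⟨p, -, hp⟩ := hN.interior
  refine finiteTerm_eq_zero hN (x := s + t)
    (add_mem (mem_nonnegCone (by simpa using hs)) (mem_nonnegCone (by simpa using ht))) ?_ ?_
  · intro h
    have h1 := congrArg (lorentz p) h
    rw [lorentz_add_right, lorentz_zero_right] at h1
    linarith [hp s (by simpa using hs), hp t (by simpa using ht)]
  · rw [lorentz_add_left, lorentz_add_right, lorentz_add_right, lorentz_comm t s,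
      hN.unit s (by simpa using hs), hN.unit t (by simpa using ht)]
    linarith

/-- The growth series of an amalgamated product. -/
theorem invGrowth_union [DecidableEq LorentzSpace] (hN : IsCoxeterNormals ((P ∪ Q : Finset _)))
    (h : ∀ s ∈ P, s ∉ Q → ∀ t ∈ Q, t ∉ P → lorentz s t ≤ -1) :
    invGrowth (P ∪ Q) = invGrowth P + invGrowth Q - invGrowth (P ∩ Q) := by
  have hP : IsCoxeterNormals P := hN.mono (by simp)
  have hQ : IsCoxeterNormals Q := hN.mono (by simp)
  have hPQ : IsCoxeterNormals ((P ∩ Q : Finset _)) := hP.mono (by simp)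
  have hinter : (P ∩ Q).powerset = P.powerset ∩ Q.powerset := by
    ext U; simp only [Finset.mem_powerset, Finset.mem_inter, Finset.subset_inter_iff]
  rw [invGrowth_eq_sum hN, invGrowth_eq_sum hP, invGrowth_eq_sum hQ, invGrowth_eq_sum hPQ,
    hinter, eq_sub_iff_add_eq, 
    ← Finset.sum_union_inter (s₁ := P.powerset) (s₂ := Q.powerset)]
  congr 1
  symm
  refine Finset.sum_subset ?_ ?_
  · exact Finset.union_subset (Finset.powerset_mono.2 Finset.subset_union_left)
      (Finset.powerset_mono.2 Finset.subset_union_right)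
  -- A subset contained in neither P nor Q has one normal from each side of the separation, so its
  -- term vanishes.
  · intro U hU hU'
    simp only [Finset.mem_union, Finset.mem_powerset, not_or, Finset.not_subset] at hU hU'
    obtain ⟨⟨t, ht, htP⟩, s, hs, hsQ⟩ := hU'
    have hs' := (Finset.mem_union.1 (hU hs)).resolve_right hsQ
    have ht' := (Finset.mem_union.1 (hU ht)).resolve_left htP
    rw [finiteTerm_eq_zero_of_pair (hN.mono (by exact_mod_cast hU)) hs ht (h s hs' hsQ t ht' htP),
      mul_zero]

/-- The reflection in u commutes with the group of M, so every element is y or y r_u with y in that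
group. If M contains no descent then y = 1, and 1 and r_u have lengths 0 and 1. -/
lemma ascLayer_insert [DecidableEq LorentzSpace] (hN : IsCoxeterNormals ((insert u M : Finset _)))
    (h : ∀ m ∈ M, lorentz m u = 0) (k : ℕ) :
    (ascLayer (insert u M) M k).card = if k = 0 ∨ k = 1 then 1 else 0 := by
  classical
  have huu : u ∈ ((insert u M : Finset _) : Set LorentzSpace) := by simp
  have hMN : (M : Set LorentzSpace) ⊆ ((insert u M : Finset _) : Set LorentzSpace) := by simp
  have hu1 := hN.unit u huu
  have hfix : ∀ m ∈ M, lorentzReflection u m = m := fun m hm => by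
    simp [lorentzReflection_apply', h m hm]
  have hcomm : ∀ m ∈ M, lorentzReflection u * lorentzReflection m =
      lorentzReflection m * lorentzReflection u := fun m hm => by
    refine LinearEquiv.ext fun x => ?_
    simp only [LinearEquiv.mul_apply, lorentzReflection_apply hu1,
      lorentzReflection_apply (hN.unit m (hMN hm)), lorentz_sub_left, lorentz_smul_left, h m hm,
      lorentz_comm u m]
    module
  have hform : ∀ w ∈ reflGroup ((insert u M : Finset _) : Set LorentzSpace),
      ∃ y ∈ reflGroup (M : Set LorentzSpace), w = y ∨ w = y * lorentzReflection u := by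
    rintro _ ⟨l, hl, rfl⟩
    induction l with
    | nil => exact ⟨1, (reflGroup _).one_mem, Or.inl rfl⟩
    | cons x l ih =>
      obtain ⟨y, hy, hy'⟩ := ih fun z hz => hl z (List.mem_cons_of_mem _ hz)
      have hx := hl x List.mem_cons_self
      simp only [Finset.coe_insert, Set.mem_insert_iff] at hx
      rw [wordProd_cons]
      rcases hx with rfl | hx
      · have hc : lorentzReflection x * y = y * lorentzReflection x := by
          obtain ⟨l', hl', rfl⟩ := hy
          clear hy' ih hl
          induction l' with
          | nil => simp
          | cons z l' ih =>
            rw [wordProd_cons, ← mul_assoc, hcomm z (by simpa using hl' z List.mem_cons_self),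
              mul_assoc, ih fun a ha => hl' a (List.mem_cons_of_mem _ ha), mul_assoc]
        refine ⟨y, hy, ?_⟩
        rcases hy' with h' | h'
        · right; rw [h', hc]
        · left; rw [h', ← mul_assoc, hc, mul_lorentzReflection_mul_self]
      · refine ⟨lorentzReflection x * y, (reflGroup _).mul_mem (lorentzReflection_mem hx) hy, ?_⟩
        rcases hy' with h' | h'
        · left; rw [h']
        · right; rw [h', mul_assoc]
  have htriv : ∀ y ∈ reflGroup (M : Set LorentzSpace),
      (∀ m ∈ M, y m ∈ nonnegCone ((insert u M : Finset _) : Set LorentzSpace)) → y = 1 := by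
    intro y hy hpos
    refine eq_one_of_forall_lt hy fun m hm => ?_
    by_contra! hle
    have h1 := (hN.mono hMN).neg_apply_mem_nonnegCone hy hm
      (lt_of_le_of_ne hle (wordLength_mul_reflection_ne (hN.mono hMN).unit hy hm))
    exact hN.not_mem_nonnegCone_of_neg (hN.apply_ne_zero y (hMN hm)) (hpos m hm)
      (Submodule.span_mono hMN h1)
  have hlen : wordLength ((insert u M : Finset _) : Set LorentzSpace) (lorentzReflection u) = 1 := by
    have h1 := wordLength_lorentzReflection_le huu
    have h2 := (hN.length_lt_iff (reflGroup _).one_mem huu).2 (mem_nonnegCone huu)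
    rw [wordLength_one, one_mul] at h2
    omega
  have hmem : ∀ w, w ∈ ascLayer (insert u M) M k ↔
      (k = 0 ∧ w = 1) ∨ (k = 1 ∧ w = lorentzReflection u) := by
    intro w
    simp only [ascLayer, Finset.mem_filter, mem_layer]
    constructor
    · rintro ⟨⟨hw, rfl⟩, hasc⟩
      obtain ⟨y, hy, rfl | rfl⟩ := hform w hw
      · obtain rfl := htriv w hy fun m hm =>
          (hN.length_lt_iff hw (hMN hm)).1 (hasc m hm)
        exact Or.inl ⟨wordLength_one, rfl⟩
      · obtain rfl := htriv y hy fun m hm => by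
          have := (hN.length_lt_iff hw (hMN hm)).1 (hasc m hm)
          rwa [LinearEquiv.mul_apply, hfix m hm] at this
        rw [one_mul]
        exact Or.inr ⟨hlen, rfl⟩
    · rintro (⟨rfl, rfl⟩ | ⟨rfl, rfl⟩)
      · exact ⟨⟨(reflGroup _).one_mem, wordLength_one⟩, fun m hm =>
          (hN.length_lt_iff (reflGroup _).one_mem (hMN hm)).2 (mem_nonnegCone (hMN hm))⟩
      · refine ⟨⟨lorentzReflection_mem huu, hlen⟩, fun m hm =>
          (hN.length_lt_iff (lorentzReflection_mem huu) (hMN hm)).2 ?_⟩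
        rw [hfix m hm]
        exact mem_nonnegCone (hMN hm)
  split_ifs with hk
  · rw [Finset.card_eq_one]
    rcases hk with rfl | rfl
    · exact ⟨1, by ext w; rw [hmem]; simp⟩
    · exact ⟨lorentzReflection u, by ext w; rw [hmem]; simp⟩
  · rw [Finset.card_eq_zero, Finset.eq_empty_iff_forall_notMem]
    intro w hw
    rw [hmem] at hw
    tauto

/-- The image of the variable in the field of Laurent series. -/
noncomputable def laurentX : LaurentSeries ℚ := HahnSeries.ofPowerSeries ℤ ℚ PowerSeries.X

/-- The growth series of the product with a group of order two. -/
theorem invGrowth_insert [DecidableEq LorentzSpace]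
    (hN : IsCoxeterNormals ((insert u M : Finset _))) (h : ∀ m ∈ M, lorentz m u = 0) :
    invGrowth (insert u M) = invGrowth M / (1 + laurentX) := by
  have h1 := growthSeries_eq_mul hN (Finset.subset_insert u M)
  have h2 : ascSeries (insert u M) M = 1 + PowerSeries.X := by
    ext k
    rw [ascSeries, PowerSeries.coeff_mk, ascLayer_insert hN h, map_add, PowerSeries.coeff_one,
      PowerSeries.coeff_X]
    rcases k with _ | _ | k <;> simp
  rw [invGrowth, h1, h2, map_mul, map_add, map_one, mul_inv, mul_comm, invGrowth, laurentX]
  rfl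

end GrowthSeries

/-! ### The finite parabolic subgroups of the simplex group -/

section RootTables

/-- The product of `a₁ + a₂ φ` and `b₁ + b₂ φ`. -/
def goldenMul (a b : ℤ × ℤ) : ℤ × ℤ := (a.1 * b.1 + a.2 * b.2, a.1 * b.2 + a.2 * b.1 + a.2 * b.2)

/-- The real number `a₁ + a₂ φ`. -/
noncomputable def goldenVal (a : ℤ × ℤ) : ℝ := a.1 + a.2 * Real.goldenRatio

lemma goldenVal_mul (a b : ℤ × ℤ) : goldenVal (goldenMul a b) = goldenVal a * goldenVal b := by
  simp only [goldenVal, goldenMul]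
  push_cast
  linear_combination (-(a.2 : ℝ) * b.2) * Real.goldenRatio_sq

lemma goldenVal_add (a b : ℤ × ℤ) : goldenVal (a + b) = goldenVal a + goldenVal b := by
  simp only [goldenVal, Prod.fst_add, Prod.snd_add]
  push_cast
  ring

/-- The label of the edge between two nodes of the Coxeter graph. -/
def edgeLabel (i j : Fin 5) : ℕ := simplexLabel i j

/-- `-2` times the Gram matrix of the simplex, over `ℤ[φ]`. -/
def gramGolden (i j : Fin 5) : ℤ × ℤ :=
  match edgeLabel i j with
  | 1 => (-2, 0)
  | 3 => (1, 0)
  | 5 => (0, 1)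
  | _ => (0, 0)

/-- If the rows of `A` are the coefficients of the images of the simple roots under `w`, then those
of `stepRoots A u` belong to `w r_u`. -/
def stepRoots (A : Fin 5 → Fin 5 → ℤ × ℤ) (u : Fin 5) : Fin 5 → Fin 5 → ℤ × ℤ :=
  fun j i => A j i + goldenMul (gramGolden j u) (A u i)

/-- The word `l` in the letters `I`, applied after an element with table `A`, is reduced and leads
to an element which maps the simple roots in `I` to their negatives, up to a permutation. -/
def IsLongestFrom (I : Finset (Fin 5)) : (Fin 5 → Fin 5 → ℤ × ℤ) → List (Fin 5) → Prop
  | A, [] => ∀ j ∈ I, ∃ i ∈ I, ∀ k, A j k = if k = i then (-1, 0) else 0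
  | A, u :: l => u ∈ I ∧ (∀ i, 0 ≤ (A u i).1 ∧ 0 ≤ (A u i).2 ∧ (i ∉ I → A u i = 0)) ∧
      IsLongestFrom I (stepRoots A u) l

instance decidableIsLongestFrom (I : Finset (Fin 5)) :
    ∀ (A : Fin 5 → Fin 5 → ℤ × ℤ) (l : List (Fin 5)), Decidable (IsLongestFrom I A l)
  | A, [] => inferInstanceAs (Decidable (∀ j ∈ I, ∃ i ∈ I, ∀ k, A j k = if k = i then (-1, 0) else 0))
  | A, u :: l => by
      have := decidableIsLongestFrom I (stepRoots A u) l
      exact inferInstanceAs (Decidable (u ∈ I ∧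
        (∀ i, 0 ≤ (A u i).1 ∧ 0 ≤ (A u i).2 ∧ (i ∉ I → A u i = 0)) ∧
        IsLongestFrom I (stepRoots A u) l))

/-- The coefficients of the simple roots. -/
def simpleRoots : Fin 5 → Fin 5 → ℤ × ℤ := fun j i => if i = j then (1, 0) else 0

/-- The simple roots of an extended simplex with the Gram matrix of `T`. -/
structure IsSimplex (e : Fin 5 → LorentzSpace) : Prop where
  gram : ∀ i j, -2 * lorentz (e i) (e j) = goldenVal (gramGolden i j)
  coxeter : IsCoxeterNormals (Set.range e)
  injective : Function.Injective e

variable {e : Fin 5 → LorentzSpace} {I : Finset (Fin 5)}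

lemma IsSimplex.unit (he : IsSimplex e) (i : Fin 5) : lorentz (e i) (e i) = 1 :=
  he.coxeter.unit _ ⟨i, rfl⟩

lemma IsSimplex.coxeter_image (he : IsSimplex e) (I : Finset (Fin 5)) :
    IsCoxeterNormals ((I.image e : Finset LorentzSpace) : Set LorentzSpace) :=
  he.coxeter.mono (by rw [Finset.coe_image]; exact Set.image_subset_range _ _)

/-- The table tracks the images of the simple roots. Before each letter the image of its root is a
non-negative combination, so appending the letter increases the length by exactly one. -/
lemma IsSimplex.exists_longest (he : IsSimplex e) {l : List (Fin 5)} :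
    ∀ {A : Fin 5 → Fin 5 → ℤ × ℤ} {w : LorentzSpace ≃ₗ[ℝ] LorentzSpace}
    (_ : w ∈ reflGroup ((I.image e : Finset LorentzSpace) : Set LorentzSpace))
    (_ : ∀ j, w (e j) = ∑ i, goldenVal (A j i) • e i) (_ : IsLongestFrom I A l),
    ∃ w' ∈ reflGroup ((I.image e : Finset LorentzSpace) : Set LorentzSpace),
      wordLength ((I.image e : Finset LorentzSpace) : Set LorentzSpace) w' =
        wordLength ((I.image e : Finset LorentzSpace) : Set LorentzSpace) w + l.length ∧
      ∀ j ∈ I, ∃ i ∈ I, w' (e j) = -e i := by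
  induction l with
  | nil =>
    intro A w hw hA h
    refine ⟨w, hw, by simp, fun j hj => ?_⟩
    obtain ⟨i, hi, hk⟩ := h j hj
    refine ⟨i, hi, ?_⟩
    rw [hA, Finset.sum_eq_single i]
    · rw [hk, if_pos rfl]; simp [goldenVal]
    · intro k _ hki
      rw [hk, if_neg hki]; simp [goldenVal]
    · simp
  | cons u l ih =>
    intro A w hw hA h
    obtain ⟨hu, hpos, hl⟩ := h
    have hue : e u ∈ ((I.image e : Finset LorentzSpace) : Set LorentzSpace) := by
      rw [Finset.coe_image]; exact ⟨u, hu, rfl⟩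
    have hcone : w (e u) ∈ nonnegCone ((I.image e : Finset LorentzSpace) : Set LorentzSpace) := by
      rw [hA]
      refine Submodule.sum_mem _ fun i _ => ?_
      by_cases hi : i ∈ I
      · refine smul_mem_nonnegCone ?_ (mem_nonnegCone ?_)
        · have h1 : (0 : ℝ) ≤ (A u i).1 := by exact_mod_cast (hpos i).1
          have h2 : (0 : ℝ) ≤ (A u i).2 := by exact_mod_cast (hpos i).2.1
          have := Real.goldenRatio_pos
          rw [goldenVal]; positivity
        · rw [Finset.coe_image]; exact ⟨i, hi, rfl⟩
      · rw [(hpos i).2.2 hi]; simp [goldenVal]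
    have hasc := ((he.coxeter_image I).length_lt_iff hw hue).2 hcone
    have hle := wordLength_mul_reflection_le hw hue
    obtain ⟨w', h1, h2, h3⟩ := ih ((reflGroup _).mul_mem hw (lorentzReflection_mem hue))
      (A := stepRoots A u) (fun j => by
        rw [LinearEquiv.mul_apply, lorentzReflection_apply (he.unit u), map_sub, map_smul, hA, hA,
          Finset.smul_sum, ← Finset.sum_sub_distrib]
        refine Finset.sum_congr rfl fun i _ => ?_
        rw [stepRoots, goldenVal_add, goldenVal_mul, ← he.gram j u]
        module) hl
    exact ⟨w', h1, by rw [h2, List.length_cons]; omega, h3⟩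

/-- If there is a longest word for `I`, it is the only element with all descents. -/
lemma IsSimplex.descSeries_image (he : IsSimplex e) {l : List (Fin 5)}
    (h : IsLongestFrom I simpleRoots l) : descSeries (I.image e) = PowerSeries.X ^ l.length := by
  set N : Finset LorentzSpace := I.image e with hNdef
  have hN : IsCoxeterNormals N := he.coxeter_image I
  obtain ⟨z, hz, hzl, hzI⟩ := he.exists_longest (I := I) (A := simpleRoots) (reflGroup _).one_mem
    (fun j => by
      rw [Finset.sum_eq_single j]
      · simp [simpleRoots, goldenVal]
      · intro i _ hij; simp [simpleRoots, goldenVal, hij]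
      · simp) h
  rw [wordLength_one, zero_add, ← hNdef] at hzl
  rw [← hNdef] at hz
  have hzN : ∀ s ∈ N, ∃ t ∈ N, z s = -t := by
    intro s hs
    obtain ⟨j, hj, rfl⟩ := Finset.mem_image.1 hs
    obtain ⟨i, hi, hji⟩ := hzI j hj
    exact ⟨e i, Finset.mem_image_of_mem e hi, hji⟩
  -- As z sends each normal to the negative of a normal, w z has no descents when w has all of them.
  -- The case w = z then shows that z is an involution, which gives uniqueness.
  have hdesc : ∀ w ∈ reflGroup (N : Set LorentzSpace),
      (∀ s ∈ N, wordLength N (w * lorentzReflection s) < wordLength N w) → w * z = 1 := by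
    intro w hw hall
    have hwz := (reflGroup _).mul_mem hw hz
    refine eq_one_of_forall_lt hwz fun s hs => (hN.length_lt_iff hwz hs).2 ?_
    obtain ⟨t, ht, hst⟩ := hzN s hs
    rw [LinearEquiv.mul_apply, hst, map_neg]
    exact hN.neg_apply_mem_nonnegCone hw ht (hall t ht)
  have hzdesc : ∀ s ∈ N, wordLength N (z * lorentzReflection s) < wordLength N z := by
    intro s hs
    obtain ⟨t, ht, hst⟩ := hzN s hs
    refine lt_of_le_of_ne ?_ (wordLength_mul_reflection_ne hN.unit hz hs)
    by_contra! hlt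
    have h1 := (hN.length_lt_iff hz hs).1 hlt
    refine hN.not_mem_nonnegCone_of_neg (hN.apply_ne_zero z hs) h1 ?_
    rw [hst, neg_neg]
    exact mem_nonnegCone ht
  have hzz := hdesc z hz hzdesc
  ext k
  rw [descSeries, PowerSeries.coeff_mk, PowerSeries.coeff_X_pow]
  have hmem : ∀ w, w ∈ descLayer N k ↔ w = z ∧ k = l.length := by
    intro w
    simp only [descLayer, Finset.mem_filter, mem_layer]
    constructor
    · rintro ⟨⟨hw, rfl⟩, hall⟩
      obtain rfl : w = z := mul_right_cancel ((hdesc w hw hall).trans hzz.symm)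
      exact ⟨rfl, hzl⟩
    · rintro ⟨rfl, rfl⟩
      exact ⟨⟨hz, hzl⟩, hzdesc⟩
  split_ifs with hk
  · norm_cast
    rw [Finset.card_eq_one]
    exact ⟨z, by ext w; rw [hmem]; simp [hk]⟩
  · norm_cast
    rw [Finset.card_eq_zero, Finset.eq_empty_iff_forall_notMem]
    intro w hw
    exact hk ((hmem w).1 hw).2

lemma IsSimplex.euler (he : IsSimplex e) (I : Finset (Fin 5)) :
    ∑ J ∈ I.powerset, (-1) ^ J.card * invGrowth (J.image e) = finiteTerm (I.image e) := by
  rw [← sum_neg_one_pow_invGrowth (he.coxeter_image I)]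
  have h1 : (I.image e).powerset = I.powerset.image (Finset.image e) := by
    ext U
    simp only [Finset.mem_powerset, Finset.mem_image, Finset.subset_image_iff]
  rw [h1, Finset.sum_image fun _ _ _ _ h => Finset.image_injective he.injective h]
  refine Finset.sum_congr rfl fun J _ => ?_
  rw [Finset.card_image_of_injective _ he.injective]

lemma IsSimplex.euler_of_isLongest (he : IsSimplex e) {l : List (Fin 5)}
    (h : IsLongestFrom I simpleRoots l) :
    ∑ J ∈ I.powerset, (-1) ^ J.card * invGrowth (J.image e) =
      laurentX ^ l.length * invGrowth (I.image e) := by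
  rw [he.euler, finiteTerm, he.descSeries_image h, map_pow, laurentX]

/-- The combination of the normals with weights c is time-like, so the finite term vanishes. The
double sum is -2 times its square, whence the positive sign in the hypothesis. -/
lemma IsSimplex.euler_of_neg (he : IsSimplex e) (c : Fin 5 → ℝ) (hc : ∀ i, 0 ≤ c i)
    (hcI : ∀ i, i ∉ I → c i = 0)
    (hneg : 0 < ∑ i, ∑ j, c i * c j * goldenVal (gramGolden i j)) :
    ∑ J ∈ I.powerset, (-1) ^ J.card * invGrowth (J.image e) = 0 := by
  have hxx : lorentz (∑ i, c i • e i) (∑ i, c i • e i) < 0 := by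
    simp_rw [lorentz_sum_left, lorentz_sum_right, lorentz_smul_left, lorentz_smul_right]
    simp_rw [← he.gram] at hneg
    have : ∑ i, ∑ j, c i * c j * (-2 * lorentz (e i) (e j)) =
        -2 * ∑ i, ∑ j, c i * (c j * lorentz (e i) (e j)) := by
      rw [Finset.mul_sum]
      refine Finset.sum_congr rfl fun i _ => ?_
      rw [Finset.mul_sum]
      exact Finset.sum_congr rfl fun j _ => by ring
    rw [this] at hneg
    linarith
  rw [he.euler]
  refine finiteTerm_eq_zero (he.coxeter_image I) (x := ∑ i, c i • e i)
    (Submodule.sum_mem _ fun i _ => ?_) ?_ hxx.le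
  · by_cases hi : i ∈ I
    · exact smul_mem_nonnegCone (hc i) (mem_nonnegCone (by
        rw [Finset.coe_image]; exact ⟨i, hi, rfl⟩))
    · rw [hcI i hi, zero_smul]; exact zero_mem _
  · intro h
    rw [h] at hxx
    simp at hxx

end RootTables

/-! ### The inverse growth series of the simplex group and of its parabolic subgroups -/

section SimplexGrowth

lemma ofPowerSeries_ne_zero {f : PowerSeries ℚ} (hf : PowerSeries.constantCoeff f = 1) :
    HahnSeries.ofPowerSeries ℤ ℚ f ≠ 0 := by
  intro h
  rw [map_eq_zero_iff _ HahnSeries.ofPowerSeries_injective] at h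
  simp [h] at hf

/-- The common denominator of the inverse growth series. -/
noncomputable def dominoDen {R : Type*} [CommRing R] (x : R) : R :=
  (1 + x) ^ 2 * (1 + x ^ 2) * (1 + x + x ^ 2 + x ^ 3 + x ^ 4 + x ^ 5) *
    (1 + x + x ^ 2 + x ^ 3 + x ^ 4 + x ^ 5 + x ^ 6 + x ^ 7 + x ^ 8 + x ^ 9)

variable {e : Fin 5 → LorentzSpace}

lemma sum_powerset_fin_one {K : Type*} [CommRing K] (F : Finset (Fin 5) → K) (a : Fin 5) :
    ∑ I ∈ ({a} : Finset (Fin 5)).powerset, (-1) ^ I.card * F I = F ∅ - F {a} := by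
  rw [← insert_empty_eq, sum_powerset_insert_alternating (by simp)]
  simp

lemma sum_powerset_fin_two {K : Type*} [CommRing K] (F : Finset (Fin 5) → K) {a b : Fin 5}
    (h : a ≠ b) :
    ∑ I ∈ ({a, b} : Finset (Fin 5)).powerset, (-1) ^ I.card * F I =
      F ∅ - F {a} - F {b} + F {a, b} := by
  rw [sum_powerset_insert_alternating (by simpa using h), sum_powerset_fin_one,
    sum_powerset_fin_one (fun I => F (insert a I))]
  simp only [insert_empty_eq]
  ring

lemma sum_powerset_fin_three {K : Type*} [CommRing K] (F : Finset (Fin 5) → K) {a b c : Fin 5}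
    (hab : a ≠ b) (hac : a ≠ c) (hbc : b ≠ c) :
    ∑ I ∈ ({a, b, c} : Finset (Fin 5)).powerset, (-1) ^ I.card * F I =
      F ∅ - F {a} - F {b} - F {c} + F {a, b} + F {a, c} + F {b, c} - F {a, b, c} := by
  rw [sum_powerset_insert_alternating (by simp [hab, hac]), sum_powerset_fin_two _ hbc,
    sum_powerset_fin_two (fun I => F (insert a I)) hbc]
  simp only [insert_empty_eq]
  ring

lemma sum_powerset_fin_four {K : Type*} [CommRing K] (F : Finset (Fin 5) → K) {a b c d : Fin 5}
    (hab : a ≠ b) (hac : a ≠ c) (had : a ≠ d) (hbc : b ≠ c) (hbd : b ≠ d) (hcd : c ≠ d) :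
    ∑ I ∈ ({a, b, c, d} : Finset (Fin 5)).powerset, (-1) ^ I.card * F I =
      F ∅ - F {a} - F {b} - F {c} - F {d} + F {a, b} + F {a, c} + F {a, d} + F {b, c} + F {b, d}
        + F {c, d} - F {a, b, c} - F {a, b, d} - F {a, c, d} - F {b, c, d} + F {a, b, c, d} := by
  rw [sum_powerset_insert_alternating (by simp [hab, hac, had]), sum_powerset_fin_three _ hbc hbd hcd,
    sum_powerset_fin_three (fun I => F (insert a I)) hbc hbd hcd]
  simp only [insert_empty_eq]
  ring


lemma one_sub_laurentX_ne_zero : (1 : LaurentSeries ℚ) - laurentX ≠ 0 := by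
  have h := ofPowerSeries_ne_zero (f := 1 - PowerSeries.X) (by simp)
  rwa [map_sub, map_one] at h

lemma one_add_laurentX_pow_ne_zero {m : ℕ} (hm : m ≠ 0) :
    (1 : LaurentSeries ℚ) + laurentX ^ m ≠ 0 := by
  have h := ofPowerSeries_ne_zero (f := 1 + PowerSeries.X ^ m) (by simp [hm])
  rwa [map_add, map_one, map_pow] at h

lemma map_dominoDen {R S : Type*} [CommRing R] [CommRing S] (f : R →+* S) (x : R) :
    f (dominoDen x) = dominoDen (f x) := by
  simp [dominoDen]

/-- The inverse growth series of the parabolic subgroup generated by the reflections `I`. -/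
noncomputable def invGrowthFace (e : Fin 5 → LorentzSpace) (I : Finset (Fin 5)) :
    LaurentSeries ℚ := invGrowth (I.image e)

lemma invGrowthFace_empty : invGrowthFace e ∅ = 1 := by
  rw [invGrowthFace, Finset.image_empty, invGrowth, growthSeries_empty, map_one, inv_one]

lemma IsSimplex.face_euler (he : IsSimplex e) {I : Finset (Fin 5)} {l : List (Fin 5)}
    (h : IsLongestFrom I simpleRoots l) :
    ∑ J ∈ I.powerset, (-1) ^ J.card * invGrowthFace e J = laurentX ^ l.length * invGrowthFace e I :=
  he.euler_of_isLongest h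

lemma IsSimplex.face_one (he : IsSimplex e) (i : Fin 5) :
    invGrowthFace e {i} * (1 + laurentX) = 1 := by
  have hl : ∀ i : Fin 5, IsLongestFrom {i} simpleRoots [i] := by decide +kernel
  have h := he.face_euler (hl i)
  rw [sum_powerset_fin_one (invGrowthFace e)] at h
  rw [invGrowthFace_empty, List.length_singleton] at h
  linear_combination -h

/-- Write f for inverse growth series. The longest element of length m gives 1 - f_i - f_j + f_ij =
x^m f_ij with f_i = f_j = 1/(1 + x); it remains to solve for f_ij and cancel 1 - x. -/
lemma IsSimplex.face_two (he : IsSimplex e) {i j : Fin 5} (hij : i ≠ j) :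
    invGrowthFace e {i, j} * ((1 + laurentX) * ∑ k ∈ Finset.range (edgeLabel i j), laurentX ^ k)
      = 1 := by
  have hl : ∀ i j : Fin 5, i ≠ j → IsLongestFrom {i, j} simpleRoots
      ([i, j, i, j, i].take (edgeLabel i j)) ∧ edgeLabel i j ≤ 5 := by decide +kernel
  have h := he.face_euler (hl i j hij).1
  rw [sum_powerset_fin_two (invGrowthFace e) hij, List.length_take_of_le (by simpa using (hl i j hij).2)] at h
  rw [invGrowthFace_empty] at h
  have h1 := he.face_one i
  have h2 := he.face_one j
  refine mul_left_cancel₀ one_sub_laurentX_ne_zero ?_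
  have h3 := mul_neg_geom_sum laurentX (edgeLabel i j)
  linear_combination invGrowthFace e {i, j} * (1 + laurentX) * h3 + (1 + laurentX) * h + h1 + h2

/-- In odd rank the unknown series occurs in the Euler relation with opposite signs on the two
sides, so solving for it means cancelling 1 + x^l, where l is the length of the longest element. The
types A₃ and H₃ are treated in the same way. -/
lemma IsSimplex.face_three_A111 (he : IsSimplex e) {i j k : Fin 5} (hij : edgeLabel i j = 2)
    (hik : edgeLabel i k = 2) (hjk : edgeLabel j k = 2) :
    invGrowthFace e {i, j, k} * (1 + laurentX) ^ 3 = 1 := by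
  have hl : ∀ i j k : Fin 5, edgeLabel i j = 2 → edgeLabel i k = 2 → edgeLabel j k = 2 →
      IsLongestFrom {i, j, k} simpleRoots [i, j, k] ∧ i ≠ j ∧ i ≠ k ∧ j ≠ k := by decide +kernel
  obtain ⟨hl, h1, h2, h3⟩ := hl i j k hij hik hjk
  have h := he.face_euler hl
  rw [sum_powerset_fin_three (invGrowthFace e) h1 h2 h3] at h
  simp only [invGrowthFace_empty, List.length_cons, List.length_nil] at h
  have hi := he.face_one i
  have hj := he.face_one j
  have hk := he.face_one k
  have hij' := he.face_two h1
  have hik' := he.face_two h2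
  have hjk' := he.face_two h3
  rw [hij] at hij'; rw [hik] at hik'; rw [hjk] at hjk'
  simp only [Finset.sum_range_succ, Finset.sum_range_zero] at hij' hik' hjk'
  refine mul_left_cancel₀ (one_add_laurentX_pow_ne_zero (show 3 ≠ 0 by norm_num)) ?_
  generalize laurentX = x at *
  linear_combination (-((1 + x) ^ 3)) * h - ((1 + x) ^ 2) * (hi + hj + hk) +
    (1 + x) * hij' + (1 + x) * hik' + (1 + x) * hjk'

lemma IsSimplex.face_three_A3 (he : IsSimplex e) {i j k : Fin 5} (hij : edgeLabel i j = 3)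
    (hik : edgeLabel i k = 2) (hjk : edgeLabel j k = 3) :
    invGrowthFace e {i, j, k} * ((1 + laurentX) * (1 + laurentX + laurentX ^ 2) *
      (1 + laurentX + laurentX ^ 2 + laurentX ^ 3)) = 1 := by
  have hl : ∀ i j k : Fin 5, edgeLabel i j = 3 → edgeLabel i k = 2 → edgeLabel j k = 3 →
      IsLongestFrom {i, j, k} simpleRoots [i, j, i, k, j, i] ∧ i ≠ j ∧ i ≠ k ∧ j ≠ k := by
    decide +kernel
  obtain ⟨hl, h1, h2, h3⟩ := hl i j k hij hik hjk
  have h := he.face_euler hl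
  rw [sum_powerset_fin_three (invGrowthFace e) h1 h2 h3] at h
  simp only [invGrowthFace_empty, List.length_cons, List.length_nil] at h
  have hi := he.face_one i
  have hj := he.face_one j
  have hk := he.face_one k
  have hij' := he.face_two h1
  have hik' := he.face_two h2
  have hjk' := he.face_two h3
  rw [hij] at hij'; rw [hik] at hik'; rw [hjk] at hjk'
  simp only [Finset.sum_range_succ, Finset.sum_range_zero] at hij' hik' hjk'
  refine mul_left_cancel₀ (one_add_laurentX_pow_ne_zero (show 6 ≠ 0 by norm_num)) ?_
  generalize laurentX = x at *
  linear_combination (-((1 + x) * (1 + x + x ^ 2) * (1 + x + x ^ 2 + x ^ 3))) * h - ((1 + x + x ^ 2) * (1 + x + x ^ 2 + x ^ 3)) * (hi + hj + hk) +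
    (1 + x + x ^ 2 + x ^ 3) * hij' + ((1 + x + x ^ 2) * (1 + x ^ 2)) * hik' + (1 + x + x ^ 2 + x ^ 3) * hjk'

lemma IsSimplex.face_three_H3 (he : IsSimplex e) {i j k : Fin 5} (hij : edgeLabel i j = 5)
    (hik : edgeLabel i k = 2) (hjk : edgeLabel j k = 3) :
    invGrowthFace e {i, j, k} * ((1 + laurentX) *
      (1 + laurentX + laurentX ^ 2 + laurentX ^ 3 + laurentX ^ 4 + laurentX ^ 5) *
      (1 + laurentX + laurentX ^ 2 + laurentX ^ 3 + laurentX ^ 4 + laurentX ^ 5 + laurentX ^ 6 +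
        laurentX ^ 7 + laurentX ^ 8 + laurentX ^ 9)) = 1 := by
  -- The Coxeter number of H₃ is 10, and the longest element, of length 15, is the fifth power of a
  -- Coxeter element. The factors of the denominator correspond to the degrees 2, 6, 10.
  have hl : ∀ i j k : Fin 5, edgeLabel i j = 5 → edgeLabel i k = 2 → edgeLabel j k = 3 →
      IsLongestFrom {i, j, k} simpleRoots [i, j, k, i, j, k, i, j, k, i, j, k, i, j, k] ∧
        i ≠ j ∧ i ≠ k ∧ j ≠ k := by
    decide +kernel
  obtain ⟨hl, h1, h2, h3⟩ := hl i j k hij hik hjk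
  have h := he.face_euler hl
  rw [sum_powerset_fin_three (invGrowthFace e) h1 h2 h3] at h
  simp only [invGrowthFace_empty, List.length_cons, List.length_nil] at h
  have hi := he.face_one i
  have hj := he.face_one j
  have hk := he.face_one k
  have hij' := he.face_two h1
  have hik' := he.face_two h2
  have hjk' := he.face_two h3
  rw [hij] at hij'; rw [hik] at hik'; rw [hjk] at hjk'
  simp only [Finset.sum_range_succ, Finset.sum_range_zero] at hij' hik' hjk'
  refine mul_left_cancel₀ (one_add_laurentX_pow_ne_zero (show 15 ≠ 0 by norm_num)) ?_
  generalize laurentX = x at *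
  linear_combination (-((1 + x) * (1 + x + x ^ 2 + x ^ 3 + x ^ 4 + x ^ 5) *
      (1 + x + x ^ 2 + x ^ 3 + x ^ 4 + x ^ 5 + x ^ 6 + x ^ 7 + x ^ 8 + x ^ 9))) * h - ((1 + x + x ^ 2 + x ^ 3 + x ^ 4 + x ^ 5) *
      (1 + x + x ^ 2 + x ^ 3 + x ^ 4 + x ^ 5 + x ^ 6 + x ^ 7 + x ^ 8 + x ^ 9)) * (hi + hj + hk) +
    ((1 + x + x ^ 2 + x ^ 3 + x ^ 4 + x ^ 5) * (1 + x ^ 5)) * hij' + ((1 + x ^ 2 + x ^ 4) *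
      (1 + x + x ^ 2 + x ^ 3 + x ^ 4 + x ^ 5 + x ^ 6 + x ^ 7 + x ^ 8 + x ^ 9)) * hik' + ((1 + x ^ 3) *
      (1 + x + x ^ 2 + x ^ 3 + x ^ 4 + x ^ 5 + x ^ 6 + x ^ 7 + x ^ 8 + x ^ 9)) * hjk'

end SimplexGrowth

/-! ### Facet groups and the whole simplex group over a common denominator -/

section SimplexGrowth

variable {e : Fin 5 → LorentzSpace}

lemma sum_powerset_fin_five {K : Type*} [CommRing K] (F : Finset (Fin 5) → K) :
    ∑ I ∈ ({0, 1, 2, 3, 4} : Finset (Fin 5)).powerset, (-1) ^ I.card * F I =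
      F ∅ - F {0} - F {1} - F {2} - F {3} - F {4} + F {0, 1} + F {0, 2} + F {0, 3} + F {0, 4} +
      F {1, 2} + F {1, 3} + F {1, 4} + F {2, 3} + F {2, 4} + F {3, 4} - F {0, 1, 2} - F {0, 1,
      3} - F {0, 1, 4} - F {0, 2, 3} - F {0, 2, 4} - F {0, 3, 4} - F {1, 2, 3} - F {1, 2, 4} - F
      {1, 3, 4} - F {2, 3, 4} + F {0, 1, 2, 3} + F {0, 1, 2, 4} + F {0, 1, 3, 4} + F {0, 2, 3,
      4} + F {1, 2, 3, 4} - F {0, 1, 2, 3, 4} := by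
  rw [sum_powerset_insert_alternating (by decide),
    sum_powerset_fin_four _ (by decide) (by decide) (by decide) (by decide) (by decide) (by decide),
    sum_powerset_fin_four (fun I => F (insert 0 I)) (by decide) (by decide) (by decide)
      (by decide) (by decide) (by decide)]
  simp only [insert_empty_eq]
  ring

lemma IsSimplex.face_euler_of_neg (he : IsSimplex e) {I : Finset (Fin 5)} (c : Fin 5 → ℝ)
    (hc : ∀ i, 0 ≤ c i) (hcI : ∀ i, i ∉ I → c i = 0)
    (hneg : 0 < ∑ i, ∑ j, c i * c j * goldenVal (gramGolden i j)) :
    ∑ J ∈ I.powerset, (-1) ^ J.card * invGrowthFace e J = 0 :=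
  he.euler_of_neg c hc hcI hneg

/-- The numerator of the inverse growth series of a facet group, over `dominoDen`. -/
noncomputable def facetNum {R : Type*} [CommRing R] (x : R) : FacetType → R
  | .A => 1 - x ^ 2 - x ^ 3 - 2 * x ^ 4 - 2 * x ^ 5 - 2 * x ^ 6 - x ^ 7 + x ^ 11 + 2 * x ^ 12 + 2 *
      x ^ 13 + 2 * x ^ 14 + x ^ 15 + x ^ 16 - x ^ 18
  | .B => 1 - x ^ 3 - x ^ 4 - 2 * x ^ 5 - x ^ 6 - x ^ 7 + x ^ 11 + x ^ 12 + 2 * x ^ 13 + x ^ 14 + x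
      ^ 15 - x ^ 18
  | .C => 1 - x ^ 2 - 2 * x ^ 3 - 4 * x ^ 4 - 4 * x ^ 5 - 3 * x ^ 6 - 2 * x ^ 7 - x ^ 8 + x ^ 10 + 2
      * x ^ 11 + 3 * x ^ 12 + 4 * x ^ 13 + 4 * x ^ 14 + 2 * x ^ 15 + x ^ 16 - x ^ 18

lemma IsSimplex.face_one_den (he : IsSimplex e) {I : Finset (Fin 5)} {i : Fin 5}
    (hI : I = {i}) : invGrowthFace e I * dominoDen laurentX =
      (1 + laurentX) * (1 + laurentX ^ 2) * (1 + laurentX + laurentX ^ 2 + laurentX ^ 3 +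
      laurentX ^ 4 + laurentX ^ 5) * (1 + laurentX + laurentX ^ 2 + laurentX ^ 3 + laurentX ^ 4
      + laurentX ^ 5 + laurentX ^ 6 + laurentX ^ 7 + laurentX ^ 8 + laurentX ^ 9) := by
  subst hI
  have h := he.face_one i
  rw [dominoDen]
  generalize laurentX = x at *
  linear_combination ((1 + x) * (1 + x ^ 2) * (1 + x + x ^ 2 + x ^ 3 + x ^ 4 + x ^ 5) * (1 + x + x ^ 2 + x ^ 3 + x
    ^ 4 + x ^ 5 + x ^ 6 + x ^ 7 + x ^ 8 + x ^ 9)) * h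

lemma IsSimplex.face_two_den_two (he : IsSimplex e) {I : Finset (Fin 5)} {i j : Fin 5} (hij : i ≠ j) (hm : edgeLabel i j = 2)
    (hI : I = {i, j}) : invGrowthFace e I * dominoDen laurentX =
      (1 + laurentX ^ 2) * (1 + laurentX + laurentX ^ 2 + laurentX ^ 3 + laurentX ^ 4 + laurentX
      ^ 5) * (1 + laurentX + laurentX ^ 2 + laurentX ^ 3 + laurentX ^ 4 + laurentX ^ 5 +
      laurentX ^ 6 + laurentX ^ 7 + laurentX ^ 8 + laurentX ^ 9) := by
  subst hI
  have h := he.face_two hij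
  simp only [hm, Finset.sum_range_succ, Finset.sum_range_zero] at h
  rw [dominoDen]
  generalize laurentX = x at *
  linear_combination ((1 + x ^ 2) * (1 + x + x ^ 2 + x ^ 3 + x ^ 4 + x ^ 5) * (1 + x + x ^ 2 + x ^ 3 + x ^ 4 + x ^
    5 + x ^ 6 + x ^ 7 + x ^ 8 + x ^ 9)) * h

lemma IsSimplex.face_two_den_three (he : IsSimplex e) {I : Finset (Fin 5)} {i j : Fin 5} (hij : i ≠ j) (hm : edgeLabel i j = 3)
    (hI : I = {i, j}) : invGrowthFace e I * dominoDen laurentX =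
      (1 + laurentX) * (1 + laurentX ^ 2) * (1 + laurentX ^ 3) * (1 + laurentX + laurentX ^ 2 +
      laurentX ^ 3 + laurentX ^ 4 + laurentX ^ 5 + laurentX ^ 6 + laurentX ^ 7 + laurentX ^ 8 +
      laurentX ^ 9) := by
  subst hI
  have h := he.face_two hij
  simp only [hm, Finset.sum_range_succ, Finset.sum_range_zero] at h
  rw [dominoDen]
  generalize laurentX = x at *
  linear_combination ((1 + x) * (1 + x ^ 2) * (1 + x ^ 3) * (1 + x + x ^ 2 + x ^ 3 + x ^ 4 + x ^ 5 + x ^ 6 + x ^ 7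
    + x ^ 8 + x ^ 9)) * h

lemma IsSimplex.face_two_den_five (he : IsSimplex e) {I : Finset (Fin 5)} {i j : Fin 5} (hij : i ≠ j) (hm : edgeLabel i j = 5)
    (hI : I = {i, j}) : invGrowthFace e I * dominoDen laurentX =
      (1 + laurentX) * (1 + laurentX ^ 2) * (1 + laurentX ^ 5) * (1 + laurentX + laurentX ^ 2 +
      laurentX ^ 3 + laurentX ^ 4 + laurentX ^ 5) := by
  subst hI
  have h := he.face_two hij
  simp only [hm, Finset.sum_range_succ, Finset.sum_range_zero] at h
  rw [dominoDen]
  generalize laurentX = x at *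
  linear_combination ((1 + x) * (1 + x ^ 2) * (1 + x ^ 5) * (1 + x + x ^ 2 + x ^ 3 + x ^ 4 + x ^ 5)) * h

lemma IsSimplex.face_three_den_A111 (he : IsSimplex e) {I : Finset (Fin 5)} {i j k : Fin 5} (hij : edgeLabel i j = 2)
    (hik : edgeLabel i k = 2) (hjk : edgeLabel j k = 2)
    (hI : I = {i, j, k}) : invGrowthFace e I * dominoDen laurentX =
      (1 + laurentX ^ 2) * (1 + laurentX + laurentX ^ 2 + laurentX ^ 3 + laurentX ^ 4 + laurentX
      ^ 5) * (1 + laurentX ^ 2 + laurentX ^ 4 + laurentX ^ 6 + laurentX ^ 8) := by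
  subst hI
  have h := he.face_three_A111 hij hik hjk
  rw [dominoDen]
  generalize laurentX = x at *
  linear_combination ((1 + x ^ 2) * (1 + x + x ^ 2 + x ^ 3 + x ^ 4 + x ^ 5) * (1 + x ^ 2 + x ^ 4 + x ^ 6 + x ^ 8)) * h

lemma IsSimplex.face_three_den_A3 (he : IsSimplex e) {I : Finset (Fin 5)} {i j k : Fin 5} (hij : edgeLabel i j = 3)
    (hik : edgeLabel i k = 2) (hjk : edgeLabel j k = 3)
    (hI : I = {i, j, k}) : invGrowthFace e I * dominoDen laurentX =
      (1 + laurentX ^ 3) * (1 + laurentX + laurentX ^ 2 + laurentX ^ 3 + laurentX ^ 4 + laurentX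
      ^ 5 + laurentX ^ 6 + laurentX ^ 7 + laurentX ^ 8 + laurentX ^ 9) := by
  subst hI
  have h := he.face_three_A3 hij hik hjk
  rw [dominoDen]
  generalize laurentX = x at *
  linear_combination ((1 + x ^ 3) * (1 + x + x ^ 2 + x ^ 3 + x ^ 4 + x ^ 5 + x ^ 6 + x ^ 7 + x ^ 8 + x ^ 9)) * h

/-- The set enters through an equation so that a face listed in increasing order can be matched with
its diagram read from the edge labelled 5. -/
lemma IsSimplex.face_three_den_H3 (he : IsSimplex e) {I : Finset (Fin 5)} {i j k : Fin 5} (hij : edgeLabel i j = 5)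
    (hik : edgeLabel i k = 2) (hjk : edgeLabel j k = 3)
    (hI : I = {i, j, k}) : invGrowthFace e I * dominoDen laurentX =
      (1 + laurentX) * (1 + laurentX ^ 2) := by
  subst hI
  have h := he.face_three_H3 hij hik hjk
  rw [dominoDen]
  generalize laurentX = x at *
  linear_combination ((1 + x) * (1 + x ^ 2)) * h

/-- The alternating sum over all subsets of the four nodes is zero, because a time-like combination
of their normals exists. It therefore expresses the series of the facet group through finite
subgroups of rank at most three. The other four facets are handled alike. -/
lemma IsSimplex.face_four_0 (he : IsSimplex e) :
    invGrowthFace e {1, 2, 3, 4} * dominoDen laurentX = facetNum laurentX .A := by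
  have h1 := he.face_one_den (I := {1}) (i := 1) rfl
  have h2 := he.face_one_den (I := {2}) (i := 2) rfl
  have h3 := he.face_one_den (I := {3}) (i := 3) rfl
  have h4 := he.face_one_den (I := {4}) (i := 4) rfl
  have h12 := he.face_two_den_three (I := {1, 2}) (i := 1) (j := 2) (by decide) rfl rfl
  have h13 := he.face_two_den_two (I := {1, 3}) (i := 1) (j := 3) (by decide) rfl rfl
  have h14 := he.face_two_den_three (I := {1, 4}) (i := 1) (j := 4) (by decide) rfl rfl
  have h23 := he.face_two_den_five (I := {2, 3}) (i := 2) (j := 3) (by decide) rfl rfl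
  have h24 := he.face_two_den_two (I := {2, 4}) (i := 2) (j := 4) (by decide) rfl rfl
  have h34 := he.face_two_den_three (I := {3, 4}) (i := 3) (j := 4) (by decide) rfl rfl
  have h123 := he.face_three_den_H3 (I := {1, 2, 3}) (i := 3) (j := 2) (k := 1) rfl rfl rfl
    (by decide)
  have h124 := he.face_three_den_A3 (I := {1, 2, 4}) (i := 2) (j := 1) (k := 4) rfl rfl rfl
    (by decide)
  have h134 := he.face_three_den_A3 (I := {1, 3, 4}) (i := 1) (j := 4) (k := 3) rfl rfl rfl
    (by decide)
  have h234 := he.face_three_den_H3 (I := {2, 3, 4}) (i := 2) (j := 3) (k := 4) rfl rfl rfl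
    (by decide)
  -- For this 4-cycle equal weights already suffice: the double sum is 2φ - 2.
  have h := he.face_euler_of_neg (I := {1, 2, 3, 4}) ![0, 1, 1, 1, 1]
    (by intro i; fin_cases i <;> norm_num) (by intro i; fin_cases i <;> simp)
    (by simp [Fin.sum_univ_five, goldenVal, gramGolden, edgeLabel, simplexLabel]; have := Real.goldenRatio_sq; nlinarith [Real.one_lt_goldenRatio])
  rw [sum_powerset_fin_four (invGrowthFace e) (by decide) (by decide) (by decide) (by decide)
    (by decide) (by decide), invGrowthFace_empty] at h
  rw [dominoDen] at *
  simp only [facetNum]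
  generalize laurentX = x at *
  linear_combination ((1 + x) ^ 2 * (1 + x ^ 2) * (1 + x + x ^ 2 + x ^ 3 + x ^ 4 + x ^ 5) * (1 + x + x ^ 2 + x ^
    3 + x ^ 4 + x ^ 5 + x ^ 6 + x ^ 7 + x ^ 8 + x ^ 9)) * h + h1 + h2 + h3 + h4 - h12 - h13 -
    h14 - h23 - h24 - h34 + h123 + h124 + h134 + h234

lemma IsSimplex.face_four_1 (he : IsSimplex e) :
    invGrowthFace e {0, 2, 3, 4} * dominoDen laurentX = facetNum laurentX .B := by
  have h0 := he.face_one_den (I := {0}) (i := 0) rfl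
  have h2 := he.face_one_den (I := {2}) (i := 2) rfl
  have h3 := he.face_one_den (I := {3}) (i := 3) rfl
  have h4 := he.face_one_den (I := {4}) (i := 4) rfl
  have h02 := he.face_two_den_two (I := {0, 2}) (i := 0) (j := 2) (by decide) rfl rfl
  have h03 := he.face_two_den_three (I := {0, 3}) (i := 0) (j := 3) (by decide) rfl rfl
  have h04 := he.face_two_den_two (I := {0, 4}) (i := 0) (j := 4) (by decide) rfl rfl
  have h23 := he.face_two_den_five (I := {2, 3}) (i := 2) (j := 3) (by decide) rfl rfl
  have h24 := he.face_two_den_two (I := {2, 4}) (i := 2) (j := 4) (by decide) rfl rfl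
  have h34 := he.face_two_den_three (I := {3, 4}) (i := 3) (j := 4) (by decide) rfl rfl
  have h023 := he.face_three_den_H3 (I := {0, 2, 3}) (i := 2) (j := 3) (k := 0) rfl rfl rfl
    (by decide)
  have h024 := he.face_three_den_A111 (I := {0, 2, 4}) (i := 0) (j := 2) (k := 4) rfl rfl rfl
    (by decide)
  have h034 := he.face_three_den_A3 (I := {0, 3, 4}) (i := 0) (j := 3) (k := 4) rfl rfl rfl
    (by decide)
  have h234 := he.face_three_den_H3 (I := {2, 3, 4}) (i := 2) (j := 3) (k := 4) rfl rfl rfl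
    (by decide)
  -- Equal weights fail for the star. More weight goes to its centre, node 3, and to node 2 at the
  -- other end of the edge labelled 5; the double sum is then 6φ - 17/2.
  have h := he.face_euler_of_neg (I := {0, 2, 3, 4}) ![1, 0, 3 / 2, 2, 1]
    (by intro i; fin_cases i <;> norm_num) (by intro i; fin_cases i <;> simp)
    (by simp [Fin.sum_univ_five, goldenVal, gramGolden, edgeLabel, simplexLabel]; have := Real.goldenRatio_sq; nlinarith [Real.one_lt_goldenRatio])
  rw [sum_powerset_fin_four (invGrowthFace e) (by decide) (by decide) (by decide) (by decide)
    (by decide) (by decide), invGrowthFace_empty] at h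
  rw [dominoDen] at *
  simp only [facetNum]
  generalize laurentX = x at *
  linear_combination ((1 + x) ^ 2 * (1 + x ^ 2) * (1 + x + x ^ 2 + x ^ 3 + x ^ 4 + x ^ 5) * (1 + x + x ^ 2 + x ^
    3 + x ^ 4 + x ^ 5 + x ^ 6 + x ^ 7 + x ^ 8 + x ^ 9)) * h + h0 + h2 + h3 + h4 - h02 - h03 -
    h04 - h23 - h24 - h34 + h023 + h024 + h034 + h234

lemma IsSimplex.face_four_2 (he : IsSimplex e) :
    invGrowthFace e {0, 1, 3, 4} * dominoDen laurentX = facetNum laurentX .A := by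
  have h0 := he.face_one_den (I := {0}) (i := 0) rfl
  have h1 := he.face_one_den (I := {1}) (i := 1) rfl
  have h3 := he.face_one_den (I := {3}) (i := 3) rfl
  have h4 := he.face_one_den (I := {4}) (i := 4) rfl
  have h01 := he.face_two_den_five (I := {0, 1}) (i := 0) (j := 1) (by decide) rfl rfl
  have h03 := he.face_two_den_three (I := {0, 3}) (i := 0) (j := 3) (by decide) rfl rfl
  have h04 := he.face_two_den_two (I := {0, 4}) (i := 0) (j := 4) (by decide) rfl rfl
  have h13 := he.face_two_den_two (I := {1, 3}) (i := 1) (j := 3) (by decide) rfl rfl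
  have h14 := he.face_two_den_three (I := {1, 4}) (i := 1) (j := 4) (by decide) rfl rfl
  have h34 := he.face_two_den_three (I := {3, 4}) (i := 3) (j := 4) (by decide) rfl rfl
  have h013 := he.face_three_den_H3 (I := {0, 1, 3}) (i := 1) (j := 0) (k := 3) rfl rfl rfl
    (by decide)
  have h014 := he.face_three_den_H3 (I := {0, 1, 4}) (i := 0) (j := 1) (k := 4) rfl rfl rfl
    (by decide)
  have h034 := he.face_three_den_A3 (I := {0, 3, 4}) (i := 0) (j := 3) (k := 4) rfl rfl rfl
    (by decide)
  have h134 := he.face_three_den_A3 (I := {1, 3, 4}) (i := 1) (j := 4) (k := 3) rfl rfl rfl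
    (by decide)
  have h := he.face_euler_of_neg (I := {0, 1, 3, 4}) ![1, 1, 0, 1, 1]
    (by intro i; fin_cases i <;> norm_num) (by intro i; fin_cases i <;> simp)
    (by simp [Fin.sum_univ_five, goldenVal, gramGolden, edgeLabel, simplexLabel]; have := Real.goldenRatio_sq; nlinarith [Real.one_lt_goldenRatio])
  rw [sum_powerset_fin_four (invGrowthFace e) (by decide) (by decide) (by decide) (by decide)
    (by decide) (by decide), invGrowthFace_empty] at h
  rw [dominoDen] at *
  simp only [facetNum]
  generalize laurentX = x at *
  linear_combination ((1 + x) ^ 2 * (1 + x ^ 2) * (1 + x + x ^ 2 + x ^ 3 + x ^ 4 + x ^ 5) * (1 + x + x ^ 2 + x ^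
    3 + x ^ 4 + x ^ 5 + x ^ 6 + x ^ 7 + x ^ 8 + x ^ 9)) * h + h0 + h1 + h3 + h4 - h01 - h03 -
    h04 - h13 - h14 - h34 + h013 + h014 + h034 + h134

lemma IsSimplex.face_four_3 (he : IsSimplex e) :
    invGrowthFace e {0, 1, 2, 4} * dominoDen laurentX = facetNum laurentX .B := by
  have h0 := he.face_one_den (I := {0}) (i := 0) rfl
  have h1 := he.face_one_den (I := {1}) (i := 1) rfl
  have h2 := he.face_one_den (I := {2}) (i := 2) rfl
  have h4 := he.face_one_den (I := {4}) (i := 4) rfl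
  have h01 := he.face_two_den_five (I := {0, 1}) (i := 0) (j := 1) (by decide) rfl rfl
  have h02 := he.face_two_den_two (I := {0, 2}) (i := 0) (j := 2) (by decide) rfl rfl
  have h04 := he.face_two_den_two (I := {0, 4}) (i := 0) (j := 4) (by decide) rfl rfl
  have h12 := he.face_two_den_three (I := {1, 2}) (i := 1) (j := 2) (by decide) rfl rfl
  have h14 := he.face_two_den_three (I := {1, 4}) (i := 1) (j := 4) (by decide) rfl rfl
  have h24 := he.face_two_den_two (I := {2, 4}) (i := 2) (j := 4) (by decide) rfl rfl
  have h012 := he.face_three_den_H3 (I := {0, 1, 2}) (i := 0) (j := 1) (k := 2) rfl rfl rfl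
    (by decide)
  have h014 := he.face_three_den_H3 (I := {0, 1, 4}) (i := 0) (j := 1) (k := 4) rfl rfl rfl
    (by decide)
  have h024 := he.face_three_den_A111 (I := {0, 2, 4}) (i := 0) (j := 2) (k := 4) rfl rfl rfl
    (by decide)
  have h124 := he.face_three_den_A3 (I := {1, 2, 4}) (i := 2) (j := 1) (k := 4) rfl rfl rfl
    (by decide)
  have h := he.face_euler_of_neg (I := {0, 1, 2, 4}) ![3 / 2, 2, 1, 0, 1]
    (by intro i; fin_cases i <;> norm_num) (by intro i; fin_cases i <;> simp)
    (by simp [Fin.sum_univ_five, goldenVal, gramGolden, edgeLabel, simplexLabel]; have := Real.goldenRatio_sq; nlinarith [Real.one_lt_goldenRatio])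
  rw [sum_powerset_fin_four (invGrowthFace e) (by decide) (by decide) (by decide) (by decide)
    (by decide) (by decide), invGrowthFace_empty] at h
  rw [dominoDen] at *
  simp only [facetNum]
  generalize laurentX = x at *
  linear_combination ((1 + x) ^ 2 * (1 + x ^ 2) * (1 + x + x ^ 2 + x ^ 3 + x ^ 4 + x ^ 5) * (1 + x + x ^ 2 + x ^
    3 + x ^ 4 + x ^ 5 + x ^ 6 + x ^ 7 + x ^ 8 + x ^ 9)) * h + h0 + h1 + h2 + h4 - h01 - h02 -
    h04 - h12 - h14 - h24 + h012 + h014 + h024 + h124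

lemma IsSimplex.face_four_4 (he : IsSimplex e) :
    invGrowthFace e {0, 1, 2, 3} * dominoDen laurentX = facetNum laurentX .C := by
  have h0 := he.face_one_den (I := {0}) (i := 0) rfl
  have h1 := he.face_one_den (I := {1}) (i := 1) rfl
  have h2 := he.face_one_den (I := {2}) (i := 2) rfl
  have h3 := he.face_one_den (I := {3}) (i := 3) rfl
  have h01 := he.face_two_den_five (I := {0, 1}) (i := 0) (j := 1) (by decide) rfl rfl
  have h02 := he.face_two_den_two (I := {0, 2}) (i := 0) (j := 2) (by decide) rfl rfl
  have h03 := he.face_two_den_three (I := {0, 3}) (i := 0) (j := 3) (by decide) rfl rfl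
  have h12 := he.face_two_den_three (I := {1, 2}) (i := 1) (j := 2) (by decide) rfl rfl
  have h13 := he.face_two_den_two (I := {1, 3}) (i := 1) (j := 3) (by decide) rfl rfl
  have h23 := he.face_two_den_five (I := {2, 3}) (i := 2) (j := 3) (by decide) rfl rfl
  have h012 := he.face_three_den_H3 (I := {0, 1, 2}) (i := 0) (j := 1) (k := 2) rfl rfl rfl
    (by decide)
  have h013 := he.face_three_den_H3 (I := {0, 1, 3}) (i := 1) (j := 0) (k := 3) rfl rfl rfl
    (by decide)
  have h023 := he.face_three_den_H3 (I := {0, 2, 3}) (i := 2) (j := 3) (k := 0) rfl rfl rfl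
    (by decide)
  have h123 := he.face_three_den_H3 (I := {1, 2, 3}) (i := 3) (j := 2) (k := 1) rfl rfl rfl
    (by decide)
  have h := he.face_euler_of_neg (I := {0, 1, 2, 3}) ![1, 1, 1, 1, 0]
    (by intro i; fin_cases i <;> norm_num) (by intro i; fin_cases i <;> simp)
    (by simp [Fin.sum_univ_five, goldenVal, gramGolden, edgeLabel, simplexLabel]; have := Real.goldenRatio_sq; nlinarith [Real.one_lt_goldenRatio])
  rw [sum_powerset_fin_four (invGrowthFace e) (by decide) (by decide) (by decide) (by decide)
    (by decide) (by decide), invGrowthFace_empty] at h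
  rw [dominoDen] at *
  simp only [facetNum]
  generalize laurentX = x at *
  linear_combination ((1 + x) ^ 2 * (1 + x ^ 2) * (1 + x + x ^ 2 + x ^ 3 + x ^ 4 + x ^ 5) * (1 + x + x ^ 2 + x ^
    3 + x ^ 4 + x ^ 5 + x ^ 6 + x ^ 7 + x ^ 8 + x ^ 9)) * h + h0 + h1 + h2 + h3 - h01 - h02 -
    h03 - h12 - h13 - h23 + h012 + h013 + h023 + h123

/-- The Euler sum over all five nodes is zero as well, so the series of the whole group follows from
those of its proper parabolic subgroups, including the five facet groups. -/
lemma IsSimplex.face_univ (he : IsSimplex e) :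
    invGrowthFace e Finset.univ * dominoDen laurentX =
      1 - laurentX - 2 * laurentX ^ 2 - 3 * laurentX ^ 3 - 3 * laurentX ^ 4 - 3 * laurentX ^ 5 -
      laurentX ^ 6 + laurentX ^ 7 + 4 * laurentX ^ 8 + 4 * laurentX ^ 9 + 5 * laurentX ^ 10 + 7
      * laurentX ^ 11 + 8 * laurentX ^ 12 + 9 * laurentX ^ 13 + 7 * laurentX ^ 14 + 3 * laurentX
      ^ 15 + laurentX ^ 16 - laurentX ^ 17 - 4 * laurentX ^ 18 := by
  rw [show (Finset.univ : Finset (Fin 5)) = {0, 1, 2, 3, 4} by decide]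
  have h0 := he.face_one_den (I := {0}) (i := 0) rfl
  have h1 := he.face_one_den (I := {1}) (i := 1) rfl
  have h2 := he.face_one_den (I := {2}) (i := 2) rfl
  have h3 := he.face_one_den (I := {3}) (i := 3) rfl
  have h4 := he.face_one_den (I := {4}) (i := 4) rfl
  have h01 := he.face_two_den_five (I := {0, 1}) (i := 0) (j := 1) (by decide) rfl rfl
  have h02 := he.face_two_den_two (I := {0, 2}) (i := 0) (j := 2) (by decide) rfl rfl
  have h03 := he.face_two_den_three (I := {0, 3}) (i := 0) (j := 3) (by decide) rfl rfl
  have h04 := he.face_two_den_two (I := {0, 4}) (i := 0) (j := 4) (by decide) rfl rfl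
  have h12 := he.face_two_den_three (I := {1, 2}) (i := 1) (j := 2) (by decide) rfl rfl
  have h13 := he.face_two_den_two (I := {1, 3}) (i := 1) (j := 3) (by decide) rfl rfl
  have h14 := he.face_two_den_three (I := {1, 4}) (i := 1) (j := 4) (by decide) rfl rfl
  have h23 := he.face_two_den_five (I := {2, 3}) (i := 2) (j := 3) (by decide) rfl rfl
  have h24 := he.face_two_den_two (I := {2, 4}) (i := 2) (j := 4) (by decide) rfl rfl
  have h34 := he.face_two_den_three (I := {3, 4}) (i := 3) (j := 4) (by decide) rfl rfl
  have h012 := he.face_three_den_H3 (I := {0, 1, 2}) (i := 0) (j := 1) (k := 2) rfl rfl rfl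
    (by decide)
  have h013 := he.face_three_den_H3 (I := {0, 1, 3}) (i := 1) (j := 0) (k := 3) rfl rfl rfl
    (by decide)
  have h014 := he.face_three_den_H3 (I := {0, 1, 4}) (i := 0) (j := 1) (k := 4) rfl rfl rfl
    (by decide)
  have h023 := he.face_three_den_H3 (I := {0, 2, 3}) (i := 2) (j := 3) (k := 0) rfl rfl rfl
    (by decide)
  have h024 := he.face_three_den_A111 (I := {0, 2, 4}) (i := 0) (j := 2) (k := 4) rfl rfl rfl
    (by decide)
  have h034 := he.face_three_den_A3 (I := {0, 3, 4}) (i := 0) (j := 3) (k := 4) rfl rfl rfl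
    (by decide)
  have h123 := he.face_three_den_H3 (I := {1, 2, 3}) (i := 3) (j := 2) (k := 1) rfl rfl rfl
    (by decide)
  have h124 := he.face_three_den_A3 (I := {1, 2, 4}) (i := 2) (j := 1) (k := 4) rfl rfl rfl
    (by decide)
  have h134 := he.face_three_den_A3 (I := {1, 3, 4}) (i := 1) (j := 4) (k := 3) rfl rfl rfl
    (by decide)
  have h234 := he.face_three_den_H3 (I := {2, 3, 4}) (i := 2) (j := 3) (k := 4) rfl rfl rfl
    (by decide)
  have h0123 := he.face_four_4
  have h0124 := he.face_four_3
  have h0134 := he.face_four_2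
  have h0234 := he.face_four_1
  have h1234 := he.face_four_0
  have h := he.face_euler_of_neg (I := {0, 1, 2, 3, 4}) ![1, 1, 1, 1, 1]
    (by intro i; fin_cases i <;> simp) (by intro i; fin_cases i <;> simp)
    (by simp [Fin.sum_univ_five, goldenVal, gramGolden, edgeLabel, simplexLabel]; have := Real.goldenRatio_sq; nlinarith [Real.one_lt_goldenRatio])
  rw [sum_powerset_fin_five (invGrowthFace e), invGrowthFace_empty] at h
  rw [dominoDen] at *
  simp only [facetNum] at *
  generalize laurentX = x at *
  linear_combination -((1 + x) ^ 2 * (1 + x ^ 2) * (1 + x + x ^ 2 + x ^ 3 + x ^ 4 + x ^ 5) * (1 + x + x ^ 2 + x ^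
    3 + x ^ 4 + x ^ 5 + x ^ 6 + x ^ 7 + x ^ 8 + x ^ 9)) * h - h0 - h1 - h2 - h3 - h4 + h01 + h02
    + h03 + h04 + h12 + h13 + h14 + h23 + h24 + h34 - h012 - h013 - h014 - h023 - h024 - h034 -
    h123 - h124 - h134 - h234 + h0123 + h0124 + h0134 + h0234 + h1234

end SimplexGrowth

/-! ### The geometry of the tile -/

section Tile

/-- A sufficient criterion for `a₁ + a₂ φ` to be positive. -/
def GoldenPos (a : ℤ × ℤ) : Prop :=
  0 < 1000 * a.1 + 1618 * a.2 ∧ 0 < 1000 * a.1 + 1619 * a.2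

instance (a : ℤ × ℤ) : Decidable (GoldenPos a) :=
  inferInstanceAs (Decidable (0 < 1000 * a.1 + 1618 * a.2 ∧ 0 < 1000 * a.1 + 1619 * a.2))

/-- Since 1.618 < φ < 1.619 and the value is affine in φ, positivity at both ends suffices. This
makes the sign conditions on the inverse Gram matrix decidable. -/
lemma GoldenPos.pos {a : ℤ × ℤ} (h : GoldenPos a) : 0 < goldenVal a := by
  have h1 : (0 : ℝ) < 1000 * a.1 + 1618 * a.2 := by exact_mod_cast h.1
  have h2 : (0 : ℝ) < 1000 * a.1 + 1619 * a.2 := by exact_mod_cast h.2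
  have h3 : 1618 < 1000 * Real.goldenRatio := by
    nlinarith [Real.goldenRatio_sq, Real.goldenRatio_pos]
  have h4 : 1000 * Real.goldenRatio < 1619 := by
    nlinarith [Real.goldenRatio_sq, Real.goldenRatio_pos]
  rw [goldenVal]
  nlinarith

lemma goldenVal_neg (a : ℤ × ℤ) : goldenVal (-a) = -goldenVal a := by
  simp only [goldenVal, Prod.fst_neg, Prod.snd_neg]; push_cast; ring

lemma goldenVal_sub (a b : ℤ × ℤ) : goldenVal (a - b) = goldenVal a - goldenVal b := by
  rw [sub_eq_add_neg, goldenVal_add, goldenVal_neg, sub_eq_add_neg]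

lemma goldenVal_sum {ι : Type*} (s : Finset ι) (f : ι → ℤ × ℤ) :
    goldenVal (∑ i ∈ s, f i) = ∑ i ∈ s, goldenVal (f i) := by
  classical
  induction s using Finset.induction_on with
  | empty => simp [goldenVal]
  | insert a s ha ih => rw [Finset.sum_insert ha, Finset.sum_insert ha, goldenVal_add, ih]

/-- `15` times the inverse of the Gram matrix of the simplex, over `ℤ[φ]`. -/
def invGram (i j : Fin 5) : ℤ × ℤ :=
  ![![(23, -11), (-12, 4), (-13, 1), (12, -14), (0, -5)],
    ![(-12, 4), (28, -16), (12, -14), (-8, -4), (10, -10)],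
    ![(-13, 1), (12, -14), (23, -11), (-12, 4), (0, -5)],
    ![(12, -14), (-8, -4), (-12, 4), (28, -16), (10, -10)],
    ![(0, -5), (10, -10), (0, -5), (10, -10), (25, -10)]] i j

/-- Here -30 = 15 · (-2), the product of the two scalings; the identity is verified by evaluation in
ℤ[φ]. -/
lemma sum_invGram_mul_gramGolden (i j : Fin 5) :
    ∑ k, goldenVal (invGram i k) * goldenVal (gramGolden k j) = if i = j then -30 else 0 := by
  have h : ∀ i j, ∑ k, goldenMul (invGram i k) (gramGolden k j) = if i = j then (-30, 0) else 0 := by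
    decide +kernel
  simp_rw [← goldenVal_mul]
  rw [← goldenVal_sum, h i j]
  split_ifs <;> simp [goldenVal]

/-- The vector dual to the `i`-th simple root, up to a factor. -/
noncomputable def dualRoot (e : Fin 5 → LorentzSpace) (i : Fin 5) : LorentzSpace :=
  ∑ j, goldenVal (invGram i j) • e j

variable {e v : Fin 5 → LorentzSpace}

lemma lorentz_dualRoot (hg : ∀ i j, -2 * lorentz (e i) (e j) = goldenVal (gramGolden i j))
    (i j : Fin 5) : lorentz (dualRoot e i) (e j) = if i = j then 15 else 0 := by
  rw [dualRoot, lorentz_sum_left]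
  have h := sum_invGram_mul_gramGolden i j
  simp_rw [← hg] at h
  have h2 : ∑ k, goldenVal (invGram i k) * (-2 * lorentz (e k) (e j)) =
      -2 * ∑ k, lorentz (goldenVal (invGram i k) • e k) (e j) := by
    rw [Finset.mul_sum]
    exact Finset.sum_congr rfl fun k _ => by rw [lorentz_smul_left]; ring
  rw [h2] at h
  split_ifs at h ⊢ <;> linarith

lemma lorentz_dualRoot_dualRoot
    (hg : ∀ i j, -2 * lorentz (e i) (e j) = goldenVal (gramGolden i j)) (i j : Fin 5) :
    lorentz (dualRoot e i) (dualRoot e j) = 15 * goldenVal (invGram j i) := by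
  conv_lhs => rw [dualRoot.eq_1 e j]
  rw [lorentz_sum_right]
  simp_rw [lorentz_smul_right, lorentz_dualRoot hg]
  simp; ring

lemma linearIndependent_of_gram (hg : ∀ i j, -2 * lorentz (e i) (e j) = goldenVal (gramGolden i j)) :
    LinearIndependent ℝ e := by
  rw [Fintype.linearIndependent_iff]
  intro g h i
  have h1 := congrArg (lorentz (dualRoot e i)) h
  rw [lorentz_sum_right, lorentz_zero_right] at h1
  simp_rw [lorentz_smul_right, lorentz_dualRoot hg] at h1
  simpa using h1

/-- The Gram matrix is invertible, so the e_j form a basis, and the Lorentz form is non-degenerate.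
-/
lemma eq_zero_of_lorentz_eq_zero
    (hg : ∀ i j, -2 * lorentz (e i) (e j) = goldenVal (gramGolden i j)) {y : LorentzSpace}
    (h : ∀ j, lorentz (e j) y = 0) : y = 0 := by
  have hspan := (linearIndependent_of_gram hg).span_eq_top_of_card_eq_finrank (by simp)
  have hall : ∀ z, lorentz z y = 0 := by
    intro z
    have hz : z ∈ Submodule.span ℝ (Set.range e) := by rw [hspan]; trivial
    induction hz using Submodule.span_induction with
    | mem z hz => obtain ⟨j, rfl⟩ := hz; exact h j
    | zero => simp
    | add a b _ _ ha hb => rw [lorentz_add_left, ha, hb, add_zero]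
    | smul c a _ ha => rw [lorentz_smul_left, ha, mul_zero]
  funext k
  have := hall (Pi.single k 1)
  fin_cases k <;> simpa [lorentz] using this

lemma neg_two_mul_neg_cos_simplexLabel (i j : Fin 5) :
    -2 * -Real.cos (Real.pi / (simplexLabel i j : ℝ)) = goldenVal (gramGolden i j) := by
  have key : ∀ i j : Fin 5, edgeLabel i j = 1 ∨ edgeLabel i j = 2 ∨ edgeLabel i j = 3 ∨
      edgeLabel i j = 5 := by decide
  change -2 * -Real.cos (Real.pi / (edgeLabel i j : ℝ)) = goldenVal (gramGolden i j)
  rw [gramGolden]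
  rcases key i j with hm | hm | hm | hm <;> rw [hm]
  · simp [goldenVal]
  · simp [goldenVal]
  · simp [goldenVal]
  · simp only [goldenVal, Nat.cast_ofNat, Real.cos_pi_div_five, Real.goldenRatio]
    push_cast; ring

lemma IsTile.gram_golden (h : IsTile e v) (i j : Fin 5) :
    -2 * lorentz (e i) (e j) = goldenVal (gramGolden i j) := by
  rw [h.gram, neg_two_mul_neg_cos_simplexLabel]

lemma IsTile.eq_smul_dualRoot (h : IsTile e v) (i : Fin 5) :
    v i = (lorentz (v i) (e i) / 15) • dualRoot e i := by
  rw [← sub_eq_zero]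
  refine eq_zero_of_lorentz_eq_zero h.gram_golden fun j => ?_
  rw [lorentz_comm, lorentz_sub_left, lorentz_smul_left, lorentz_dualRoot h.gram_golden]
  split_ifs with hij
  · subst hij; ring
  · rw [h.ortho i j hij]; ring

lemma IsTile.lorentz_vertices (h : IsTile e v) (i j : Fin 5) :
    lorentz (v i) (v j) = lorentz (v i) (e i) * lorentz (v j) (e j) * goldenVal (invGram i j) / 15 := by
  have hsymm : ∀ i j, invGram i j = invGram j i := by decide
  conv_lhs => rw [h.eq_smul_dualRoot i, h.eq_smul_dualRoot j]
  rw [lorentz_smul_left, lorentz_smul_right, lorentz_dualRoot_dualRoot h.gram_golden, hsymm j i]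
  ring

/-- Let g = `goldenVal (invGram i i)` and a = ⟨v_i,e_i⟩. Normalisation of v_i says a² g = 15 with 0
< g < 15, hence a² > 1, and a is negative. -/
lemma IsTile.vertex_facet (h : IsTile e v) (i : Fin 5) : lorentz (v i) (e i) ≤ -1 := by
  have h1 := h.lorentz_vertices i i
  rw [h.unit] at h1
  have hp : ∀ i, GoldenPos (invGram i i) := by decide
  have hp' : ∀ i, GoldenPos ((15, 0) - invGram i i) := by decide
  have h2 := (hp i).pos
  have h3 := (hp' i).pos
  rw [goldenVal_sub] at h3
  have h6 : goldenVal (15, 0) = 15 := by simp [goldenVal]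
  rw [h6] at h3
  have h4 := h.neg i
  by_contra! h5
  nlinarith [mul_pos h2 (show 0 < 1 - lorentz (v i) (e i) * lorentz (v i) (e i) by nlinarith)]

/-- The off-diagonal entries g_ij of the scaled inverse Gram matrix are negative and satisfy g_ij² >
g_ii g_jj. After normalisation the product is at most -1, so the truncating hyperplanes are
disjoint. -/
lemma IsTile.vertex_vertex (h : IsTile e v) {i j : Fin 5} (hij : i ≠ j) :
    lorentz (v i) (v j) ≤ -1 := by
  have hi := h.lorentz_vertices i i
  have hj := h.lorentz_vertices j j
  rw [h.unit] at hi hj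
  have hd : ∀ i j, i ≠ j → GoldenPos (-invGram i j) := by decide
  have hp : ∀ i, GoldenPos (invGram i i) := by decide
  have hdd : ∀ i j, i ≠ j → GoldenPos (goldenMul (invGram i j) (invGram i j) -
    goldenMul (invGram i i) (invGram j j)) := by decide
  have h1 := (hd i j hij).pos
  have h2 := (hdd i j hij).pos
  rw [goldenVal_sub, goldenVal_mul, goldenVal_mul] at h2
  rw [goldenVal_neg] at h1
  have h3 := h.lorentz_vertices i j
  have h4 := h.neg i
  have h5 := h.neg j
  have h7 : lorentz (v i) (v j) < 0 := by
    rw [h3]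
    have := mul_pos_of_neg_of_neg h4 h5
    have : lorentz (v i) (e i) * lorentz (v j) (e j) * goldenVal (invGram i j) < 0 :=
      mul_neg_of_pos_of_neg this (by linarith)
    linarith
  have h8 : 1 ≤ lorentz (v i) (v j) ^ 2 := by
    have e1 : lorentz (v i) (v j) ^ 2 = (lorentz (v i) (e i) * lorentz (v j) (e j)) ^ 2 / 225 *
        (goldenVal (invGram i j) * goldenVal (invGram i j)) := by rw [h3]; ring
    have e2 : (1 : ℝ) = (lorentz (v i) (e i) * lorentz (v j) (e j)) ^ 2 / 225 *
        (goldenVal (invGram i i) * goldenVal (invGram j j)) := by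
      linear_combination hi + (lorentz (v i) (e i) * lorentz (v i) (e i) *
        goldenVal (invGram i i) / 15) * hj
    rw [e1, e2]
    exact mul_le_mul_of_nonneg_left (by linarith) (by positivity)
  nlinarith

/-- The facet normals of a tile. -/
noncomputable def tileNormals (e v : Fin 5 → LorentzSpace) : Finset LorentzSpace :=
  Finset.univ.image e ∪ Finset.univ.image v

lemma coe_tileNormals : (tileNormals e v : Set LorentzSpace) = (truncatedSimplex e v).normals := by
  simp [tileNormals, truncatedSimplex]

lemma IsTile.unit_facet (h : IsTile e v) (i : Fin 5) : lorentz (e i) (e i) = 1 := by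
  have h1 := h.gram_golden i i
  have h2 : ∀ i, gramGolden i i = (-2, 0) := by decide
  rw [h2] at h1
  simp only [goldenVal] at h1
  push_cast at h1
  linarith

lemma IsTile.facet_facet (h : IsTile e v) {i j : Fin 5} (hij : i ≠ j) :
    lorentz (e i) (e j) = 0 ∨ lorentz (e i) (e j) = -1 / 2 ∨
      lorentz (e i) (e j) = -Real.goldenRatio / 2 := by
  have h1 := h.gram_golden i j
  have h2 : ∀ i j, i ≠ j → gramGolden i j = (0, 0) ∨ gramGolden i j = (1, 0) ∨
    gramGolden i j = (0, 1) := by decide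
  rcases h2 i j hij with h3 | h3 | h3 <;> rw [h3] at h1 <;> simp only [goldenVal] at h1 <;>
    push_cast at h1
  · left; linarith
  · right; left; linarith
  · right; right; linarith

lemma IsTile.facet_injective (h : IsTile e v) : Function.Injective e := by
  intro i j hij
  by_contra hne
  have h1 := h.facet_facet hne
  rw [← hij, h.unit_facet] at h1
  have := Real.goldenRatio_pos
  rcases h1 with h1 | h1 | h1 <;> linarith

lemma IsTile.vertex_injective (h : IsTile e v) : Function.Injective v := by
  intro i j hij
  by_contra hne
  have h1 := h.vertex_vertex hne
  rw [← hij, h.unit] at h1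
  linarith

lemma IsTile.vertex_facet_cases (h : IsTile e v) (i j : Fin 5) :
    (i ≠ j ∧ lorentz (v i) (e j) = 0) ∨ (i = j ∧ lorentz (v i) (e j) ≤ -1) := by
  by_cases hij : i = j
  · subst hij; exact Or.inr ⟨rfl, h.vertex_facet i⟩
  · exact Or.inl ⟨hij, h.ortho i j hij⟩

lemma IsTile.vertex_ne_facet (h : IsTile e v) (i j : Fin 5) : v i ≠ e j := by
  intro hij
  rcases h.vertex_facet_cases i j with ⟨-, h1⟩ | ⟨-, h1⟩ <;>
    rw [← hij, h.unit] at h1 <;> linarith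

lemma IsTile.coxeter (h : IsTile e v) :
    IsCoxeterNormals (truncatedSimplex e v).normals where
  unit := by
    rintro u (⟨i, rfl⟩ | ⟨i, rfl⟩)
    exacts [h.unit_facet i, h.unit i]
  angle := by
    rintro u (⟨i, rfl⟩ | ⟨i, rfl⟩) w (⟨j, rfl⟩ | ⟨j, rfl⟩) hne
    · have := h.facet_facet (i := i) (j := j) (by rintro rfl; exact hne rfl)
      tauto
    · rw [lorentz_comm]
      have := h.vertex_facet_cases j i
      tauto
    · have := h.vertex_facet_cases i j
      tauto
    · exact Or.inr (Or.inr (Or.inr (h.vertex_vertex (by rintro rfl; exact hne rfl))))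
  interior := by
    obtain ⟨x, hx, hx'⟩ := h.interior_nonempty
    exact ⟨x, ⟨by rw [hx.1]; norm_num, hx.2⟩, hx'⟩

lemma IsTile.isSimplex (h : IsTile e v) : IsSimplex e where
  gram := h.gram_golden
  coxeter := h.coxeter.mono (by rw [truncatedSimplex]; exact Set.subset_union_left)
  injective := h.facet_injective

/-- Orthogonal facets are added one at a time. The new normal is orthogonal to four of the e_j and
separated from all other normals present, which makes the group an amalgam over the facet group.
With f the inverse series of the latter, the change is f/(1 + x) - f. -/
lemma IsTile.invGrowth_partial (h : IsTile e v) (S : Finset (Fin 5)) :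
    invGrowth (Finset.univ.image e ∪ S.image v) = invGrowthFace e Finset.univ -
      laurentX / (1 + laurentX) * ∑ i ∈ S, invGrowthFace e (Finset.univ.erase i) := by
  have hx : (1 : LaurentSeries ℚ) + laurentX ≠ 0 := by
    simpa using one_add_laurentX_pow_ne_zero one_ne_zero
  induction S using Finset.induction_on with
  | empty => simp [invGrowthFace]
  | insert k S hk ih =>
    set P := Finset.univ.image e ∪ S.image v with hP
    set M := (Finset.univ.erase k).image e with hM
    have hvP : v k ∉ P := by
      simp only [hP, Finset.mem_union, Finset.mem_image, Finset.mem_univ, true_and, not_or,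
        not_exists, not_and]
      exact ⟨fun j hj => h.vertex_ne_facet k j hj.symm,
        fun j hj hjk => hk (h.vertex_injective hjk ▸ hj)⟩
    have hMP : M ⊆ P := fun u hu => by
      obtain ⟨j, -, rfl⟩ := Finset.mem_image.1 hu
      exact Finset.mem_union_left _ (Finset.mem_image_of_mem e (Finset.mem_univ j))
    have hunion : Finset.univ.image e ∪ (insert k S).image v = P ∪ insert (v k) M := by
      rw [Finset.union_insert, Finset.union_eq_left.2 hMP, Finset.image_insert,
        Finset.union_insert]
    have hinter : P ∩ insert (v k) M = M := by
      rw [Finset.inter_insert_of_notMem hvP, Finset.inter_eq_right.2 hMP]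
    have hN : IsCoxeterNormals ((P ∪ insert (v k) M : Finset LorentzSpace) : Set LorentzSpace) := by
      refine h.coxeter.mono ?_
      rw [← hunion, ← coe_tileNormals, tileNormals]
      exact_mod_cast Finset.union_subset_union_right (Finset.image_subset_image (Finset.subset_univ _))
    have hMv : ∀ m ∈ M, lorentz m (v k) = 0 := by
      intro m hm
      obtain ⟨j, hj, rfl⟩ := Finset.mem_image.1 hm
      rw [lorentz_comm]
      exact h.ortho k j (Finset.ne_of_mem_erase hj).symm
    rw [hunion, invGrowth_union hN, hinter, invGrowth_insert (hN.mono (by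
        exact_mod_cast Finset.subset_union_right)) hMv, ih,
      Finset.sum_insert hk]
    · change _ + invGrowthFace e (Finset.univ.erase k) / _ - invGrowthFace e (Finset.univ.erase k) = _
      field_simp
      ring
    · intro s hs hsQ t ht htP
      obtain rfl : t = v k := by
        rcases Finset.mem_insert.1 ht with h1 | h1
        · exact h1
        · exact absurd (hMP h1) htP
      rcases Finset.mem_union.1 hs with h1 | h1
      · obtain ⟨j, -, rfl⟩ := Finset.mem_image.1 h1
        rw [lorentz_comm]
        rcases h.vertex_facet_cases k j with ⟨h2, -⟩ | ⟨-, h2⟩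
        · exact absurd (Finset.mem_insert_of_mem (Finset.mem_image_of_mem e
            (Finset.mem_erase.2 ⟨h2.symm, Finset.mem_univ j⟩))) hsQ
        · exact h2
      · obtain ⟨j, hj, rfl⟩ := Finset.mem_image.1 h1
        exact h.vertex_vertex (by rintro rfl; exact hk hj)

/-- The face of the tile orthogonal to the `i`-th orthogonal facet. -/
lemma IsTile.face_four (h : IsTile e v) (i : Fin 5) :
    invGrowthFace e (Finset.univ.erase i) * dominoDen laurentX =
      facetNum laurentX (orthFacetType i) := by
  have he := h.isSimplex
  fin_cases i
  · exact he.face_four_0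
  · exact he.face_four_1
  · exact he.face_four_2
  · exact he.face_four_3
  · exact he.face_four_4

/-- The polynomial expression `Q_{ℓ,m,n}(x)`. -/
noncomputable def dominoPoly {R : Type*} [CommRing R] (ℓ m n x : R) : R :=
  x ^ 18 - (4 * n + 6) * x ^ 17 + (2 * n - m + 3) * x ^ 16
    - (3 * n - m + ℓ + 5) * x ^ 15 + (5 * n - 3 * m + 5) * x ^ 14
    - (n - 4 * m + 1) * x ^ 13 + (8 * n - 4 * m + ℓ + 9) * x ^ 12
    + (5 * m - ℓ) * x ^ 11 + (10 * n - 5 * m + ℓ + 11) * x ^ 10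
    - (2 * n - 6 * m + 2) * x ^ 9 + (10 * n - 5 * m + ℓ + 11) * x ^ 8
    + (5 * m - ℓ) * x ^ 7 + (8 * n - 4 * m + ℓ + 9) * x ^ 6
    - (n - 4 * m + 1) * x ^ 5 + (5 * n - 3 * m + 5) * x ^ 4
    - (3 * n - m + ℓ + 5) * x ^ 3 + (2 * n - m + 3) * x ^ 2
    - (4 * n + 6) * x + 1

lemma map_dominoPoly {R S : Type*} [CommRing R] [CommRing S] (f : R →+* S) (ℓ m n x : R) :
    f (dominoPoly ℓ m n x) = dominoPoly (f ℓ) (f m) (f n) (f x) := by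
  simp [dominoPoly, map_ofNat f]

theorem IsTile.invGrowth_tile (h : IsTile e v) :
    invGrowth (tileNormals e v) * dominoDen laurentX = dominoPoly 0 0 0 laurentX := by
  have hx : (1 : LaurentSeries ℚ) + laurentX ≠ 0 := by
    simpa using one_add_laurentX_pow_ne_zero one_ne_zero
  rw [tileNormals, h.invGrowth_partial, Fin.sum_univ_five]
  have hE := h.isSimplex.face_univ
  have h0 := h.face_four 0
  have h1 := h.face_four 1
  have h2 := h.face_four 2
  have h3 := h.face_four 3
  have h4 := h.face_four 4
  simp only [orthFacetType] at h0 h1 h2 h3 h4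
  simp only [Matrix.cons_val, facetNum] at h0 h1 h2 h3 h4
  refine mul_left_cancel₀ hx ?_
  rw [sub_mul, mul_sub, div_mul_eq_mul_div, div_mul_eq_mul_div, mul_div_cancel₀ _ hx]
  rw [dominoPoly]
  generalize laurentX = x at *
  linear_combination (1 + x) * hE - x * (h0 + h1 + h2 + h3 + h4)

end Tile

/-! ### Gluing polytopes -/

section Gluing

variable {D D' : MarkedPolytope} {t : FacetType} {u y z p q : LorentzSpace}

/-- The projection of a future vector to `u^⊥` is a future vector. -/
lemma IsFuture.project (hp : IsFuture p) (hu : lorentz u u = 1) :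
    IsFuture (p - lorentz p u • u) := by
  have h1 : lorentz (p - lorentz p u • u) (p - lorentz p u • u) < 0 := by
    simp only [lorentz_sub_left, lorentz_sub_right, lorentz_smul_left, lorentz_smul_right, hu,
      lorentz_comm u p]
    nlinarith [hp.1, sq_nonneg (lorentz p u)]
  refine ⟨h1, hp.time_pos h1.le ?_⟩
  rw [lorentz_sub_right, lorentz_smul_right]
  nlinarith [hp.1, sq_nonneg (lorentz p u)]

/-- A hyperplane disjoint from `u^⊥` projects to a causal future vector in `u^⊥`. -/
lemma project_normal (hp : IsFuture p) (hu : lorentz u u = 1) (hpu : lorentz p u < 0)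
    (hy : lorentz y y = 1) (hpy : lorentz p y < 0) (hyu : lorentz y u ≤ -1) :
    lorentz (y - lorentz y u • u) (y - lorentz y u • u) ≤ 0 ∧ 0 < (y - lorentz y u • u) 4 := by
  have h1 : lorentz (y - lorentz y u • u) (y - lorentz y u • u) ≤ 0 := by
    simp only [lorentz_sub_left, lorentz_sub_right, lorentz_smul_left, lorentz_smul_right, hu,
      lorentz_comm u y, hy]
    nlinarith
  refine ⟨h1, (hp.project hu).time_pos h1 ?_⟩
  simp only [lorentz_sub_left, lorentz_sub_right, lorentz_smul_left, lorentz_smul_right, hu,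
    lorentz_comm u y]
  nlinarith

/-- Hyperplanes that are disjoint from `u^⊥` and lie on different sides of it are disjoint. -/
lemma lorentz_le_of_separated (hu : lorentz u u = 1) (hp : IsFuture p) (hpu : lorentz p u < 0)
    (hy : lorentz y y = 1) (hpy : lorentz p y < 0) (hyu : lorentz y u ≤ -1)
    (hq : IsFuture q) (hqu : lorentz q (-u) < 0)
    (hz : lorentz z z = 1) (hqz : lorentz q z < 0) (hzu : lorentz z (-u) ≤ -1) :
    lorentz y z ≤ -1 := by
  have h1 := project_normal hp hu hpu hy hpy hyu
  have h2 := project_normal hq (by simpa using hu) hqu hz hqz hzu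
  -- The products of y and z and of their projections to u^⊥ differ by ⟨y,u⟩⟨z,u⟩, which is at most
  -- -1 because the two factors lie on opposite sides of [-1, 1].
  have h3 := lorentz_nonpos_of_causal h1.1 h1.2.le h2.1 h2.2.le
  simp only [lorentz_sub_left, lorentz_sub_right, lorentz_smul_left, lorentz_smul_right, hu,
    lorentz_neg_right, lorentz_comm u z] at h3
  rw [lorentz_neg_right] at hzu
  nlinarith

/-- The properties of dominoes that are preserved by gluing. -/
structure IsGlueable (D : MarkedPolytope) : Prop where
  finite : D.normals.Finite
  coxeter : IsCoxeterNormals D.normals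
  orth_subset : ∀ t, D.orth t ⊆ D.normals
  orth_angle : ∀ t, ∀ u ∈ D.orth t, ∀ y ∈ D.normals, y ≠ u → lorentz y u = 0 ∨ lorentz y u ≤ -1
  orth_orth : ∀ t t', ∀ u ∈ D.orth t, ∀ y ∈ D.orth t', y ≠ u → lorentz y u ≤ -1
  orth_disjoint : ∀ t t', t ≠ t' → Disjoint (D.orth t) (D.orth t')
  tile : ∀ t, ∀ u ∈ D.orth t, ∃ e v, IsTile e v ∧ ∃ i, orthFacetType i = t ∧ v i = u ∧
    D.orthogonalTo u = e '' {j | j ≠ i}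

lemma IsTile.orthogonalTo {e v : Fin 5 → LorentzSpace} (h : IsTile e v) (i : Fin 5) :
    (truncatedSimplex e v).orthogonalTo (v i) = e '' {j | j ≠ i} := by
  ext y
  constructor
  · rintro ⟨⟨j, rfl⟩ | ⟨j, rfl⟩, hy⟩
    · refine ⟨j, ?_, rfl⟩
      rintro rfl
      rw [lorentz_comm] at hy
      linarith [h.vertex_facet j]
    · by_cases hij : j = i
      · subst hij; rw [h.unit] at hy; norm_num at hy
      · linarith [h.vertex_vertex hij]
  · rintro ⟨j, hj, rfl⟩
    exact ⟨Or.inl ⟨j, rfl⟩, by rw [lorentz_comm]; exact h.ortho i j (Ne.symm hj)⟩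

lemma IsTile.isGlueable {e v : Fin 5 → LorentzSpace} (h : IsTile e v) :
    IsGlueable (truncatedSimplex e v) where
  finite := by rw [← coe_tileNormals]; exact Finset.finite_toSet _
  coxeter := h.coxeter
  orth_subset := by rintro t _ ⟨i, -, rfl⟩; exact Or.inr ⟨i, rfl⟩
  orth_angle := by
    rintro t _ ⟨i, -, rfl⟩ _ (⟨j, rfl⟩ | ⟨j, rfl⟩) hne
    · rw [lorentz_comm]
      have := h.vertex_facet_cases i j
      tauto
    · exact Or.inr (h.vertex_vertex (by rintro rfl; exact hne rfl))
  orth_orth := by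
    rintro t t' _ ⟨i, -, rfl⟩ _ ⟨j, -, rfl⟩ hne
    exact h.vertex_vertex (by rintro rfl; exact hne rfl)
  orth_disjoint := by
    intro t t' htt
    rw [Set.disjoint_left]
    rintro _ ⟨i, hi, rfl⟩ ⟨j, hj, hij⟩
    obtain rfl := h.vertex_injective hij
    exact htt (hi.symm.trans hj)
  tile := by
    rintro t _ ⟨i, hi, rfl⟩
    exact ⟨e, v, h, i, hi, rfl, h.orthogonalTo i⟩

lemma MarkedPolytope.glue_comm (D D' : MarkedPolytope) (u : LorentzSpace) :
    D.glue D' u = D'.glue D (-u) := by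
  simp only [MarkedPolytope.glue, neg_neg, Set.union_comm]

/-- `D` and `D'` lie on different sides of a common orthogonal facet. -/
structure IsGluing (D D' : MarkedPolytope) (t : FacetType) (u : LorentzSpace) : Prop where
  left : IsGlueable D
  right : IsGlueable D'
  mem_left : u ∈ D.orth t
  mem_right : -u ∈ D'.orth t
  facet : D.orthogonalTo u = D'.orthogonalTo (-u)

namespace IsGluing

lemma symm (h : IsGluing D D' t u) : IsGluing D' D t (-u) where
  left := h.right
  right := h.left
  mem_left := h.mem_right
  mem_right := by rw [neg_neg]; exact h.mem_left
  facet := by rw [neg_neg]; exact h.facet.symm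

lemma unit (h : IsGluing D D' t u) : lorentz u u = 1 :=
  h.left.coxeter.unit u (h.left.orth_subset t h.mem_left)

lemma mem_of_orthogonal (h : IsGluing D D' t u) (hy : y ∈ D.normals) (hyu : lorentz y u = 0) :
    y ∈ D'.normals ∧ y ≠ -u := by
  have h1 : y ∈ D.orthogonalTo u := ⟨hy, hyu⟩
  rw [h.facet] at h1
  refine ⟨h1.1, ?_⟩
  rintro rfl
  rw [lorentz_neg_left, h.unit] at hyu
  norm_num at hyu

lemma cross (h : IsGluing D D' t u) (hy : y ∈ D.normals) (hyu : lorentz y u ≤ -1)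
    (hz : z ∈ D'.normals) (hzu : lorentz z (-u) ≤ -1) : lorentz y z ≤ -1 := by
  obtain ⟨p, hp, hpD⟩ := h.left.coxeter.interior
  obtain ⟨q, hq, hqD⟩ := h.right.coxeter.interior
  exact lorentz_le_of_separated h.unit hp (hpD u (h.left.orth_subset t h.mem_left))
    (h.left.coxeter.unit y hy) (hpD y hy) hyu hq (hqD _ (h.right.orth_subset t h.mem_right))
    (h.right.coxeter.unit z hz) (hqD z hz) hzu

/-- Every other facet of D is either shared with D' and perpendicular to the common facet, or has a
hyperplane disjoint from it. -/
lemma cases_left (h : IsGluing D D' t u) (hy : y ∈ D.normals) (hyu : y ≠ u) :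
    (y ∈ D'.normals ∧ y ≠ -u ∧ lorentz y u = 0) ∨ lorentz y u ≤ -1 := by
  rcases h.left.orth_angle t u h.mem_left y hy hyu with h1 | h1
  · exact Or.inl ⟨(h.mem_of_orthogonal hy h1).1, (h.mem_of_orthogonal hy h1).2, h1⟩
  · exact Or.inr h1

lemma coxeter (h : IsGluing D D' t u) : IsCoxeterNormals (D.glue D' u).normals where
  unit := by
    rintro y (⟨hy, -⟩ | ⟨hy, -⟩)
    exacts [h.left.coxeter.unit y hy, h.right.coxeter.unit y hy]
  angle := by
    have key : ∀ {D D' : MarkedPolytope} {u : LorentzSpace}, IsGluing D D' t u →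
        ∀ y ∈ D.normals, y ≠ u → ∀ z ∈ D'.normals, z ≠ -u → y ≠ z →
        lorentz y z = 0 ∨ lorentz y z = -1 / 2 ∨
          lorentz y z = -Real.goldenRatio / 2 ∨ lorentz y z ≤ -1 := by
      intro D D' u h y hy hyu z hz hzu hyz
      rcases h.cases_left hy hyu with h1 | h1
      · exact h.right.coxeter.angle y h1.1 z hz hyz
      rcases h.symm.cases_left hz hzu with h2 | h2
      · exact h.left.coxeter.angle y hy z h2.1 hyz
      · exact Or.inr (Or.inr (Or.inr (h.cross hy h1 hz h2)))
    rintro y (⟨hy, hyu⟩ | ⟨hy, hyu⟩) z (⟨hz, hzu⟩ | ⟨hz, hzu⟩) hne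
    · exact h.left.coxeter.angle y hy z hz hne
    · exact key h y hy hyu z hz hzu hne
    · refine key h.symm y hy hyu z hz ?_ hne
      rw [neg_neg]; exact hzu
    · exact h.right.coxeter.angle y hy z hz hne
  interior := by
    obtain ⟨p, hp, hpD⟩ := h.left.coxeter.interior
    obtain ⟨q, hq, hqD⟩ := h.right.coxeter.interior
    have hpu := hpD u (h.left.orth_subset t h.mem_left)
    have hleft : ∀ y ∈ D.normals, y ≠ u → lorentz (p - lorentz p u • u) y < 0 := by
      intro y hy hyu
      rw [lorentz_sub_left, lorentz_smul_left, lorentz_comm u y]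
      rcases h.left.orth_angle t u h.mem_left y hy hyu with h1 | h1
      · rw [h1]; linarith [hpD y hy]
      · nlinarith [hpD y hy]
    -- An interior point of D, projected to u^⊥, lies in the relative interior of the common facet
    -- and so becomes interior once that facet has disappeared. Unshared normals of D' are
    -- controlled through their causal projections.
    refine ⟨p - lorentz p u • u, hp.project h.unit, ?_⟩
    rintro z (⟨hz, hzu⟩ | ⟨hz, hzu⟩)
    · exact hleft z hz hzu
    · rcases h.symm.cases_left hz hzu with h2 | h2
      · exact hleft z h2.1 (by simpa using h2.2.1)
      · have h3 := project_normal hq (by simpa using h.unit)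
          (hqD _ (h.right.orth_subset t h.mem_right)) (h.right.coxeter.unit z hz) (hqD z hz) h2
        have h4 := (hp.project h.unit).lorentz_neg h3.1 h3.2
        simp only [lorentz_sub_left, lorentz_sub_right, lorentz_smul_left, lorentz_smul_right,
          h.unit, lorentz_neg_right] at h4 ⊢
        linarith

/-- Unshared facets of D' are separated from every remaining orthogonal facet of D, so the latter
keep their shape and remain congruent to facets of a tile. This permits further gluings. -/
lemma orthogonalTo_left (h : IsGluing D D' t u) {t' : FacetType} (hy : y ∈ D.orth t')
    (hyu : y ≠ u) : (D.glue D' u).orthogonalTo y = D.orthogonalTo y := by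
  have hyu' := h.left.orth_orth t t' u h.mem_left y hy hyu
  ext z
  constructor
  · rintro ⟨⟨hz, -⟩ | ⟨hz, hzu⟩, hzy⟩
    · exact ⟨hz, hzy⟩
    · rcases h.symm.cases_left hz hzu with h1 | h1
      · exact ⟨h1.1, hzy⟩
      · have h2 := h.cross (h.left.orth_subset _ hy) hyu' hz h1
        rw [lorentz_comm, hzy] at h2
        norm_num at h2
  · rintro ⟨hz, hzy⟩
    refine ⟨Or.inl ⟨hz, ?_⟩, hzy⟩
    rintro rfl
    rw [lorentz_comm] at hzy
    linarith

theorem isGlueable (h : IsGluing D D' t u) : IsGlueable (D.glue D' u) where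
  finite := (h.left.finite.subset Set.sdiff_subset).union (h.right.finite.subset Set.sdiff_subset)
  coxeter := h.coxeter
  orth_subset := by
    rintro t' y (⟨hy, hyu⟩ | ⟨hy, hyu⟩)
    exacts [Or.inl ⟨h.left.orth_subset t' hy, hyu⟩, Or.inr ⟨h.right.orth_subset t' hy, hyu⟩]
  orth_angle := by
    have key : ∀ {D D' : MarkedPolytope} {u : LorentzSpace}, IsGluing D D' t u →
        ∀ t', ∀ w ∈ D.orth t', w ≠ u → ∀ y ∈ (D.glue D' u).normals, y ≠ w →
          lorentz y w = 0 ∨ lorentz y w ≤ -1 := by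
      rintro D D' u h t' w hw hwu y (⟨hy, -⟩ | ⟨hy, hyu⟩) hyw
      · exact h.left.orth_angle t' w hw y hy hyw
      · rcases h.symm.cases_left hy hyu with h1 | h1
        · exact h.left.orth_angle t' w hw y h1.1 hyw
        · rw [lorentz_comm]
          exact Or.inr (h.cross (h.left.orth_subset t' hw)
            (h.left.orth_orth t t' u h.mem_left w hw hwu) hy h1)
    rintro t' w (⟨hw, hwu⟩ | ⟨hw, hwu⟩) y hy hyw
    · exact key h t' w hw hwu y hy hyw
    · rw [MarkedPolytope.glue_comm] at hy
      exact key h.symm t' w hw hwu y hy hyw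
  orth_orth := by
    have key : ∀ {D D' : MarkedPolytope} {u : LorentzSpace}, IsGluing D D' t u →
        ∀ t₁ t₂, ∀ w ∈ D.orth t₁, w ≠ u → ∀ y ∈ D'.orth t₂, y ≠ -u → lorentz w y ≤ -1 :=
      fun h t₁ t₂ w hw hwu y hy hyu => h.cross (h.left.orth_subset t₁ hw)
        (h.left.orth_orth t t₁ _ h.mem_left w hw hwu) (h.right.orth_subset t₂ hy)
        (h.right.orth_orth t t₂ _ h.mem_right y hy hyu)
    rintro t₁ t₂ w (⟨hw, hwu⟩ | ⟨hw, hwu⟩) y (⟨hy, hyu⟩ | ⟨hy, hyu⟩) hyw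
    · exact h.left.orth_orth t₁ t₂ w hw y hy hyw
    · rw [lorentz_comm]; exact key h t₁ t₂ w hw hwu y hy hyu
    · exact key h t₂ t₁ y hy hyu w hw hwu
    · exact h.right.orth_orth t₁ t₂ w hw y hy hyw
  orth_disjoint := by
    intro t₁ t₂ hne
    have key : ∀ t₁ t₂, ∀ w ∈ D.orth t₁, w ≠ u → w ∈ D'.orth t₂ → w ≠ -u → False := by
      intro t₁ t₂ w hw hwu hw' hwu'
      have h1 := h.cross (h.left.orth_subset t₁ hw)
        (h.left.orth_orth t t₁ _ h.mem_left w hw hwu) (h.right.orth_subset t₂ hw')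
        (h.right.orth_orth t t₂ _ h.mem_right w hw' hwu')
      rw [h.left.coxeter.unit w (h.left.orth_subset t₁ hw)] at h1
      norm_num at h1
    rw [Set.disjoint_left]
    rintro w (⟨hw, hwu⟩ | ⟨hw, hwu⟩) (⟨hy, hyu⟩ | ⟨hy, hyu⟩)
    · exact Set.disjoint_left.1 (h.left.orth_disjoint t₁ t₂ hne) hw hy
    · exact key t₁ t₂ w hw hwu hy hyu
    · exact key t₂ t₁ w hy hyu hw hwu
    · exact Set.disjoint_left.1 (h.right.orth_disjoint t₁ t₂ hne) hw hy
  tile := by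
    rintro t' w (⟨hw, hwu⟩ | ⟨hw, hwu⟩)
    · rw [h.orthogonalTo_left hw hwu]
      exact h.left.tile t' w hw
    · rw [MarkedPolytope.glue_comm, h.symm.orthogonalTo_left hw hwu]
      exact h.right.tile t' w hw

/-- The normals without the one of the common facet, together with those of the common facet. -/
lemma invGrowth_left (h : IsGluing D D' t u) {N P M : Finset LorentzSpace}
    (hN : (N : Set LorentzSpace) = D.normals) (hP : (P : Set LorentzSpace) = D.normals \ {u})
    (hM : (M : Set LorentzSpace) = D.orthogonalTo u) :
    invGrowth N = invGrowth P + invGrowth M / (1 + laurentX) - invGrowth M := by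
  have huN : u ∈ D.normals := h.left.orth_subset t h.mem_left
  have hmemP : ∀ y, y ∈ P ↔ y ∈ D.normals ∧ y ≠ u := fun y => by
    rw [← Finset.mem_coe, hP]; rfl
  have hmemM : ∀ y, y ∈ M ↔ y ∈ D.normals ∧ lorentz y u = 0 := fun y => by
    rw [← Finset.mem_coe, hM]; rfl
  have hmemN : ∀ y, y ∈ N ↔ y ∈ D.normals := fun y => by rw [← Finset.mem_coe, hN]
  have hMu : u ∉ M := by
    rw [hmemM, h.unit]; norm_num
  have hMP : M ⊆ P := fun y hy => (hmemP y).2 ⟨((hmemM y).1 hy).1, by rintro rfl; exact hMu hy⟩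
  have hunion : N = P ∪ insert u M := by
    ext y
    simp only [Finset.mem_union, Finset.mem_insert, hmemN, hmemP, hmemM]
    by_cases hy : y = u
    · simp [hy, huN]
    · simp only [hy, ne_eq, not_false_eq_true, and_true, false_or]; tauto
  have hinter : P ∩ insert u M = M := by
    rw [Finset.inter_insert_of_notMem (by simp [hmemP]), Finset.inter_eq_right.2 hMP]
  have hcox : IsCoxeterNormals ((P ∪ insert u M : Finset LorentzSpace) : Set LorentzSpace) := by
    rw [← hunion, hN]; exact h.left.coxeter
  rw [hunion, invGrowth_union hcox, hinter, invGrowth_insert (hcox.mono (by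
    exact_mod_cast Finset.subset_union_right)) fun m hm => ((hmemM m).1 hm).2]
  intro s hs hsQ w hw hwP
  obtain rfl : w = u := by
    rcases Finset.mem_insert.1 hw with h1 | h1
    · exact h1
    · exact absurd (hMP h1) hwP
  have hs' := (hmemP s).1 hs
  refine (h.left.orth_angle t w h.mem_left s hs'.1 hs'.2).resolve_left fun h1 => hsQ ?_
  exact Finset.mem_insert_of_mem ((hmemM s).2 ⟨hs'.1, h1⟩)

/-- Let P and Q be the two sets of normals without u and -u, and let f denote inverse series. The
glued group is the amalgam of P and Q over M, so f_K = f_P + f_Q - f_M. Restoring the removed normal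
on either side costs f_M/(1 + x) - f_M, hence f_M occurs in total with coefficient 1 - 2/(1 + x). -/
theorem invGrowth_glue (h : IsGluing D D' t u) {N N' K M : Finset LorentzSpace}
    (hN : (N : Set LorentzSpace) = D.normals) (hN' : (N' : Set LorentzSpace) = D'.normals)
    (hK : (K : Set LorentzSpace) = (D.glue D' u).normals)
    (hM : (M : Set LorentzSpace) = D.orthogonalTo u) :
    invGrowth K = invGrowth N + invGrowth N' +
      (laurentX - 1) / (1 + laurentX) * invGrowth M := by
  have hx : (1 : LaurentSeries ℚ) + laurentX ≠ 0 := by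
    simpa using one_add_laurentX_pow_ne_zero one_ne_zero
  set P := N.erase u with hPdef
  set Q := N'.erase (-u) with hQdef
  have hP : (P : Set LorentzSpace) = D.normals \ {u} := by rw [hPdef, Finset.coe_erase, hN]
  have hQ : (Q : Set LorentzSpace) = D'.normals \ {-u} := by rw [hQdef, Finset.coe_erase, hN']
  have hmemP : ∀ y, y ∈ P ↔ y ∈ D.normals ∧ y ≠ u := fun y => by
    rw [← Finset.mem_coe, hP]; rfl
  have hmemQ : ∀ y, y ∈ Q ↔ y ∈ D'.normals ∧ y ≠ -u := fun y => by
    rw [← Finset.mem_coe, hQ]; rfl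
  have hKPQ : K = P ∪ Q := by
    apply Finset.coe_injective
    rw [hK, Finset.coe_union, hP, hQ]; rfl
  have hinter : P ∩ Q = M := by
    ext y
    rw [Finset.mem_inter, hmemP, hmemQ, ← Finset.mem_coe, hM]
    constructor
    · rintro ⟨⟨h1, h2⟩, h3, h4⟩
      rcases h.cases_left h1 h2 with h5 | h5
      · exact ⟨h1, h5.2.2⟩
      rcases h.symm.cases_left h3 h4 with h6 | h6
      · exact ⟨h1, by simpa using h6.2.2⟩
      · have h7 := h.cross h1 h5 h3 h6
        rw [h.left.coxeter.unit y h1] at h7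
        norm_num at h7
    · rintro ⟨h1, h2⟩
      refine ⟨⟨h1, ?_⟩, h.mem_of_orthogonal h1 h2⟩
      rintro rfl
      rw [h.unit] at h2
      norm_num at h2
  have hcox : IsCoxeterNormals ((P ∪ Q : Finset LorentzSpace) : Set LorentzSpace) := by
    rw [← hKPQ, hK]; exact h.coxeter
  rw [hKPQ, invGrowth_union hcox, hinter, h.invGrowth_left hN hP hM,
    h.symm.invGrowth_left hN' hQ (hM.trans h.facet)]
  · field_simp
    ring
  · intro s hs hsQ w hw hwP
    rw [hmemP] at hs hwP
    rw [hmemQ] at hsQ hw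
    have h1 := (h.cases_left hs.1 hs.2).resolve_left fun h1 => hsQ ⟨h1.1, h1.2.1⟩
    have h2 := (h.symm.cases_left hw.1 hw.2).resolve_left fun h1 => hwP ⟨h1.1, by simpa using h1.2.1⟩
    exact h.cross hs.1 h1 hw.1 h2

end IsGluing

theorem IsDomino.isGlueable {ℓ m n : ℕ} (h : IsDomino ℓ m n D) : IsGlueable D := by
  induction h with
  | tile e v h => exact h.isGlueable
  | glue ℓ m n D e v t u hD h hu hu' hfacet ih =>
    exact (IsGluing.mk ih h.isGlueable hu hu' hfacet).isGlueable

/-- The growth series of a domino. -/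
theorem IsDomino.invGrowth {ℓ m n : ℕ} (h : IsDomino ℓ m n D) {N : Finset LorentzSpace}
    (hN : (N : Set LorentzSpace) = D.normals) :
    _root_.invGrowth N * dominoDen laurentX =
      dominoPoly (ℓ : LaurentSeries ℚ) m n laurentX := by
  induction h generalizing N with
  | tile e v h =>
    obtain rfl : N = tileNormals e v := Finset.coe_injective (by rw [hN, coe_tileNormals])
    rw [h.invGrowth_tile]; simp
  | glue ℓ m n D e v t u hD h hu hu' hfacet ih =>
    have hx : (1 : LaurentSeries ℚ) + laurentX ≠ 0 := by
      simpa using one_add_laurentX_pow_ne_zero one_ne_zero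
    have hg := IsGluing.mk hD.isGlueable h.isGlueable hu hu' hfacet
    obtain ⟨i, hi, hiu⟩ := hu'
    have hM : (((Finset.univ.erase i).image e : Finset LorentzSpace) : Set LorentzSpace) =
        D.orthogonalTo u := by
      rw [hfacet, ← hiu, h.orthogonalTo i, Finset.coe_image]
      congr 1
      ext j; simp
    have h1 := hg.invGrowth_glue (N := hD.isGlueable.finite.toFinset) (by simp)
      coe_tileNormals hN hM
    have h2 := ih (N := hD.isGlueable.finite.toFinset) (by simp)
    have h3 := h.invGrowth_tile
    have h4 := h.face_four i
    rw [hi] at h4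
    change _ = _ + _ + _ * invGrowthFace e (Finset.univ.erase i) at h1
    rw [h1]
    refine mul_left_cancel₀ hx ?_
    have h5 : (1 + laurentX) * ((laurentX - 1) / (1 + laurentX) *
        invGrowthFace e (Finset.univ.erase i)) =
        (laurentX - 1) * invGrowthFace e (Finset.univ.erase i) := by
      field_simp
    push_cast
    generalize (laurentX - 1) / (1 + laurentX) = c at *
    simp only [dominoPoly] at h2 h3 ⊢
    generalize laurentX = x at *
    -- `dominoPoly` is affine in ℓ, m, n. For each type its increment is its value for the tile plus
    -- (x - 1)/(1 + x) times the numerator of the facet group.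
    cases t
    all_goals
      simp only [facetNum, FacetType.count, Nat.cast_zero, Nat.cast_one] at h4 ⊢
      linear_combination (1 + x) * (h2 + h3) + (x - 1) * h4 + dominoDen x * h5

end Gluing

/-! ### Growth of the coefficients of a rational power series -/

section CoefficientGrowth

/-- The coefficients of `A` grow at most exponentially, at every rate greater than `s`. -/
def HasCoeffGrowth (s : ℝ) (A : PowerSeries ℂ) : Prop :=
  ∀ ρ, s < ρ → ∃ C : ℝ, 0 < C ∧ ∀ k, ‖PowerSeries.coeff k A‖ ≤ C * ρ ^ k

variable {s : ℝ} {A B : PowerSeries ℂ}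

/-- Convolution of two bounds σ^k costs a factor k + 1, which is absorbed by passing from σ to a
larger ρ. For this reason the growth condition concerns all rates above s only. -/
lemma HasCoeffGrowth.mul (hs : 0 < s) (hA : HasCoeffGrowth s A) (hB : HasCoeffGrowth s B) :
    HasCoeffGrowth s (A * B) := by
  intro ρ hρ
  obtain ⟨σ, h1, h2⟩ := exists_between hρ
  have hσ : 0 < σ := hs.trans h1
  have hρ' : 0 < ρ := hs.trans hρ
  obtain ⟨C, hC, hCA⟩ := hA σ h1
  obtain ⟨C', hC', hCB⟩ := hB σ h1
  have hlim : Tendsto (fun k : ℕ => (k : ℝ) * (σ / ρ) ^ k) atTop (nhds 0) :=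
    tendsto_self_mul_const_pow_of_lt_one (by positivity) ((div_lt_one (hσ.trans h2)).2 h2)
  obtain ⟨K, hK⟩ := hlim.bddAbove_range
  have hK0 : 0 ≤ K := by simpa using hK ⟨0, rfl⟩
  refine ⟨C * C' * (K + 1), by positivity, fun k => ?_⟩
  rw [PowerSeries.coeff_mul]
  have hterm : ∀ p ∈ Finset.HasAntidiagonal.antidiagonal k,
      ‖PowerSeries.coeff p.1 A * PowerSeries.coeff p.2 B‖ ≤ C * C' * σ ^ k := by
    intro p hp
    rw [norm_mul, ← Finset.HasAntidiagonal.mem_antidiagonal.1 hp, pow_add]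
    calc _ ≤ (C * σ ^ p.1) * (C' * σ ^ p.2) := by
          gcongr
          exacts [hCA _, hCB _]
      _ = _ := by ring
  refine (norm_sum_le_of_le _ hterm).trans ?_
  rw [Finset.sum_const, Finset.Nat.card_antidiagonal, nsmul_eq_mul]
  have h3 : (k : ℝ) * (σ / ρ) ^ k ≤ K := hK ⟨k, rfl⟩
  have h4 : (σ / ρ) ^ k ≤ 1 := pow_le_one₀ (by positivity) ((div_le_one (hσ.trans h2)).2 h2.le)
  have h5 : σ ^ k = (σ / ρ) ^ k * ρ ^ k := by
    rw [div_pow, div_mul_cancel₀ _ (pow_ne_zero _ (hσ.trans h2).ne')]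
  have hρ0 : 0 < ρ ^ k := pow_pos (hσ.trans h2) k
  rw [h5]
  push_cast
  calc ((k : ℝ) + 1) * (C * C' * ((σ / ρ) ^ k * ρ ^ k)) =
      C * C' * (k * (σ / ρ) ^ k + (σ / ρ) ^ k) * ρ ^ k := by ring
    _ ≤ C * C' * (K + 1) * ρ ^ k := by gcongr

lemma hasCoeffGrowth_polynomial (hs : 0 < s) (p : ℂ[X]) : HasCoeffGrowth s (p : PowerSeries ℂ) := by
  intro ρ hρ
  have hρ0 := hs.trans hρ
  refine ⟨1 + ∑ i ∈ p.support, ‖p.coeff i‖ / ρ ^ i, by positivity, fun k => ?_⟩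
  rw [Polynomial.coeff_coe]
  by_cases hk : k ∈ p.support
  · have h1 : ‖p.coeff k‖ / ρ ^ k ≤ ∑ i ∈ p.support, ‖p.coeff i‖ / ρ ^ i :=
      Finset.single_le_sum (f := fun i => ‖p.coeff i‖ / ρ ^ i) (fun i _ => by positivity) hk
    rw [div_le_iff₀ (by positivity)] at h1
    nlinarith [pow_pos hρ0 k]
  · rw [Polynomial.notMem_support_iff.1 hk, norm_zero]; positivity

/-- The inverse of X - z is a geometric series in 1/z, whose coefficients grow at rate 1/‖z‖ ≤ s. -/
lemma HasCoeffGrowth.of_mul_X_sub_C (hs : 0 < s) {z : ℂ} (hz : 1 / s ≤ ‖z‖)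
    (h : HasCoeffGrowth s (A * ((X - C z : ℂ[X]) : PowerSeries ℂ))) : HasCoeffGrowth s A := by
  have hz0 : z ≠ 0 := norm_pos_iff.1 (lt_of_lt_of_le (by positivity) hz)
  let G : PowerSeries ℂ := PowerSeries.mk fun k => -(z⁻¹) ^ (k + 1)
  have hG : ((X - C z : ℂ[X]) : PowerSeries ℂ) * G = 1 := by
    ext k
    simp only [Polynomial.coe_sub, Polynomial.coe_X, Polynomial.coe_C, sub_mul, map_sub,
      PowerSeries.coeff_C_mul, G, PowerSeries.coeff_mk, PowerSeries.coeff_one]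
    cases k with
    | zero => simp [hz0]
    | succ k =>
      rw [PowerSeries.coeff_succ_X_mul, PowerSeries.coeff_mk, pow_succ _ (k + 1)]
      field_simp
      simp
  have hGg : HasCoeffGrowth s G := by
    intro ρ hρ
    have hzi : ‖z‖⁻¹ ≤ s := by
      rw [one_div] at hz
      exact inv_le_of_inv_le₀ hs hz
    refine ⟨s, hs, fun k => ?_⟩
    rw [PowerSeries.coeff_mk, norm_neg, norm_pow, norm_inv, pow_succ']
    gcongr
    exact hzi.trans hρ.le
  have h2 := h.mul hs hGg
  rwa [mul_assoc, hG, mul_one] at h2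

lemma HasCoeffGrowth.of_mul_prod (hs : 0 < s) (R : Multiset ℂ) (hR : ∀ z ∈ R, 1 / s ≤ ‖z‖)
    (h : HasCoeffGrowth s (A * (((R.map fun z => X - C z).prod : ℂ[X]) : PowerSeries ℂ))) :
    HasCoeffGrowth s A := by
  induction R using Multiset.induction_on generalizing A with
  | empty => simpa using h
  | cons z R ih =>
    rw [Multiset.map_cons, Multiset.prod_cons, mul_comm (X - C z), Polynomial.coe_mul,
      ← mul_assoc] at h
    exact ih (fun w hw => hR w (Multiset.mem_cons_of_mem hw))
      (HasCoeffGrowth.of_mul_X_sub_C hs (hR z (Multiset.mem_cons_self z R)) h)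

/-- A power series which is summable at `x` can be evaluated there. -/
lemma tsum_coeff_mul_polynomial {x : ℂ} (hA : Summable fun k => ‖PowerSeries.coeff k A * x ^ k‖)
    {p q : ℂ[X]} (h : A * (q : PowerSeries ℂ) = p) :
    (∑' k, PowerSeries.coeff k A * x ^ k) * q.eval x = p.eval x := by
  have heval : ∀ r : ℂ[X], HasSum (fun k => r.coeff k * x ^ k) (r.eval x) := by
    intro r
    rw [Polynomial.eval_eq_sum, Polynomial.sum]
    exact hasSum_sum_of_ne_finset_zero fun k hk => by
      rw [Polynomial.notMem_support_iff.1 hk, zero_mul]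
  have hq : Summable fun k => ‖q.coeff k * x ^ k‖ :=
    summable_of_ne_finset_zero (s := q.support) fun k hk => by
      rw [Polynomial.notMem_support_iff.1 hk, zero_mul, norm_zero]
  rw [← (heval q).tsum_eq, ← (heval p).tsum_eq,
    tsum_mul_tsum_eq_tsum_sum_antidiagonal_of_summable_norm hA hq]
  refine tsum_congr fun k => ?_
  have h1 : p.coeff k = PowerSeries.coeff k (A * (q : PowerSeries ℂ)) := by
    rw [h, Polynomial.coeff_coe]
  rw [h1, PowerSeries.coeff_mul, Finset.sum_mul]
  refine Finset.sum_congr rfl fun ij hij => ?_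
  rw [Polynomial.coeff_coe, ← Finset.HasAntidiagonal.mem_antidiagonal.1 hij, pow_add]
  ring

/-- The exponential growth rate of the coefficients of a rational function is given by its
smallest pole, if the latter is positive. -/
theorem limsup_root_coeff_eq {a : ℕ → ℝ} (ha : ∀ k, 0 ≤ a k) {p q : ℂ[X]} (hq : q.Monic)
    (h : PowerSeries.mk (fun k => (a k : ℂ)) * (q : PowerSeries ℂ) = p) {α : ℝ} (hα : 0 < α)
    (hroots : ∀ z ∈ q.roots, 1 / α ≤ ‖z‖) (hq0 : q.eval ((α : ℂ)⁻¹) = 0)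
    (hp : p.eval ((α : ℂ)⁻¹) ≠ 0) :
    limsup (fun k : ℕ => a k ^ (1 / (k : ℝ))) atTop = α := by
  have hA : HasCoeffGrowth α (PowerSeries.mk fun k => (a k : ℂ)) := by
    refine HasCoeffGrowth.of_mul_prod hα q.roots hroots ?_
    rw [← (IsAlgClosed.splits q).eq_prod_roots_of_monic hq, h]
    exact hasCoeffGrowth_polynomial hα p
  -- The constant in C ρ^k disappears in the limit of k-th roots.
  have hbound : ∀ ρ, α < ρ → ∃ b : ℕ → ℝ, Tendsto b atTop (nhds ρ) ∧
      ∀ᶠ k : ℕ in atTop, a k ^ (1 / (k : ℝ)) ≤ b k := by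
    intro ρ hρ
    have hρ0 := hα.trans hρ
    obtain ⟨C, hC, hCa⟩ := hA ρ hρ
    refine ⟨fun k => C ^ (1 / (k : ℝ)) * ρ, ?_, ?_⟩
    · have h1 : Tendsto (fun k : ℕ => C ^ (1 / (k : ℝ))) atTop (nhds (C ^ (0 : ℝ))) :=
        (Real.continuousAt_const_rpow hC.ne').tendsto.comp tendsto_one_div_atTop_nhds_zero_nat
      rw [Real.rpow_zero] at h1
      simpa using h1.mul_const ρ
    · filter_upwards [eventually_gt_atTop 0] with k hk
      have h1 := hCa k
      rw [PowerSeries.coeff_mk, Complex.norm_real, Real.norm_of_nonneg (ha k)] at h1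
      calc a k ^ (1 / (k : ℝ)) ≤ (C * ρ ^ k) ^ (1 / (k : ℝ)) :=
            Real.rpow_le_rpow (ha k) h1 (by positivity)
        _ = C ^ (1 / (k : ℝ)) * ρ := by
            rw [Real.mul_rpow hC.le (by positivity), one_div,
              Real.pow_rpow_inv_natCast hρ0.le hk.ne']
  have hnonneg : ∀ k : ℕ, 0 ≤ a k ^ (1 / (k : ℝ)) := fun k => Real.rpow_nonneg (ha k) _
  have hcobdd : IsCoboundedUnder (· ≤ ·) atTop fun k : ℕ => a k ^ (1 / (k : ℝ)) :=
    isCoboundedUnder_le_of_le atTop (x := 0) hnonneg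
  have hbdd : IsBoundedUnder (· ≤ ·) atTop fun k : ℕ => a k ^ (1 / (k : ℝ)) := by
    obtain ⟨b, hb, hab⟩ := hbound (α + 1) (by linarith)
    exact hb.isBoundedUnder_le.mono_le hab
  apply le_antisymm
  · refine le_of_forall_gt_imp_ge_of_dense fun ρ hρ => ?_
    obtain ⟨b, hb, hab⟩ := hbound ρ hρ
    rw [← hb.limsup_eq]
    exact limsup_le_limsup hab hcobdd hb.isBoundedUnder_le
  -- If the limsup were smaller than α, the series would converge absolutely at 1/α, and evaluating
  -- there would force p(1/α) = 0.
  · by_contra! hlt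
    obtain ⟨σ, h1, h2⟩ := exists_between hlt
    have h3 := eventually_lt_of_limsup_lt h1 hbdd
    have hσ : 0 < σ := by
      obtain ⟨k, hk⟩ := h3.exists
      exact (hnonneg k).trans_lt hk
    have hsum : Summable fun k => ‖PowerSeries.coeff k (PowerSeries.mk fun k => (a k : ℂ)) *
        ((α : ℂ)⁻¹) ^ k‖ := by
      refine summable_of_isBigO_nat
        (summable_geometric_of_lt_one (r := σ / α) (by positivity) ((div_lt_one hα).2 h2)) ?_
      refine Asymptotics.IsBigO.of_bound 1 ?_
      filter_upwards [h3, eventually_gt_atTop 0] with k hk hk0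
      have h4 : a k ≤ σ ^ k := by
        have h5 := pow_le_pow_left₀ (hnonneg k) hk.le k
        rwa [one_div, Real.rpow_inv_natCast_pow (ha k) hk0.ne'] at h5
      rw [norm_norm, PowerSeries.coeff_mk, norm_mul, Complex.norm_real,
        Real.norm_of_nonneg (ha k), norm_pow, norm_inv, Complex.norm_real,
        Real.norm_of_nonneg hα.le, one_mul, Real.norm_of_nonneg (by positivity), div_pow, inv_pow,
        div_eq_mul_inv]
      gcongr
    have h6 := tsum_coeff_mul_polynomial hsum h
    rw [hq0, mul_zero] at h6
    exact hp h6.symm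

end CoefficientGrowth

/-! ### The roots of the polynomials `Q_{ℓ,m,n}` -/

section TracePolynomial

/-- The trace polynomial of `Q_{ℓ,m,n}`, see `dominoPoly_eq_pow_mul_dominoTrace`. -/
def dominoTrace {R : Type*} [CommRing R] (ℓ m n x : R) : R :=
  x ^ 9 + (-6 - 4 * n) * x ^ 8 + (-6 - m + 2 * n) * x ^ 7 + (43 - ℓ + m + 29 * n) * x ^ 6
    + (11 + 4 * m - 9 * n) * x ^ 5 + (-91 + 6 * ℓ - 2 * m - 63 * n) * x ^ 4
    + (-4 + ℓ - 3 * m + 11 * n) * x ^ 3 + (55 - 10 * ℓ - 2 * m + 41 * n) * x ^ 2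
    + (-3 - 2 * ℓ - m - 3 * n) * x + (-6 + 4 * ℓ + 2 * m - 6 * n)

/-- The coefficients of Q are palindromic, so Q(t)/t⁹ is a polynomial in t + 1/t. -/
lemma dominoPoly_eq_pow_mul_dominoTrace {K : Type*} [Field K] (ℓ m n : K) {t : K} (ht : t ≠ 0) :
    dominoPoly ℓ m n t = t ^ 9 * dominoTrace ℓ m n (t + t⁻¹) := by
  unfold dominoPoly dominoTrace
  field_simp
  ring

lemma map_dominoTrace {R S : Type*} [CommRing R] [CommRing S] (f : R →+* S) (ℓ m n x : R) :
    f (dominoTrace ℓ m n x) = dominoTrace (f ℓ) (f m) (f n) (f x) := by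
  simp [dominoTrace, map_ofNat f]

lemma continuous_dominoTrace (ℓ m n : ℝ) : Continuous (dominoTrace ℓ m n) := by
  unfold dominoTrace
  fun_prop

variable {ℓ m n : ℝ}

lemma exists_dominoTrace_eq_zero {a b : ℝ} (hab : a < b)
    (h : dominoTrace ℓ m n a < 0 ∧ 0 < dominoTrace ℓ m n b ∨
      0 < dominoTrace ℓ m n a ∧ dominoTrace ℓ m n b < 0) :
    ∃ x, dominoTrace ℓ m n x = 0 ∧ a < x ∧ x < b := by
  have hc := (continuous_dominoTrace ℓ m n).continuousOn (s := Set.Icc a b)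
  rcases h with h | h
  · obtain ⟨x, hx, h0⟩ := intermediate_value_Ioo hab.le hc h
    exact ⟨x, h0, hx⟩
  · obtain ⟨x, hx, h0⟩ := intermediate_value_Ioo' hab.le hc ⟨h.2, h.1⟩
    exact ⟨x, h0, hx⟩

/-- Points of alternating sign of the trace polynomial. -/
noncomputable def traceSeparator : Fin 8 → ℝ := ![-2, -17 / 10, -1, -3 / 5, 0, 3 / 5, 1, 2]

lemma strictMono_traceSeparator : StrictMono traceSeparator := by
  rw [Fin.strictMono_iff_lt_succ]
  intro i
  have h2 : traceSeparator 2 = -1 := rfl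
  fin_cases i <;> norm_num [h2] <;> norm_num [traceSeparator]

lemma exists_traceRoots_circle (hℓ : 0 ≤ ℓ) (hm : 0 ≤ m) (h : ℓ + m ≤ n) :
    ∃ x : Fin 7 → ℝ, ∀ i, dominoTrace ℓ m n (x i) = 0 ∧
      traceSeparator i.castSucc < x i ∧ x i < traceSeparator i.succ := by
  refine Classical.axiomOfChoice (r := fun i x => dominoTrace ℓ m n x = 0 ∧
      traceSeparator (Fin.castSucc i) < x ∧ x < traceSeparator (Fin.succ i)) fun i =>
    exists_dominoTrace_eq_zero (strictMono_traceSeparator i.castSucc_lt_succ) ?_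
  -- At a fixed rational point the trace polynomial is affine in ℓ, m, n, so all these signs follow
  -- linearly from 0 ≤ ℓ, 0 ≤ m and ℓ + m ≤ n.
  have h0 : dominoTrace ℓ m n (-2) < 0 := by unfold dominoTrace; linarith
  have h1 : 0 < dominoTrace ℓ m n (-17 / 10) := by unfold dominoTrace; linarith
  have h2 : dominoTrace ℓ m n (-1) < 0 := by unfold dominoTrace; linarith
  have h3 : 0 < dominoTrace ℓ m n (-3 / 5) := by unfold dominoTrace; linarith
  have h4 : dominoTrace ℓ m n 0 < 0 := by unfold dominoTrace; linarith
  have h5 : 0 < dominoTrace ℓ m n (3 / 5) := by unfold dominoTrace; linarith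
  have h6 : dominoTrace ℓ m n 1 < 0 := by unfold dominoTrace; linarith
  have h7 : 0 < dominoTrace ℓ m n 2 := by unfold dominoTrace; linarith
  fin_cases i
  exacts [Or.inl ⟨h0, h1⟩, Or.inr ⟨h1, h2⟩, Or.inl ⟨h2, h3⟩, Or.inr ⟨h3, h4⟩, Or.inl ⟨h4, h5⟩,
    Or.inr ⟨h5, h6⟩, Or.inl ⟨h6, h7⟩]

lemma exists_traceRoot_small (hℓ : 0 ≤ ℓ) (hm : 0 ≤ m) (h : ℓ + m ≤ n) :
    ∃ b, dominoTrace ℓ m n b = 0 ∧ 2 < b ∧ b < 3 :=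
  exists_dominoTrace_eq_zero (by norm_num)
    (Or.inr ⟨by unfold dominoTrace; linarith, by unfold dominoTrace; linarith⟩)

/-- The lower end is 4n + 5 + 1/5, which is at least the trace of 4n + 5; this is what later turns
into α > 4n + 5. -/
lemma exists_traceRoot_large (hℓ : 0 ≤ ℓ) (hm : 0 ≤ m) (h : ℓ + m ≤ n) :
    ∃ a, dominoTrace ℓ m n a = 0 ∧ 4 * n + 26 / 5 < a ∧ a < 4 * n + 6 := by
  have hn : 0 ≤ n := by linarith
  refine exists_dominoTrace_eq_zero (by linarith) (Or.inl ⟨?_, ?_⟩)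
  -- After expansion the negated value has only non-negative coefficients as a polynomial in ℓ, m,
  -- n.
  · rw [← neg_pos]
    unfold dominoTrace
    ring_nf
    positivity
  · have hmn : 0 ≤ 4 * n * (n - m) := by
      have : 0 ≤ n - m := by linarith
      positivity
    -- The value splits into a polynomial in n alone, positive after expansion, and terms whose
    -- coefficients are non-negative because ℓ + m ≤ n.
    have hx : dominoTrace ℓ m n (4 * n + 6) = (7 + 12 * n + 4 * n ^ 2) * (4 * n + 6) ^ 6
          + (11 - 9 * n) * (4 * n + 6) ^ 5 + (-91 - 65 * n) * (4 * n + 6) ^ 4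
          + (-4 + 8 * n) * (4 * n + 6) ^ 3 + (55 + 31 * n) * (4 * n + 6) ^ 2
          + (-3 - 5 * n) * (4 * n + 6) + (-6 - 6 * n)
        + ((4 * n * (n - m) + (5 * (n - m) - ℓ)) * (4 * n + 6) ^ 6 + 4 * m * (4 * n + 6) ^ 5
          + (6 * ℓ + 2 * (n - m)) * (4 * n + 6) ^ 4 + (ℓ + 3 * (n - m)) * (4 * n + 6) ^ 3
          + (10 * n - 10 * ℓ - 2 * m) * (4 * n + 6) ^ 2 + (2 * n - 2 * ℓ - m) * (4 * n + 6)
          + (4 * ℓ + 2 * m)) := by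
      unfold dominoTrace
      ring
    have h1 : 0 < (7 + 12 * n + 4 * n ^ 2) * (4 * n + 6) ^ 6
          + (11 - 9 * n) * (4 * n + 6) ^ 5 + (-91 - 65 * n) * (4 * n + 6) ^ 4
          + (-4 + 8 * n) * (4 * n + 6) ^ 3 + (55 + 31 * n) * (4 * n + 6) ^ 2
          + (-3 - 5 * n) * (4 * n + 6) + (-6 - 6 * n) := by
      ring_nf
      positivity
    have h2 : 0 ≤ 4 * n * (n - m) + (5 * (n - m) - ℓ) := by linarith
    have h3 : 0 ≤ 6 * ℓ + 2 * (n - m) := by linarith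
    have h4 : 0 ≤ ℓ + 3 * (n - m) := by linarith
    have h5 : 0 ≤ 10 * n - 10 * ℓ - 2 * m := by linarith
    have h6 : 0 ≤ 2 * n - 2 * ℓ - m := by linarith
    rw [hx]
    positivity

/-- No interval between consecutive separators contains an integer. -/
lemma ne_intCast_of_traceSeparator {i : Fin 7} {x : ℝ} (h1 : traceSeparator i.castSucc < x)
    (h2 : x < traceSeparator i.succ) (k : ℤ) : x ≠ k := by
  have key : ∀ z : ℤ, (z : ℝ) < x → x < z + 1 → x ≠ k := by
    rintro z h3 h4 rfl
    have h5 : z < k := by exact_mod_cast h3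
    have h6 : k < z + 1 := by exact_mod_cast h4
    omega
  have h3 : traceSeparator 2 = -1 := rfl
  fin_cases i <;> norm_num [h3] at h1 h2 <;> norm_num [traceSeparator] at h1 h2
  · exact key (-2) (by push_cast; linarith) (by push_cast; linarith)
  · exact key (-2) (by push_cast; linarith) (by push_cast; linarith)
  · exact key (-1) (by push_cast; linarith) (by push_cast; linarith)
  · exact key (-1) (by push_cast; linarith) (by push_cast; linarith)
  · exact key 0 (by push_cast; linarith) (by push_cast; linarith)
  · exact key 0 (by push_cast; linarith) (by push_cast; linarith)
  · exact key 1 (by push_cast; linarith) (by push_cast; linarith)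

end TracePolynomial

/-! ### From real traces to the eighteen complex roots -/

section Roots

lemma dominoQ_eq_dominoPoly (ℓ m n : ℤ) :
    dominoQ ℓ m n = dominoPoly (C ℓ) (C m) (C n) X := by
  simp only [dominoQ, dominoPoly, C_add, C_sub, C_mul, C_ofNat, C_1]

lemma dominoQ_eq_trinomial_add (ℓ m n : ℤ) : ∃ r : ℤ[X], r.degree < 18 ∧
    dominoQ ℓ m n = X ^ 18 + r := by
  refine ⟨dominoQ ℓ m n - X ^ 18, ?_, by ring⟩
  rw [show (18 : WithBot ℕ) = ((18 : ℕ) : WithBot ℕ) from rfl, degree_lt_iff_coeff_zero]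
  intro k hk
  simp only [dominoQ, coeff_add, coeff_sub, coeff_C_mul, coeff_X_pow, coeff_X, coeff_one]
  simp [show ∀ j < 18, k ≠ j by omega, show 1 ≠ k by omega]

lemma dominoQ_monic (ℓ m n : ℤ) : (dominoQ ℓ m n).Monic := by
  obtain ⟨r, hr, h⟩ := dominoQ_eq_trinomial_add ℓ m n
  rw [h]
  exact monic_X_pow_add hr

lemma natDegree_dominoQ (ℓ m n : ℤ) : (dominoQ ℓ m n).natDegree = 18 := by
  obtain ⟨r, hr, h⟩ := dominoQ_eq_trinomial_add ℓ m n
  rw [h]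
  refine natDegree_eq_of_degree_eq_some ?_
  rw [degree_add_eq_left_of_degree_lt, degree_X_pow]
  rwa [degree_X_pow]

lemma eval_dominoQ {R : Type*} [CommRing R] (f : ℤ →+* R) (ℓ m n : ℤ) (z : R) :
    ((dominoQ ℓ m n).map f).eval z = dominoPoly (ℓ : R) m n z := by
  rw [dominoQ_eq_dominoPoly, eval_map, ← coe_eval₂RingHom, map_dominoPoly]
  simp

/-- The point of the upper half of the unit circle with trace `x`. -/
noncomputable def circlePoint (x : ℝ) : ℂ := ⟨x / 2, √(1 - x ^ 2 / 4)⟩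

/-- The real number greater than one with trace `x`. -/
noncomputable def axisPoint (x : ℝ) : ℝ := (x + √(x ^ 2 - 4)) / 2

lemma circlePoint_injective : Function.Injective circlePoint := by
  intro x y h
  have := congrArg Complex.re h
  simp only [circlePoint] at this
  linarith

lemma norm_circlePoint {x : ℝ} (h1 : -2 < x) (h2 : x < 2) : ‖circlePoint x‖ = 1 := by
  have h : 0 ≤ 1 - x ^ 2 / 4 := by nlinarith
  have h3 := Complex.normSq_apply (circlePoint x)
  simp only [circlePoint, Real.mul_self_sqrt h] at h3
  rw [Complex.norm_def, circlePoint, h3, Real.sqrt_eq_one]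
  ring

lemma circlePoint_im_pos {x : ℝ} (h1 : -2 < x) (h2 : x < 2) : 0 < (circlePoint x).im :=
  Real.sqrt_pos.2 (by nlinarith)

lemma circlePoint_add_inv {x : ℝ} (h1 : -2 < x) (h2 : x < 2) :
    circlePoint x + (circlePoint x)⁻¹ = x := by
  rw [Complex.inv_eq_conj (norm_circlePoint h1 h2), Complex.add_conj]
  simp only [circlePoint]
  push_cast
  ring

lemma one_lt_axisPoint {x : ℝ} (h : 2 < x) : 1 < axisPoint x := by
  have := Real.sqrt_nonneg (x ^ 2 - 4)
  unfold axisPoint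
  linarith

lemma axisPoint_add_inv {x : ℝ} (h : 2 < x) : axisPoint x + (axisPoint x)⁻¹ = x := by
  have h0 : axisPoint x ≠ 0 := (zero_lt_one.trans (one_lt_axisPoint h)).ne'
  have h1 : √(x ^ 2 - 4) ^ 2 = x ^ 2 - 4 := Real.sq_sqrt (by nlinarith)
  have h2 : axisPoint x * axisPoint x + 1 = x * axisPoint x := by
    unfold axisPoint
    linear_combination h1 / 4
  field_simp
  linear_combination h2

lemma isRoot_dominoQ {ℓ m n : ℕ} {x : ℝ} (hx : dominoTrace (ℓ : ℝ) m n x = 0) {z : ℂ}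
    (hz : z + z⁻¹ = x) (h0 : z ≠ 0) :
    z ∈ ((dominoQ ℓ m n).map (Int.castRingHom ℂ)).roots := by
  rw [mem_roots ((dominoQ_monic _ _ _).map _).ne_zero, IsRoot, eval_dominoQ,
    dominoPoly_eq_pow_mul_dominoTrace _ _ _ h0, hz]
  have := congrArg Complex.ofRealHom hx
  rw [map_dominoTrace] at this
  simp only [map_natCast, map_zero, Complex.ofRealHom_eq_coe] at this
  simp [this]

/-- The roots of `Q_{ℓ,m,n}`. None of their traces is an integer. -/
theorem exists_roots_dominoQ (ℓ m n : ℕ) (h : ℓ + m ≤ n) : ∃ (α β : ℝ) (ω : Fin 7 → ℂ),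
    Function.Injective ω ∧ (∀ i, ‖ω i‖ = 1 ∧ 0 < (ω i).im) ∧
    ((dominoQ ℓ m n).map (Int.castRingHom ℂ)).roots =
      ({(α : ℂ), ((1 / α : ℝ) : ℂ), (β : ℂ), ((1 / β : ℝ) : ℂ)} : Multiset ℂ)
        + (Finset.univ : Finset (Fin 7)).val.map ω
        + (Finset.univ : Finset (Fin 7)).val.map (fun i => (starRingEnd ℂ) (ω i)) ∧
    1 < β ∧ β < α ∧ 4 * (n : ℝ) + 5 < α ∧ α < 4 * (n : ℝ) + 6 ∧
    ∀ k : ℤ, α + α⁻¹ ≠ k ∧ β + β⁻¹ ≠ k ∧ ∀ i, ω i + (ω i)⁻¹ ≠ k := by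
  have hℓ : (0 : ℝ) ≤ ℓ := ℓ.cast_nonneg
  have hm : (0 : ℝ) ≤ m := m.cast_nonneg
  have hn : (0 : ℝ) ≤ n := n.cast_nonneg
  have h' : (ℓ : ℝ) + m ≤ n := by exact_mod_cast h
  obtain ⟨x, hx⟩ := exists_traceRoots_circle hℓ hm h'
  obtain ⟨b, hb, hb2, hb3⟩ := exists_traceRoot_small hℓ hm h'
  obtain ⟨a, ha, ha1, ha2⟩ := exists_traceRoot_large hℓ hm h'
  have hx1 : ∀ i, -2 < x i := fun i => lt_of_le_of_lt
    (strictMono_traceSeparator.monotone (Fin.zero_le i.castSucc)) (hx i).2.1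
  have hx2 : ∀ i, x i < 2 := fun i => lt_of_lt_of_le (hx i).2.2
    (strictMono_traceSeparator.monotone (Fin.le_last i.succ))
  have hxmono : StrictMono x := by
    intro i j hij
    refine (hx i).2.2.trans (lt_of_le_of_lt ?_ (hx j).2.1)
    exact strictMono_traceSeparator.monotone (Fin.le_def.2 (by simpa using Nat.succ_le_of_lt (Fin.lt_def.1 hij)))
  have ha3 : 2 < a := by linarith
  have hA := axisPoint_add_inv ha3
  have hB := axisPoint_add_inv hb2
  have hA1 := one_lt_axisPoint ha3
  have hB1 := one_lt_axisPoint hb2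
  have hω := fun i => circlePoint_add_inv (hx1 i) (hx2 i)
  have hnorm := fun i => norm_circlePoint (hx1 i) (hx2 i)
  have him := fun i => circlePoint_im_pos (hx1 i) (hx2 i)
  set α := axisPoint a
  set β := axisPoint b
  set ω : Fin 7 → ℂ := fun i => circlePoint (x i)
  have hωinj : Function.Injective ω := circlePoint_injective.comp hxmono.injective
  have hAi : 0 < α⁻¹ := by positivity
  have hBi : 0 < β⁻¹ := by positivity
  have hAi1 : α⁻¹ < 1 := inv_lt_one_of_one_lt₀ hA1
  have hBi1 : β⁻¹ < 1 := inv_lt_one_of_one_lt₀ hB1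
  -- The function t + 1/t increases for t ≥ 1, so α ≤ 4n + 5 would bound the trace by 4n + 5 + 1/5.
  have hα : 4 * (n : ℝ) + 5 < α := by
    have h1 : 4 < α := by linarith
    have h2 : α⁻¹ < 4⁻¹ := inv_strictAnti₀ (by norm_num) h1
    by_contra h3
    have h4 : 4⁻¹ < α⁻¹ + 4⁻¹ := by linarith
    have h5 : α * α⁻¹ = 1 := mul_inv_cancel₀ (by positivity)
    nlinarith
  have hβα : β < α := by linarith
  have hBA : α⁻¹ < β⁻¹ := inv_strictAnti₀ (by linarith) hβα
  refine ⟨α, β, ω, hωinj, fun i => ⟨hnorm i, him i⟩, ?_, hB1, hβα, hα, by linarith,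
    fun k => ⟨?_, ?_, fun i => ?_⟩⟩
  · symm
    -- Eighteen distinct roots of a polynomial of degree 18 are all of its roots, each with
    -- multiplicity one. Positive imaginary parts keep the ω apart from their conjugates and from
    -- the real roots.
    refine Multiset.eq_of_le_of_card_le ((Multiset.le_iff_subset ?_).2 ?_) ?_
    · simp only [Multiset.nodup_add, Multiset.disjoint_left]
      refine ⟨⟨?_, ?_, ?_⟩, ?_, ?_⟩
      · simp only [Multiset.insert_eq_cons, Multiset.nodup_cons, Multiset.mem_cons,
          Multiset.mem_singleton, Multiset.nodup_singleton, Complex.ofReal_inj, one_div, not_or]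
        exact ⟨⟨by linarith only [hA1, hAi1], ne_of_gt hβα, by linarith⟩, ⟨by linarith, hBA.ne⟩,
          by linarith, trivial⟩
      · exact (Multiset.nodup_map_iff_of_injective hωinj).2 Finset.univ.nodup
      · intro z hz hz'
        obtain ⟨i, -, rfl⟩ := Multiset.mem_map.1 hz'
        have h1 := him i
        simp only [Multiset.insert_eq_cons, Multiset.mem_cons, Multiset.mem_singleton] at hz
        rcases hz with h | h | h | h
        all_goals
          have h2 := congrArg Complex.im h
          simp only [Complex.ofReal_im] at h2
          linarith
      · exact (Multiset.nodup_map_iff_of_injective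
          ((starRingEnd ℂ).injective.comp hωinj)).2 Finset.univ.nodup
      · intro z hz hz'
        obtain ⟨i, -, rfl⟩ := Multiset.mem_map.1 hz'
        have h1 := him i
        simp only [Multiset.mem_add, Multiset.insert_eq_cons, Multiset.mem_cons,
          Multiset.mem_singleton, Multiset.mem_map] at hz
        rcases hz with (h | h | h | h) | ⟨j, -, h⟩
        any_goals
          have h2 := congrArg Complex.im h
          simp only [Complex.conj_im, Complex.ofReal_im] at h2
          linarith
        have h2 := congrArg Complex.im h
        simp only [Complex.conj_im] at h2
        linarith [him j]
    · intro z hz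
      simp only [Multiset.mem_add, Multiset.insert_eq_cons, Multiset.mem_cons,
        Multiset.mem_singleton, Multiset.mem_map] at hz
      have hA0 : (α : ℂ) ≠ 0 := by exact_mod_cast (by positivity : α ≠ 0)
      have hB0 : (β : ℂ) ≠ 0 := by exact_mod_cast (by positivity : β ≠ 0)
      have hω0 : ∀ i, ω i ≠ 0 := fun i h0 => by
        have h1 : ‖ω i‖ = 1 := hnorm i
        simp [h0] at h1
      rcases hz with ((rfl | rfl | rfl | rfl) | ⟨i, -, rfl⟩) | ⟨i, -, rfl⟩
      · exact isRoot_dominoQ ha (by rw [← hA]; push_cast; rfl) hA0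
      · refine isRoot_dominoQ ha (by rw [← hA]; push_cast; rw [one_div, inv_inv, add_comm]) ?_
        simpa using hA0
      · exact isRoot_dominoQ hb (by rw [← hB]; push_cast; rfl) hB0
      · refine isRoot_dominoQ hb (by rw [← hB]; push_cast; rw [one_div, inv_inv, add_comm]) ?_
        simpa using hB0
      · exact isRoot_dominoQ (hx i).1 (hω i) (hω0 i)
      · rw [← Complex.inv_eq_conj (hnorm i)]
        exact isRoot_dominoQ (hx i).1 (by rw [inv_inv, add_comm]; exact hω i)
          (inv_ne_zero (hω0 i))
    · refine (card_roots' _).trans ?_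
      rw [(dominoQ_monic _ _ _).natDegree_map, natDegree_dominoQ]
      simp
  · rw [hA]
    rintro rfl
    have h1 : 4 * (n : ℤ) + 5 < k := by
      have : ((4 * (n : ℤ) + 5 : ℤ) : ℝ) < k := by push_cast; linarith
      exact_mod_cast this
    have h2 : k < 4 * (n : ℤ) + 6 := by exact_mod_cast ha2
    omega
  · rw [hB]
    rintro rfl
    have h1 : 2 < k := by exact_mod_cast hb2
    have h2 : k < 3 := by exact_mod_cast hb3
    omega
  · intro h1
    rw [hω i] at h1
    exact ne_intCast_of_traceSeparator (hx i).2.1 (hx i).2.2 k (by exact_mod_cast h1)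

end Roots

/-! ### Absence of quadratic factors -/

section QuadraticFactors

/-- The roots of `Q_{ℓ,m,n}` are non-real points of the unit circle and positive real numbers, and
their traces are not integers. -/
lemma mem_roots_dominoQ {ℓ m n : ℕ} (h : ℓ + m ≤ n) {z : ℂ}
    (hz : z ∈ ((dominoQ ℓ m n).map (Int.castRingHom ℂ)).roots) :
    (∀ k : ℤ, z + z⁻¹ ≠ k) ∧ (‖z‖ = 1 ∧ z.im ≠ 0 ∨ ∃ s : ℝ, 0 < s ∧ z = s) := by
  obtain ⟨α, β, ω, -, hω, hroots, hβ, hβα, -, -, hk⟩ := exists_roots_dominoQ ℓ m n h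
  have hA : ∀ k : ℤ, (α : ℂ) + (α : ℂ)⁻¹ ≠ k := fun k h => (hk k).1 (by exact_mod_cast h)
  have hB : ∀ k : ℤ, (β : ℂ) + (β : ℂ)⁻¹ ≠ k := fun k h => (hk k).2.1 (by exact_mod_cast h)
  have hβ0 : 0 < β := by linarith
  have hα0 : 0 < α := by linarith
  rw [hroots] at hz
  simp only [Multiset.mem_add, Multiset.insert_eq_cons, Multiset.mem_cons,
    Multiset.mem_singleton, Multiset.mem_map] at hz
  rcases hz with ((rfl | rfl | rfl | rfl) | ⟨i, -, rfl⟩) | ⟨i, -, rfl⟩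
  · exact ⟨hA, Or.inr ⟨α, hα0, rfl⟩⟩
  · refine ⟨fun k => ?_, Or.inr ⟨1 / α, by positivity, rfl⟩⟩
    push_cast
    rw [one_div, inv_inv, add_comm]
    exact hA k
  · exact ⟨hB, Or.inr ⟨β, hβ0, rfl⟩⟩
  · refine ⟨fun k => ?_, Or.inr ⟨1 / β, by positivity, rfl⟩⟩
    push_cast
    rw [one_div, inv_inv, add_comm]
    exact hB k
  · exact ⟨fun k => (hk k).2.2 i, Or.inl ⟨(hω i).1, (hω i).2.ne'⟩⟩
  · refine ⟨fun k => ?_, Or.inl ⟨?_, ?_⟩⟩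
    · rw [← Complex.inv_eq_conj (hω i).1, inv_inv, add_comm]
      exact (hk k).2.2 i
    · rw [RCLike.norm_conj, (hω i).1]
    · simpa using (hω i).2.ne'

/-- `Q_{ℓ,m,n}` does not have two roots with an integral sum and product `-1`. -/
lemma neg_inv_notMem_roots_dominoQ {ℓ m n : ℕ} (h : ℓ + m ≤ n) {z : ℂ} (c : ℤ)
    (hz : z ∈ ((dominoQ ℓ m n).map (Int.castRingHom ℂ)).roots) (hc : z - z⁻¹ = c) :
    -z⁻¹ ∉ ((dominoQ ℓ m n).map (Int.castRingHom ℂ)).roots := by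
  intro hz'
  -- On the unit circle z - 1/z is purely imaginary, so a real value forces z to be real. For a
  -- positive real z the number -1/z is negative, and no root is.
  rcases (mem_roots_dominoQ h hz).2 with ⟨h1, h2⟩ | ⟨s, hs, rfl⟩
  · rw [Complex.inv_eq_conj h1] at hc
    have h3 := congrArg Complex.im hc
    simp only [Complex.sub_im, Complex.conj_im, Complex.intCast_im] at h3
    exact h2 (by linarith)
  · rcases (mem_roots_dominoQ h hz').2 with ⟨-, h2⟩ | ⟨r, hr, h2⟩
    · rw [← Complex.ofReal_inv, ← Complex.ofReal_neg, Complex.ofReal_im] at h2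
      exact h2 rfl
    · have h3 : -s⁻¹ = r := by exact_mod_cast h2
      have : 0 < s⁻¹ := by positivity
      linarith

/-- Q is monic with constant term 1, so a quadratic factor has leading and constant coefficients ±1.
Its roots then have integral sum and product 1 or -1: the first makes a trace integral, the second
is excluded by `neg_inv_notMem_roots_dominoQ`. -/
theorem not_dvd_dominoQ {ℓ m n : ℕ} (h : ℓ + m ≤ n) {p : ℤ[X]} (hp : p.natDegree = 2) :
    ¬ p ∣ dominoQ ℓ m n := by
  rintro ⟨q, hq⟩
  have h2 : IsUnit (p.coeff 2) := by
    have h1 : p.leadingCoeff * q.leadingCoeff = 1 := by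
      rw [← leadingCoeff_mul, ← hq, (dominoQ_monic _ _ _).leadingCoeff]
    rw [leadingCoeff, hp] at h1
    exact IsUnit.of_mul_eq_one _ h1
  have h0 : IsUnit (p.coeff 0) := by
    have h1 : p.coeff 0 * q.coeff 0 = 1 := by
      rw [← mul_coeff_zero, ← hq]
      simp [dominoQ]
    exact IsUnit.of_mul_eq_one _ h1
  have hpe : ∀ z : ℂ, (p.map (Int.castRingHom ℂ)).eval z
      = p.coeff 2 * z ^ 2 + p.coeff 1 * z + p.coeff 0 := by
    intro z
    rw [eval_map, eval₂_eq_sum_range, hp]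
    simp [Finset.sum_range_succ]
    ring
  have hroot : ∀ z : ℂ, (p.coeff 2 : ℂ) * z ^ 2 + p.coeff 1 * z + p.coeff 0 = 0 →
      z ∈ ((dominoQ ℓ m n).map (Int.castRingHom ℂ)).roots := by
    intro z hz
    rw [mem_roots ((dominoQ_monic _ _ _).map _).ne_zero, hq, Polynomial.map_mul, IsRoot,
      eval_mul, hpe, hz, zero_mul]
  obtain ⟨z, hz⟩ : ∃ z : ℂ, (p.coeff 2 : ℂ) * z ^ 2 + p.coeff 1 * z + p.coeff 0 = 0 := by
    have hdeg : (p.map (Int.castRingHom ℂ)).degree ≠ 0 := by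
      rw [degree_map_eq_of_injective (RingHom.injective_int _), degree_eq_natDegree, hp]
      · norm_num
      · rintro rfl; simp at hp
    obtain ⟨z, hz⟩ := IsAlgClosed.exists_root _ hdeg
    exact ⟨z, by rw [← hpe]; exact hz⟩
  obtain ⟨hk, hz'⟩ := mem_roots_dominoQ h (hroot z hz)
  have hz0 : z ≠ 0 := by
    rintro rfl
    rcases hz' with h1 | ⟨s, hs, h1⟩
    · simp at h1
    · have : s = 0 := by exact_mod_cast h1.symm
      exact hs.ne' this
  generalize p.coeff 1 = b at *
  rcases Int.isUnit_iff.1 h2 with h2 | h2 <;> rcases Int.isUnit_iff.1 h0 with h0 | h0 <;>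
    rw [h2, h0] at hz hroot <;> push_cast at hz hroot
  · refine hk (-b) ?_
    push_cast
    field_simp
    linear_combination hz
  · refine neg_inv_notMem_roots_dominoQ h (-b) (hroot z hz) ?_ (hroot _ ?_)
    · push_cast
      field_simp
      linear_combination hz
    · field_simp
      linear_combination -hz
  · refine neg_inv_notMem_roots_dominoQ h b (hroot z hz) ?_ (hroot _ ?_)
    · field_simp
      linear_combination -hz
    · field_simp
      linear_combination -hz
  · refine hk b ?_
    field_simp
    linear_combination -hz

end QuadraticFactors

/-! ### The growth rate as the reciprocal of the smallest pole -/

section Rate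

lemma mem_reflectionsIn {N : Set LorentzSpace} (hN : ∀ u ∈ N, lorentz u u = 1)
    {r : LorentzSpace ≃ₗ[ℝ] LorentzSpace} :
    r ∈ reflectionsIn N ↔ ∃ u ∈ N, lorentzReflection u = r := by
  refine exists_congr fun u => and_congr_right fun hu => ?_
  rw [LinearEquiv.ext_iff]
  refine forall_congr' fun x => ?_
  rw [lorentzReflection_apply (hN u hu), eq_comm]

/-- Transfers word length from the reflections, as in the definition of the growth rate, to words in
the normals. -/
lemma exists_word_reflectionsIn {N : Set LorentzSpace} (hN : ∀ u ∈ N, lorentz u u = 1)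
    {w : LorentzSpace ≃ₗ[ℝ] LorentzSpace} {j : ℕ} :
    (∃ l : List (LorentzSpace ≃ₗ[ℝ] LorentzSpace), l.length = j ∧
      (∀ s ∈ l, s ∈ reflectionsIn N) ∧ l.prod = w) ↔
    ∃ l : List LorentzSpace, l.length = j ∧ (∀ u ∈ l, u ∈ N) ∧ wordProd l = w := by
  constructor
  · rintro ⟨l, rfl, hl, rfl⟩
    induction l with
    | nil => exact ⟨[], rfl, by simp, rfl⟩
    | cons s l ih =>
      obtain ⟨l', h1, h2, h3⟩ := ih fun s hs => hl s (List.mem_cons_of_mem _ hs)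
      obtain ⟨u, hu, rfl⟩ := (mem_reflectionsIn hN).1 (hl s List.mem_cons_self)
      refine ⟨u :: l', by simp [h1], ?_, by simp [h3]⟩
      simpa [hu] using h2
  · rintro ⟨l, rfl, hl, rfl⟩
    refine ⟨l.map lorentzReflection, by simp, ?_, rfl⟩
    intro s hs
    obtain ⟨u, hu, rfl⟩ := List.mem_map.1 hs
    exact (mem_reflectionsIn hN).2 ⟨u, hl u hu, rfl⟩

lemma growthCoeff_reflectionsIn {N : Finset LorentzSpace}
    (hN : ∀ u ∈ (N : Set LorentzSpace), lorentz u u = 1) (k : ℕ) :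
    growthCoeff (reflectionsIn (N : Set LorentzSpace)) k = (layer N k).card := by
  rw [growthCoeff, ← Set.ncard_coe_finset]
  congr 1
  ext w
  simp only [Set.mem_ofPred_eq, HasWordLength, exists_word_reflectionsIn hN, Finset.mem_coe,
    mem_layer]
  constructor
  · intro h
    obtain ⟨l, -, hl, rfl⟩ := h.1
    exact ⟨wordProd_mem hl, h.csInf_eq⟩
  · rintro ⟨hw, rfl⟩
    exact ⟨exists_word hw, fun j hj => Nat.sInf_le hj⟩

variable {D : MarkedPolytope}

lemma IsDomino.growthSeries_mul {ℓ m n : ℕ} (h : IsDomino ℓ m n D) {N : Finset LorentzSpace}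
    (hN : (N : Set LorentzSpace) = D.normals) :
    growthSeries N * dominoPoly (ℓ : PowerSeries ℚ) m n PowerSeries.X
      = dominoDen PowerSeries.X := by
  apply HahnSeries.ofPowerSeries_injective (Γ := ℤ)
  have h1 := h.invGrowth hN
  rw [map_mul, map_dominoPoly, map_dominoDen, map_natCast, map_natCast, map_natCast]
  change _ * dominoPoly _ _ _ laurentX = dominoDen laurentX
  rw [← h1, _root_.invGrowth, mul_inv_cancel_left₀ (growthSeries_ne_zero N)]

lemma coe_dominoQ (ℓ m n : ℕ) : (((dominoQ ℓ m n).map (Int.castRingHom ℂ) : ℂ[X]) : PowerSeries ℂ)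
    = dominoPoly (ℓ : PowerSeries ℂ) m n PowerSeries.X := by
  rw [dominoQ_eq_dominoPoly, ← coe_mapRingHom, map_dominoPoly,
    ← Polynomial.coeToPowerSeries.ringHom_apply, map_dominoPoly]
  simp

lemma dominoDen_pos {x : ℝ} (hx : 0 < x) : 0 < dominoDen x := by
  unfold dominoDen
  positivity

/-- The growth series is `dominoDen` divided by Q. The first is positive on the positive half-line,
so the root 1/α of Q, of least modulus by hypothesis, is a genuine pole. -/
theorem IsDomino.rate_eq {ℓ m n : ℕ} (h : IsDomino ℓ m n D) {α : ℝ} (hα : 0 < α)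
    (hroots : ∀ z ∈ ((dominoQ ℓ m n).map (Int.castRingHom ℂ)).roots, 1 / α ≤ ‖z‖)
    (hα' : ((1 / α : ℝ) : ℂ) ∈ ((dominoQ ℓ m n).map (Int.castRingHom ℂ)).roots) :
    D.rate = α := by
  have hN : ((h.isGlueable.finite.toFinset : Finset LorentzSpace) : Set LorentzSpace)
      = D.normals := h.isGlueable.finite.coe_toFinset
  generalize h.isGlueable.finite.toFinset = N at hN
  have hunit := h.isGlueable.coxeter.unit
  rw [← hN] at hunit
  rw [MarkedPolytope.rate, growthRate, ← hN]
  simp only [growthCoeff_reflectionsIn hunit]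
  have hα0 : ((α : ℂ)⁻¹) = ((1 / α : ℝ) : ℂ) := by push_cast; rw [one_div]
  refine limsup_root_coeff_eq (p := dominoDen X) (fun k => Nat.cast_nonneg _)
    ((dominoQ_monic ℓ m n).map (Int.castRingHom ℂ)) ?_ hα hroots ?_ ?_
  · have h1 := congrArg (PowerSeries.map (algebraMap ℚ ℂ)) (h.growthSeries_mul hN)
    rw [map_mul, map_dominoPoly, map_dominoDen] at h1
    rw [coe_dominoQ, ← Polynomial.coeToPowerSeries.ringHom_apply, map_dominoDen]
    simp only [map_natCast, PowerSeries.map_X, Polynomial.coeToPowerSeries.ringHom_apply,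
      Polynomial.coe_X] at h1 ⊢
    rw [← h1]
    congr 1
  · rw [hα0]
    exact (mem_roots'.1 hα').2
  · rw [hα0, ← coe_evalRingHom, map_dominoDen, coe_evalRingHom, eval_X,
      ← Complex.ofRealHom_eq_coe, ← map_dominoDen]
    simpa using (dominoDen_pos (one_div_pos.2 hα)).ne'

end Rate

/-! ### Existence of the tile -/

section TileExistence

variable {e v : Fin 5 → LorentzSpace}

lemma IsFuture.exists_smul_mem_hyperbolicSpace {x : LorentzSpace} (hx : IsFuture x) :
    ∃ c : ℝ, 0 < c ∧ c • x ∈ hyperbolicSpace := by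
  have h1 : 0 < -lorentz x x := neg_pos.2 hx.1
  refine ⟨(√(-lorentz x x))⁻¹, by positivity, ?_, mul_pos (by positivity) hx.2⟩
  rw [lorentz_smul_left, lorentz_smul_right, ← mul_assoc, ← mul_inv, Real.mul_self_sqrt h1.le,
    inv_neg, neg_mul, inv_mul_cancel₀ hx.1.ne]

/-- A simplex with the right Gram matrix can be truncated if it has a suitable incenter. -/
lemma exists_isTile_of_gram (hg : ∀ i j, -2 * lorentz (e i) (e j) = goldenVal (gramGolden i j))
    {x : LorentzSpace} (hx : IsFuture x) (hxe : ∀ i, lorentz x (e i) = -1) :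
    ∃ v, IsTile e v := by
  have hp : ∀ i, GoldenPos (invGram i i) := by decide
  -- Negative row sums of the inverse Gram matrix make every dual root positive against x. The
  -- outward truncating normals are the negative multiples, and x lies strictly inside all of them.
  have hs : ∀ i, GoldenPos (-∑ j, invGram i j) := by decide
  have hpos : ∀ i, 0 < 15 * goldenVal (invGram i i) := fun i => mul_pos (by norm_num) (hp i).pos
  have hc : ∀ i, 0 < (√(15 * goldenVal (invGram i i)))⁻¹ := fun i =>
    inv_pos.2 (Real.sqrt_pos.2 (hpos i))
  have hxd : ∀ i, 0 < lorentz x (dualRoot e i) := by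
    intro i
    have h1 := (hs i).pos
    rw [goldenVal_neg, goldenVal_sum] at h1
    rw [dualRoot, lorentz_sum_right]
    simp_rw [lorentz_smul_right, hxe, mul_neg, mul_one]
    rwa [Finset.sum_neg_distrib]
  refine ⟨fun i => (-(√(15 * goldenVal (invGram i i)))⁻¹) • dualRoot e i, ?_, ?_, ?_, ?_, ?_⟩
  · intro i j
    linarith [hg i j, neg_two_mul_neg_cos_simplexLabel i j]
  · intro i
    rw [lorentz_smul_left, lorentz_smul_right, lorentz_dualRoot_dualRoot hg, ← mul_assoc,
      neg_mul_neg, ← mul_inv, Real.mul_self_sqrt (hpos i).le, inv_mul_cancel₀ (hpos i).ne']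
  · intro i j hij
    rw [lorentz_smul_left, lorentz_dualRoot hg, if_neg hij, mul_zero]
  · intro i
    rw [lorentz_smul_left, lorentz_dualRoot hg, if_pos rfl]
    linarith [hc i]
  · obtain ⟨c, hc0, hcx⟩ := hx.exists_smul_mem_hyperbolicSpace
    refine ⟨c • x, hcx, ?_⟩
    rintro _ (⟨i, rfl⟩ | ⟨i, rfl⟩)
    · rw [lorentz_smul_left, hxe]
      linarith
    · rw [lorentz_smul_left, lorentz_smul_right, neg_mul, mul_neg, neg_lt_zero]
      exact mul_pos hc0 (mul_pos (hc i) (hxd i))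

/-- Three of the normals are pairwise orthogonal and may be taken as coordinate vectors. Their
products with the other two then determine the first three coordinates of those. -/
theorem exists_isTile : ∃ e v, IsTile e v := by
  have hφ := Real.goldenRatio_sq
  have hφ1 := Real.one_lt_goldenRatio
  set φ := Real.goldenRatio with hφdef
  -- The numbers p and q solve p² - q² = (1 - φ)/4 and p² + q² = (1 + 2φ)/4, that is, unit length
  -- and mutual orthogonality of the two remaining normals.
  obtain ⟨p, hp⟩ : ∃ p : ℝ, p * p = (φ + 2) / 8 :=
    ⟨√((φ + 2) / 8), Real.mul_self_sqrt (by positivity)⟩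
  obtain ⟨q, hq0, hq⟩ : ∃ q : ℝ, 0 < q ∧ q * q = 3 * φ / 8 :=
    ⟨√(3 * φ / 8), Real.sqrt_pos.2 (by positivity), Real.mul_self_sqrt (by positivity)⟩
  let e : Fin 5 → LorentzSpace := ![![1, 0, 0, 0, 0], ![-φ / 2, -1 / 2, -1 / 2, p, q],
    ![0, 1, 0, 0, 0], ![-1 / 2, -φ / 2, -1 / 2, -p, q], ![0, 0, 1, 0, 0]]
  have h : ∀ i j, i ≤ j → -2 * lorentz (e i) (e j) = goldenVal (gramGolden i j) := by
    have h11 : lorentz (e 1) (e 1) = 1 := by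
      simp [lorentz, e]
      linear_combination hφ / 4 + hp - hq
    have h13 : lorentz (e 1) (e 3) = 0 := by
      simp [lorentz, e]
      linear_combination -hp - hq
    have h33 : lorentz (e 3) (e 3) = 1 := by
      simp [lorentz, e]
      linear_combination hφ / 4 + hp - hq
    intro i j hij
    have hG : ∀ a b, goldenVal (a, b) = a + b * φ := fun a b => rfl
    have hmem : ∀ i j : Fin 5, i ≤ j → (i, j, gramGolden i j) ∈ [(1, 1, (-2, 0)),
      (1, 3, (0, 0)), (3, 3, (-2, 0)), (0, 0, (-2, 0)), (0, 1, (0, 1)), (0, 2, (0, 0)),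
      (0, 3, (1, 0)), (0, 4, (0, 0)), (1, 2, (1, 0)), (1, 4, (1, 0)), (2, 2, (-2, 0)),
      (2, 3, (0, 1)), (2, 4, (0, 0)), (3, 4, (1, 0)), (4, 4, (-2, 0))] := by decide
    have hij := hmem i j hij
    simp only [List.mem_cons, Prod.mk.injEq, List.not_mem_nil, or_false] at hij
    rcases hij with ⟨rfl, rfl, h⟩ | ⟨rfl, rfl, h⟩ | ⟨rfl, rfl, h⟩ | hij
    · rw [h11, h, hG]; norm_num
    · rw [h13, h, hG]; norm_num
    · rw [h33, h, hG]; norm_num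
    · rcases hij with ⟨rfl, rfl, h⟩ | ⟨rfl, rfl, h⟩ | ⟨rfl, rfl, h⟩ | ⟨rfl, rfl, h⟩ |
        ⟨rfl, rfl, h⟩ | ⟨rfl, rfl, h⟩ | ⟨rfl, rfl, h⟩ | ⟨rfl, rfl, h⟩ | ⟨rfl, rfl, h⟩ |
        ⟨rfl, rfl, h⟩ | ⟨rfl, rfl, h⟩ | ⟨rfl, rfl, h⟩ <;> rw [h, hG] <;>
        simp [lorentz, e] <;> ring
  have hsymm : ∀ i j, gramGolden i j = gramGolden j i := by decide
  -- The point x is the solution of ⟨x,e_i⟩ = -1 for all i, a multiple of the incenter.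
  obtain ⟨v, hv⟩ := exists_isTile_of_gram (e := e) (x := ![-1, -1, -1, 0, (2 + φ / 2) / q])
    (fun i j => by
      rcases le_total i j with hij | hij
      · exact h i j hij
      · rw [lorentz_comm, hsymm, h j i hij])
    ⟨by
      have h1 : (2 + φ / 2) / q * ((2 + φ / 2) / q) = (2 + φ / 2) ^ 2 / (3 * φ / 8) := by
        rw [← hq]; field_simp
      have h2 : 3 < (2 + φ / 2) ^ 2 / (3 * φ / 8) := by
        rw [lt_div_iff₀ (by positivity)]
        nlinarith
      simp [lorentz]
      linarith, by simp; positivity⟩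
    (fun i => by
      have h1 : (2 + φ / 2) / q * q = 2 + φ / 2 := by field_simp
      fin_cases i <;> simp [lorentz, e] <;> linarith)
  exact ⟨e, v, hv⟩

end TileExistence

/-! ### Existence of dominoes -/

section DominoExistence

variable {e v : Fin 5 → LorentzSpace} {D : MarkedPolytope} {t : FacetType} {u : LorentzSpace}

lemma IsTile.reflection (h : IsTile e v) {u : LorentzSpace} (hu : lorentz u u = 1) :
    IsTile (fun i => lorentzReflection u (e i)) (fun i => lorentzReflection u (v i)) where
  gram i j := by rw [lorentz_lorentzReflection, h.gram]
  unit i := by rw [lorentz_lorentzReflection, h.unit]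
  ortho i j hij := by rw [lorentz_lorentzReflection, h.ortho i j hij]
  neg i := by rw [lorentz_lorentzReflection]; exact h.neg i
  interior_nonempty := by
    obtain ⟨x, ⟨hx1, hx2⟩, hx⟩ := h.interior_nonempty
    have hf : IsFuture x := ⟨by rw [hx1]; norm_num, hx2⟩
    refine ⟨lorentzReflection u x, ⟨?_, (hf.reflection hu).2⟩, ?_⟩
    · rw [lorentz_lorentzReflection, hx1]
    · rintro _ (⟨i, rfl⟩ | ⟨i, rfl⟩) <;> rw [lorentz_lorentzReflection]
      exacts [hx _ (Or.inl ⟨i, rfl⟩), hx _ (Or.inr ⟨i, rfl⟩)]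

/-- A copy of the tile, namely the reflection of a suitable one, can be glued to every free
orthogonal facet. -/
lemma IsGlueable.exists_isTile (hD : IsGlueable D) (hu : u ∈ D.orth t) :
    ∃ e v, IsTile e v ∧ -u ∈ (truncatedSimplex e v).orth t ∧
      D.orthogonalTo u = (truncatedSimplex e v).orthogonalTo (-u) := by
  have hunit := hD.coxeter.unit u (hD.orth_subset t hu)
  obtain ⟨e, v, h, i, hi, rfl, hfacet⟩ := hD.tile t u hu
  have h' := h.reflection hunit
  refine ⟨_, _, h', ⟨i, hi, lorentzReflection_self hunit⟩, ?_⟩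
  have h1 := h'.orthogonalTo i
  simp only [lorentzReflection_self hunit] at h1
  rw [h1, hfacet]
  refine Set.image_congr fun j hj => ?_
  rw [lorentzReflection_apply hunit, lorentz_comm, h.ortho i j (Ne.symm hj)]
  simp

lemma IsDomino.exists_glue {ℓ m n : ℕ} (h : IsDomino ℓ m n D) (ht : (D.orth t).Nonempty) :
    ∃ D', IsDomino (ℓ + t.count .A) (m + t.count .B) (n + 1) D' := by
  obtain ⟨u, hu⟩ := ht
  obtain ⟨e, v, he, hu', hfacet⟩ := h.isGlueable.exists_isTile hu
  exact ⟨_, IsDomino.glue ℓ m n D e v t u h he hu hu' hfacet⟩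

/-- An orthogonal facet of a type different from the type of the gluing persists. -/
lemma IsGluing.orth_of_ne {D' : MarkedPolytope} (h : IsGluing D D' t u) {t' : FacetType}
    (ht : t' ≠ t) : (D.glue D' u).orth t' = D.orth t' ∪ D'.orth t' := by
  have h1 : u ∉ D.orth t' := fun h1 =>
    Set.disjoint_left.1 (h.left.orth_disjoint t' t ht) h1 h.mem_left
  have h2 : -u ∉ D'.orth t' := fun h2 =>
    Set.disjoint_left.1 (h.right.orth_disjoint t' t ht) h2 h.mem_right
  rw [MarkedPolytope.glue]
  simp only
  rw [Set.sdiff_singleton_eq_self h1, Set.sdiff_singleton_eq_self h2]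

/-- Orthogonal facets on different sides of a common facet are different. -/
lemma IsGluing.disjoint_orth {D' : MarkedPolytope} (h : IsGluing D D' t u) {t' : FacetType}
    (ht : t' ≠ t) : Disjoint (D.orth t') (D'.orth t') := by
  rw [Set.disjoint_left]
  intro y hy hy'
  have h1 : y ≠ u := by
    rintro rfl
    exact Set.disjoint_left.1 (h.left.orth_disjoint t' t ht) hy h.mem_left
  have h2 : y ≠ -u := by
    rintro rfl
    exact Set.disjoint_left.1 (h.right.orth_disjoint t' t ht) hy' h.mem_right
  have h3 := h.cross (h.left.orth_subset t' hy) (h.left.orth_orth t t' u h.mem_left y hy h1)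
    (h.right.orth_subset t' hy') (h.right.orth_orth t t' (-u) h.mem_right y hy' h2)
  rw [h.left.coxeter.unit y (h.left.orth_subset t' hy)] at h3
  norm_num at h3

lemma orth_C_truncatedSimplex (e v : Fin 5 → LorentzSpace) :
    (truncatedSimplex e v).orth .C = {v 4} := by
  ext u
  constructor
  · rintro ⟨i, hi, rfl⟩
    fin_cases i <;> first | rfl | cases hi
  · rintro rfl
    exact ⟨4, rfl, rfl⟩

/-- Every domino has free facets of type `A` and `B`. -/
lemma IsDomino.orth_nonempty {ℓ m n : ℕ} (h : IsDomino ℓ m n D) {i j : Fin 5} (hij : i ≠ j)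
    (hi : orthFacetType i = t) (hj : orthFacetType j = t) : (D.orth t).Nonempty := by
  cases h with
  | tile e v h => exact ⟨v i, i, hi, rfl⟩
  | glue ℓ m n D e v t' u hD h hu hu' hfacet =>
    by_cases h1 : v i = -u
    · refine ⟨v j, Or.inr ⟨⟨j, hj, rfl⟩, fun h2 => hij ?_⟩⟩
      exact h.vertex_injective (h1.trans h2.symm)
    · exact ⟨v i, Or.inr ⟨⟨i, hi, rfl⟩, h1⟩⟩

/-- The number of free facets of type `C`. -/
lemma IsDomino.ncard_orth_C {ℓ m n : ℕ} (h : IsDomino ℓ m n D) :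
    (D.orth .C).ncard + n = 1 + 2 * (ℓ + m) := by
  induction h with
  | tile e v h => simp [orth_C_truncatedSimplex]
  | glue ℓ m n D e v t u hD h hu hu' hfacet ih =>
    have hg := IsGluing.mk hD.isGlueable h.isGlueable hu hu' hfacet
    have hfin : (D.orth .C).Finite :=
      hD.isGlueable.finite.subset (hD.isGlueable.orth_subset .C)
    have key : FacetType.C ≠ t → ((D.glue (truncatedSimplex e v) u).orth .C).ncard
        = (D.orth .C).ncard + 1 := by
      intro ht
      rw [hg.orth_of_ne ht, Set.ncard_union_eq (hg.disjoint_orth ht) hfin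
        (by rw [orth_C_truncatedSimplex]; exact Set.finite_singleton _),
        orth_C_truncatedSimplex, Set.ncard_singleton]
    cases t with
    | A => rw [key nofun]; simp only [FacetType.count]; omega
    | B => rw [key nofun]; simp only [FacetType.count]; omega
    | C =>
      have h1 : (D.glue (truncatedSimplex e v) u).orth .C = D.orth .C \ {u} := by
        rw [orth_C_truncatedSimplex, Set.mem_singleton_iff] at hu'
        rw [MarkedPolytope.glue]
        simp only [orth_C_truncatedSimplex, hu', Set.sdiff_self, Set.union_empty]
      have h2 := Set.ncard_sdiff_singleton_add_one hu hfin
      rw [h1]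
      simp only [FacetType.count]
      omega

/-- All gluings of type A come first, then those of type B, then those of type C. Each of the first
two kinds yields one more free facet of type C, each of the last kind uses one up, and the tile has
a single one; so c gluings of type C are possible if c ≤ ℓ + m + 1. -/
theorem exists_isDomino {ℓ m c : ℕ} (h : c ≤ ℓ + m + 1) :
    ∃ D, IsDomino ℓ m (ℓ + m + c) D := by
  induction c with
  | zero =>
    induction m with
    | zero =>
      induction ℓ with
      | zero =>
        obtain ⟨e, v, h⟩ := exists_isTile
        exact ⟨_, IsDomino.tile e v h⟩
      | succ ℓ ih =>
        obtain ⟨D, hD⟩ := ih (by omega)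
        exact hD.exists_glue (t := .A) (hD.orth_nonempty (i := 0) (j := 2) (by decide) rfl rfl)
    | succ m ih =>
      obtain ⟨D, hD⟩ := ih (by omega)
      exact hD.exists_glue (t := .B) (hD.orth_nonempty (i := 1) (j := 3) (by decide) rfl rfl)
  | succ c ih =>
    obtain ⟨D, hD⟩ := ih (by omega)
    refine hD.exists_glue (t := .C) (Set.nonempty_of_ncard_ne_zero ?_)
    have := hD.ncard_orth_C
    omega

end DominoExistence

theorem mainTheorem2 :
    (∀ ℓ m n : ℕ, Admissible ℓ m n →
      (∃ D : MarkedPolytope, IsDomino ℓ m n D) ∧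
      (∃ (α β : ℝ) (ω : Fin 7 → ℂ),
        Function.Injective ω ∧ (∀ i, ‖ω i‖ = 1 ∧ 0 < (ω i).im) ∧
        ((dominoQ ℓ m n).map (Int.castRingHom ℂ)).roots =
          ({(α : ℂ), ((1 / α : ℝ) : ℂ), (β : ℂ), ((1 / β : ℝ) : ℂ)} : Multiset ℂ)
            + (Finset.univ : Finset (Fin 7)).val.map ω
            + (Finset.univ : Finset (Fin 7)).val.map (fun i => (starRingEnd ℂ) (ω i)) ∧
        0 < 1 / α ∧ 1 / α < 1 / β ∧ 1 / β < 1 ∧ 1 < β ∧ β < α ∧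
        (∀ D : MarkedPolytope, IsDomino ℓ m n D → D.rate = α) ∧
        4 * (n : ℝ) + 5 < α ∧ α < 4 * (n : ℝ) + m + ℓ + 6) ∧
      (∀ p : ℤ[X], p.natDegree = 2 → ¬ p ∣ dominoQ ℓ m n)) ∧
    (∀ K : ℝ, ∃ N : ℕ, ∀ ℓ m n : ℕ, N ≤ n → Admissible ℓ m n →
      ∀ D : MarkedPolytope, IsDomino ℓ m n D → K < D.rate) := by
  -- Any description of the roots in this form determines the rate, as 1/α is then the root of least
  -- modulus.
  have rate : ∀ {ℓ m n : ℕ} {D : MarkedPolytope}, IsDomino ℓ m n D → ∀ {α β : ℝ} {ω : Fin 7 → ℂ},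
      (∀ i, ‖ω i‖ = 1 ∧ 0 < (ω i).im) →
      ((dominoQ ℓ m n).map (Int.castRingHom ℂ)).roots =
        ({(α : ℂ), ((1 / α : ℝ) : ℂ), (β : ℂ), ((1 / β : ℝ) : ℂ)} : Multiset ℂ)
          + (Finset.univ : Finset (Fin 7)).val.map ω
          + (Finset.univ : Finset (Fin 7)).val.map (fun i => (starRingEnd ℂ) (ω i)) →
      1 < β → β < α → D.rate = α := by
    intro ℓ m n D hD α β ω hω hroots hβ hβα
    have hα0 : 0 < α := by linarith
    have hβ0 : 0 < β := by linarith
    have h1 : 1 / α < 1 := (div_lt_one hα0).2 (by linarith)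
    refine hD.rate_eq hα0 (fun z hz => ?_) (by rw [hroots]; simp)
    rw [hroots] at hz
    simp only [Multiset.mem_add, Multiset.insert_eq_cons, Multiset.mem_cons,
      Multiset.mem_singleton, Multiset.mem_map] at hz
    rcases hz with ((rfl | rfl | rfl | rfl) | ⟨i, -, rfl⟩) | ⟨i, -, rfl⟩
    · rw [Complex.norm_real, Real.norm_of_nonneg hα0.le]
      linarith
    · rw [Complex.norm_real, Real.norm_of_nonneg (by positivity)]
    · rw [Complex.norm_real, Real.norm_of_nonneg hβ0.le]
      linarith
    · rw [Complex.norm_real, Real.norm_of_nonneg (by positivity)]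
      exact one_div_le_one_div_of_le hβ0 hβα.le
    · rw [(hω i).1]
      exact h1.le
    · rw [RCLike.norm_conj, (hω i).1]
      exact h1.le
  refine ⟨fun ℓ m n hadm => ⟨?_, ?_, fun p hp => not_dvd_dominoQ hadm.1 hp⟩, fun K => ?_⟩
  · obtain ⟨h, hodd, heven⟩ := hadm
    obtain ⟨c, rfl⟩ := Nat.exists_eq_add_of_le h
    refine exists_isDomino ?_
    -- With n = ℓ + m + c, admissibility reads c ≤ ℓ + m + 1 for odd n and c ≤ ℓ + m for even n.
    have h1 : (c : ℝ) ≤ ℓ + m + 1 := by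
      push_cast at hodd heven
      rcases Nat.even_or_odd (ℓ + m + c) with h2 | h2
      · linarith [heven h2]
      · linarith [hodd h2]
    exact_mod_cast h1
  · obtain ⟨α, β, ω, hinj, hω, hroots, hβ, hβα, h5, h6, -⟩ := exists_roots_dominoQ ℓ m n hadm.1
    have hα0 : 0 < α := by linarith
    have hβ0 : 0 < β := by linarith
    refine ⟨α, β, ω, hinj, hω, hroots, by positivity, one_div_lt_one_div_of_lt hβ0 hβα,
      (div_lt_one hβ0).2 hβ, hβ, hβα, fun D hD => rate hD hω hroots hβ hβα, h5, ?_⟩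
    have hℓ : (0 : ℝ) ≤ ℓ := ℓ.cast_nonneg
    have hm : (0 : ℝ) ≤ m := m.cast_nonneg
    linarith
  · obtain ⟨N, hN⟩ := exists_nat_ge K
    refine ⟨N, fun ℓ m n hn hadm D hD => ?_⟩
    obtain ⟨α, β, ω, -, hω, hroots, hβ, hβα, h5, -⟩ := exists_roots_dominoQ ℓ m n hadm.1
    rw [rate hD hω hroots hβ hβα]
    have h1 : (N : ℝ) ≤ n := by exact_mod_cast hn
    have h2 : (0 : ℝ) ≤ n := n.cast_nonneg
    linarith
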